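/- **Theorem 1.4.** Let $(\overline M,g)$ be a compact Riemannian manifold of dimension $d\ge 2$ with smooth boundary $\partial M$ and interior $M$, and with smooth metric $g$. Suppose that $\partial M$ is strictly convex (its second fundamental form is positive definite) and that $\overline M$ is non-trapping (every maximal geodesic has finite length). Let $SM$ be the unit sphere bundle, with volume form $d\Sigma$, let $\phi_s$ be the geodesic flow with generator $X$, let $\partial_\pm SM$ be the sets of unit vectors $(x,v)$ with $x\in\partial M$ and $\pm\langle n(x),v\rangle_g>0$, where $n$ is the unit outer normal, and put $SM_T=(0,T)\times SM$, $\partial_\pm SM_T=(0,T)\times\partial_\pm SM$. For $\sigma\in L^\infty(SM)$ and $N:SM\times\mathbb R\to\mathbb R$ consider $$\partial_t f+Xf+\sigma f+N(x,v,f)=0\ \text{ in } SM_T,\qquad f=f_0\ \text{ on }\{0\}\times SM,\qquad f=f_-\ \text{ on }\partial_-SM_T ,$$ where $f\in L^\infty(SM_T)$ is a solution if, along almost every characteristic $s\mapsto(t+s,\phi_s(x,v))$, it satisfies the equation in integrated form with the given initial or incoming value. Let $\mathcal A_{\sigma,N}(f_0,f_-)=f|_{\partial_+SM_T}\in L^\infty(\partial_+SM_T)$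 be the outgoing trace of the solution, which is defined for sufficiently small data. There is $T_0>0$, depending only on $(\overline M,g)$, such that the following holds for every $T\ge T_0$. Let $\sigma_1,\sigma_2\in L^\infty(SM)$ satisfy $0\le\sigma_j\le\sigma^0$ a.e. for some positive constant $\sigma^0$, let $q_1,q_2\in L^\infty(SM)$, and let $N_j(x,v,z)=q_j(x,v)N_0(z)$, where $N_0:\mathbb R\to\mathbb R$ is differentiable, twice differentiable at $0$ with $N_0''(0)>0$, and for some integer $\ell\ge2$ and constants $C_1,C_2>0$ satisfies $$|N_0(z)|\le C_1|z|^\ell,\qquad |N_0'(z)|\le C_2|z|^{\ell-1}\qquad\text{for all } z\in\mathbb R .$$ If there is $\delta>0$ such that $\mathcal A_{\sigma_1,N_1}(h,0)=\mathcal A_{\sigma_2,N_2}(h,0)$ for every $h\in L^\infty(SM)$ with $\|h\|_{L^\infty(SM)}\le\delta$ for which both sides are defined, then $$\sigma_1=\sigma_2\quad\text{and}\quad q_1=q_2\quad\text{a.e. in }SM,$$ hence $N_1(x,v,z)=N_2(x,v,z)$ for a.e. $(x,v)\in SM$ and all $z\in\mathbb R$. -/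

import Mathlib

open Set MeasureTheory Manifold Bundle
open scoped ENNReal ContDiff Topology

noncomputable section

namespace TransportIP

/-- Coordinate space of dimension `d = n + 1`; charts take values in the half space `0 ≤ y 0`. -/
abbrev Coord (n : ℕ) : Type := EuclideanSpace ℝ (Fin (n + 1))

/-- A smooth Riemannian metric on a smooth manifold with boundary `M` of dimension `n + 1`. -/
abbrev Metric (n : ℕ) (M : Type*) [TopologicalSpace M]
    [ChartedSpace (EuclideanHalfSpace (n + 1)) M] [IsManifold (𝓡∂ (n + 1)) ∞ M] :=
  ContMDiffRiemannianMetric (𝓡∂ (n + 1)) ∞ (Coord n)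
    (fun x : M => TangentSpace (𝓡∂ (n + 1)) x)

section

variable {n : ℕ} {M : Type*} [TopologicalSpace M]
  [ChartedSpace (EuclideanHalfSpace (n + 1)) M] [IsManifold (𝓡∂ (n + 1)) ∞ M]

/-- The tangent bundle carries its Borel σ-algebra. -/
instance tangentMeasurableSpace : MeasurableSpace (TangentBundle (𝓡∂ (n + 1)) M) := borel _

instance tangentBorelSpace : BorelSpace (TangentBundle (𝓡∂ (n + 1)) M) := ⟨rfl⟩

/-! ### Coordinates -/

/-- Position coordinates in the chart centred at `x₀`. -/
def pos (x₀ : M) (p : TangentBundle (𝓡∂ (n + 1)) M) : Coord n :=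
  extChartAt (𝓡∂ (n + 1)) x₀ p.1

/-- Velocity coordinates in the chart centred at `x₀`: the components of the vector `p.2` in the
coordinate frame of that chart. -/
def vel (x₀ : M) (p : TangentBundle (𝓡∂ (n + 1)) M) : Coord n :=
  (trivializationAt (Coord n) (TangentSpace (𝓡∂ (n + 1)) : M → Type _) x₀ p).2

/-- The tangent vector at `x` with components `u` in the coordinate frame of the chart at `x₀`. -/
def frameVec (x₀ x : M) (u : Coord n) : TangentSpace (𝓡∂ (n + 1)) x :=
  (trivializationAt (Coord n) (TangentSpace (𝓡∂ (n + 1)) : M → Type _) x₀).symmL ℝ x u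

/-- The point of the tangent bundle with coordinates `(y, u)` in the chart centred at `x₀`. -/
def param (x₀ : M) (z : Coord n × Coord n) : TangentBundle (𝓡∂ (n + 1)) M :=
  ⟨(extChartAt (𝓡∂ (n + 1)) x₀).symm z.1,
    frameVec x₀ ((extChartAt (𝓡∂ (n + 1)) x₀).symm z.1) z.2⟩

/-- The metric in the chart centred at `x₀`: `∑ gᵢⱼ(y) uⁱ wʲ`. -/
def gram (g : Metric n M) (x₀ : M) (y u w : Coord n) : ℝ :=
  g.inner ((extChartAt (𝓡∂ (n + 1)) x₀).symm y)
    (frameVec x₀ _ u) (frameVec x₀ _ w)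

/-- The matrix `(gᵢⱼ(y))`. -/
def gramMatrix (g : Metric n M) (x₀ : M) (y : Coord n) : Matrix (Fin (n + 1)) (Fin (n + 1)) ℝ :=
  Matrix.of fun i j => gram g x₀ y (EuclideanSpace.single i 1) (EuclideanSpace.single j 1)

/-- The directional derivative `∑ ∂ₖgᵢⱼ(y) aᵏ uⁱ wʲ`. -/
def dgram (g : Metric n M) (x₀ : M) (y a u w : Coord n) : ℝ :=
  fderivWithin ℝ (fun y' => gram g x₀ y' u w) (range (𝓡∂ (n + 1))) y a

/-- The Christoffel symbols of the first kind, contracted: `∑ Γₖ,ᵢⱼ(y) uⁱ uʲ wᵏ` with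
`Γₖ,ᵢⱼ = (∂ᵢ gⱼₖ + ∂ⱼ gᵢₖ - ∂ₖ gᵢⱼ) / 2`. -/
def christoffel (g : Metric n M) (x₀ : M) (y u w : Coord n) : ℝ :=
  dgram g x₀ y u u w - dgram g x₀ y w u u / 2

/-! ### The unit sphere bundle, its volume and its boundary -/

/-- The unit sphere bundle over the whole manifold with boundary. The part over the boundary is a
null set for the volume `sphereVolume`. -/
def UnitBundle (g : Metric n M) : Type _ :=
  {p : TangentBundle (𝓡∂ (n + 1)) M // g.inner p.1 p.2 p.2 = 1}

instance (g : Metric n M) : TopologicalSpace (UnitBundle g) :=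
  inferInstanceAs (TopologicalSpace {p : TangentBundle (𝓡∂ (n + 1)) M // g.inner p.1 p.2 p.2 = 1})

instance (g : Metric n M) : MeasurableSpace (UnitBundle g) :=
  inferInstanceAs (MeasurableSpace {p : TangentBundle (𝓡∂ (n + 1)) M // g.inner p.1 p.2 p.2 = 1})

/-- The volume of the tangent bundle, `det (gᵢⱼ) dy du` in every chart. It is the supremum of
these chart expressions, which agree on overlaps. -/
def tangentVolume (g : Metric n M) : Measure (TangentBundle (𝓡∂ (n + 1)) M) :=
  ⨆ x₀ : M, Measure.map (param x₀)
    (((volume : Measure (Coord n × Coord n)).restrict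
        ((extChartAt (𝓡∂ (n + 1)) x₀).target ×ˢ univ)).withDensity
      fun z => ENNReal.ofReal (gramMatrix g x₀ z.1).det)

/-- The boundary point of the coordinate half space with tangential coordinates `y`. -/
def bdryPt (y : EuclideanSpace ℝ (Fin n)) : Coord n :=
  WithLp.toLp 2 (Fin.cons (α := fun _ => ℝ) 0 (fun i => y i))

/-- The volume of the tangent bundle restricted to the boundary: the product of the induced
surface measure of the boundary and the Lebesgue measure of the tangent spaces. -/
def tangentBoundaryVolume (g : Metric n M) : Measure (TangentBundle (𝓡∂ (n + 1)) M) :=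
  ⨆ x₀ : M, Measure.map (fun z => param x₀ (bdryPt z.1, z.2))
    (((volume : Measure (EuclideanSpace ℝ (Fin n) × Coord n)).restrict
        {z | bdryPt z.1 ∈ (extChartAt (𝓡∂ (n + 1)) x₀).target}).withDensity
      fun z => ENNReal.ofReal
        (√((gramMatrix g x₀ (bdryPt z.1)).submatrix Fin.succ Fin.succ).det *
          √(gramMatrix g x₀ (bdryPt z.1)).det))

/-- Radial projection `(x, v) ↦ (x, v / |v|)`. -/
def normalize (g : Metric n M) (p : TangentBundle (𝓡∂ (n + 1)) M) :
    TangentBundle (𝓡∂ (n + 1)) M :=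
  ⟨p.1, (√(g.inner p.1 p.2 p.2))⁻¹ • p.2⟩

/-- From a measure on the tangent bundle that is Lebesgue measure on the fibres, the measure on the
unit sphere bundle that is the surface measure on the fibres: the cone over a subset of the unit
sphere in dimension `d = n + 1` has `1 / d` times its surface measure as volume. -/
def sphereMeasure (g : Metric n M) (μ : Measure (TangentBundle (𝓡∂ (n + 1)) M)) :
    Measure (UnitBundle g) :=
  ((n + 1 : ℕ) : ℝ≥0∞) •
    (Measure.map (normalize g)
      (μ.restrict {p | 0 < g.inner p.1 p.2 p.2 ∧ g.inner p.1 p.2 p.2 ≤ 1})).comap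
      (fun p : UnitBundle g => p.1)

/-- The volume `dΣ` of the unit sphere bundle. -/
def sphereVolume (g : Metric n M) : Measure (UnitBundle g) :=
  sphereMeasure g (tangentVolume g)

/-- The volume of the boundary of the unit sphere bundle (a measure carried by the vectors whose
base point is in the boundary). -/
def sphereBoundaryVolume (g : Metric n M) : Measure (UnitBundle g) :=
  sphereMeasure g (tangentBoundaryVolume g)

/-- `ν` is the unit outer normal vector at the boundary point `x`. Vectors tangent to the boundary
have vanishing zeroth component, outward ones have negative zeroth component. -/
def IsOuterUnitNormal (g : Metric n M) (x : M) (ν : TangentSpace (𝓡∂ (n + 1)) x) : Prop :=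
  g.inner x ν ν = 1 ∧
  (∀ w : TangentSpace (𝓡∂ (n + 1)) x, vel (n := n) x ⟨x, w⟩ 0 = 0 → g.inner x ν w = 0) ∧
  vel (n := n) x ⟨x, ν⟩ 0 < 0

/-- The outgoing boundary `∂₊SM`. -/
def outgoing (g : Metric n M) : Set (UnitBundle g) :=
  {p | p.1.1 ∈ (𝓡∂ (n + 1)).boundary M ∧
    ∃ ν, IsOuterUnitNormal g p.1.1 ν ∧ 0 < g.inner p.1.1 ν p.1.2}

/-- The boundary is strictly convex: its second fundamental form
`II(u, u) = - ⟨∇ᵤ u, ν⟩ = - ∑ Γₖ,ᵢⱼ uⁱ uʲ νᵏ` with respect to the outer unit normal `ν` is positive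
definite. -/
def StrictlyConvexBoundary (g : Metric n M) : Prop :=
  ∀ x ∈ (𝓡∂ (n + 1)).boundary M, ∀ ν, IsOuterUnitNormal g x ν →
    ∀ u : Coord n, u 0 = 0 → u ≠ 0 →
      0 < -christoffel g x (extChartAt (𝓡∂ (n + 1)) x x) u (vel (n := n) x ⟨x, ν⟩)

/-! ### Geodesics and travel times -/

/-- On the interval `J`, the curve `c` in the unit sphere bundle is an orbit `s ↦ (γ(s), γ'(s))`
of the geodesic flow: in every chart, with `y` the position and `u` the velocity, `y' = u` and
`gₖₗ (uˡ)' + Γₖ,ᵢⱼ uⁱ uʲ = 0`. -/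
def IsGeodesicOn (g : Metric n M) (c : ℝ → UnitBundle g) (J : Set ℝ) : Prop :=
  ContinuousOn c J ∧
  ∀ t ∈ J, ∀ x₀ : M, (c t).1.1 ∈ (chartAt (EuclideanHalfSpace (n + 1)) x₀).source →
    HasDerivWithinAt (fun s => pos x₀ (c s).1) (vel x₀ (c t).1) J t ∧
    ∃ a : Coord n, HasDerivWithinAt (fun s => vel x₀ (c s).1) a J t ∧
      ∀ w : Coord n, gram g x₀ (pos x₀ (c t).1) a w +
        christoffel g x₀ (pos x₀ (c t).1) (vel x₀ (c t).1) w = 0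

/-- The manifold is non-trapping: every maximal geodesic has finite length, that is, for each unit
vector the lengths of the geodesics issuing from it are bounded. -/
def NonTrapping (g : Metric n M) : Prop :=
  ∀ p : UnitBundle g, BddAbove
    {s : ℝ | 0 ≤ s ∧ ∃ c : ℝ → UnitBundle g, c 0 = p ∧ IsGeodesicOn g c (Icc 0 s)}

/-- The backward travel time `τ₋(x, v)`: the maximal geodesic `γ` with `(γ(0), γ'(0)) = (x, v)`
starts at parameter `-τ₋(x, v)`. -/
def backwardTime (g : Metric n M) (p : UnitBundle g) : ℝ :=
  sSup {s : ℝ | 0 ≤ s ∧ ∃ c : ℝ → UnitBundle g, c 0 = p ∧ IsGeodesicOn g c (Icc (-s) 0)}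

/-! ### The transport equation and the measurement operator -/

/-- The volume of `SM_T = (0, T) × SM`. -/
def spaceTime (g : Metric n M) (T : ℝ) : Measure (ℝ × UnitBundle g) :=
  (volume.restrict (Ioo 0 T)).prod (sphereVolume g)

/-- The volume of `∂₊SM_T = (0, T) × ∂₊SM`. -/
def outgoingSpaceTime (g : Metric n M) (T : ℝ) : Measure (ℝ × UnitBundle g) :=
  (volume.restrict (Ioo 0 T)).prod ((sphereBoundaryVolume g).restrict (outgoing g))

/-- The problem `∂ₜf + Xf + σf + N(·, f) = 0`, `f = f₀` at time zero, `f = fm` on the incoming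
boundary, assigns the value `a` to `f` at `(t, p)`. As `(∂ₜ + X) f = d/dk f(t + k, φₖ(p))`, this is
the equation integrated along the characteristic `s ↦ (t - s, φ₋ₛ(p))` from the point where this
leaves `(0, T) × SM` backwards, either through time zero (if `t < τ₋(p)`) or through the incoming
boundary. -/
def CharacteristicValue (g : Metric n M) (σ : UnitBundle g → ℝ) (N : UnitBundle g → ℝ → ℝ)
    (f₀ : UnitBundle g → ℝ) (fm f : ℝ → UnitBundle g → ℝ)
    (t : ℝ) (p : UnitBundle g) (a : ℝ) : Prop :=
  ∃ c : ℝ → UnitBundle g, c 0 = p ∧ IsGeodesicOn g c (Icc (-backwardTime g p) 0) ∧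
    IntervalIntegrable
      (fun s => σ (c (-s)) * f (t - s) (c (-s)) + N (c (-s)) (f (t - s) (c (-s))))
      volume 0 (min t (backwardTime g p)) ∧
    a = (if t < backwardTime g p then f₀ (c (-t))
          else fm (t - backwardTime g p) (c (-backwardTime g p))) -
      ∫ s in (0 : ℝ)..min t (backwardTime g p),
        (σ (c (-s)) * f (t - s) (c (-s)) + N (c (-s)) (f (t - s) (c (-s))))

/-- `f ∈ L^∞(SM_T)` solves the initial boundary value problem
`∂ₜf + Xf + σf + N(x, v, f) = 0` in `SM_T`, `f = f₀` on `{0} × SM`, `f = fm` on `∂₋SM_T`. -/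
def IsSolution (g : Metric n M) (T : ℝ) (σ : UnitBundle g → ℝ) (N : UnitBundle g → ℝ → ℝ)
    (f₀ : UnitBundle g → ℝ) (fm f : ℝ → UnitBundle g → ℝ) : Prop :=
  MemLp (fun z : ℝ × UnitBundle g => f z.1 z.2) ∞ (spaceTime g T) ∧
  ∀ᵐ z ∂(spaceTime g T), CharacteristicValue g σ N f₀ fm f z.1 z.2 (f z.1 z.2)

/-- `m ∈ L^∞(∂₊SM_T)` is the trace `f|_{∂₊SM_T}` of the solution `f`. -/
def IsOutgoingTrace (g : Metric n M) (T : ℝ) (σ : UnitBundle g → ℝ) (N : UnitBundle g → ℝ → ℝ)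
    (f₀ : UnitBundle g → ℝ) (fm f m : ℝ → UnitBundle g → ℝ) : Prop :=
  MemLp (fun z : ℝ × UnitBundle g => m z.1 z.2) ∞ (outgoingSpaceTime g T) ∧
  ∀ᵐ z ∂(outgoingSpaceTime g T), CharacteristicValue g σ N f₀ fm f z.1 z.2 (m z.1 z.2)

/-- The graph of the measurement operator: `A_{σ,N}(f₀, fm) = m`. -/
def IsMeasurement (g : Metric n M) (T : ℝ) (σ : UnitBundle g → ℝ) (N : UnitBundle g → ℝ → ℝ)
    (f₀ : UnitBundle g → ℝ) (fm m : ℝ → UnitBundle g → ℝ) : Prop :=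
  ∃ f : ℝ → UnitBundle g → ℝ, IsSolution g T σ N f₀ fm f ∧ IsOutgoingTrace g T σ N f₀ fm f m

/-- `σ ∈ L^∞(SM)` with `0 ≤ σ ≤ σ⁰` for some positive constant `σ⁰`. -/
def IsAbsorption (g : Metric n M) (σ : UnitBundle g → ℝ) : Prop :=
  MemLp σ ∞ (sphereVolume g) ∧
  ∃ s : ℝ, 0 < s ∧ ∀ᵐ p ∂(sphereVolume g), 0 ≤ σ p ∧ σ p ≤ s

end

end TransportIP

end

open Set MeasureTheory Manifold Bundle
open scoped ENNReal ContDiff Topology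

noncomputable section

set_option linter.unusedSectionVars false
set_option maxSynthPendingDepth 3

/-! The measurements are tested only on small constant initial values `ε` with zero incoming data.
Let `p` be outgoing with backward travel time `τ`. For `0 < t < τ` the characteristic through `(t,
p)` reaches time zero before it meets the boundary, so the trace `f(t, p)` is the end value of a
scalar semilinear equation along the last piece, of length `t`, of the orbit ending at `p`, with
starting value `ε`. Let `α`, `β` be `σ`, `q` along the backward orbit of `p`, and `A(t) = ∫₀ᵗ α`. As
`ε → 0`, `f / ε` tends to `exp(-A(t))`, and `(ε exp(-A(t)) - f) / ε²` tends to `(b / 2) ∫₀ᵗ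
exp(-A(r)) β(r) exp(-2 (A(t) - A(r))) dr`. The last integrand is `exp(-2 A(t)) exp(A(r)) β(r)`.
Equality of the traces for almost all `t` in `(0, τ)` therefore gives, by Lebesgue differentiation,
first `α` and then `β` almost everywhere (`coefficients_eq_of_semilinear`). The variable `t` does
the localization, so no other data are needed. `T₀` is a uniform bound for travel times: `t` then
sweeps every orbit completely.

The coefficients are only classes modulo null sets, and this needs a qualitative form of Santaló's
formula. On one hand, almost every orbit, from `SM` and from `∂₊SM`, meets a given null set only at
a null set of times (`ae_ae_backFlow_notMem`, `ae_outgoing_ae_backFlow_notMem`); hence solutions for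
bounded measurable representatives are solutions for the original coefficients. On the other hand, a
set avoided in this sense by almost every outgoing orbit is null (`null_of_ae_outgoing`); hence
equality along orbits is equality almost everywhere. Only null sets matter, so the volumes enter
through their cones in charts (`IsConical`), and the flow through Lipschitz bounds for it and its
inverses.

The geodesic equation lives on a manifold with boundary. In a chart the spray is extended from the
half space to a Lipschitz field on the whole coordinate space (`FlowBox`); a geodesic exists exactly
as long as the extended orbit stays in the half space (`FlowBox.backReach_iff`). This makes the
domain of the flow closed and the flow continuous on it. With compactness and non-trapping it yields
`T₀` (`exists_backReach_bound`). By strict convexity a geodesic of positive length meets the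
boundary only at its ends, and transversally, so interior and outgoing vectors are recognized by
their travel times.

The measurements must also be shown to exist. Picard iteration for a truncated nonlinearity produces
measurable solutions defined at every point, which are their own traces (`exists_measurement`). -/

namespace TransportIP


/-! ### Charts of the tangent bundle and the metric in coordinates. -/

section Coordinates

variable {n : ℕ} {M : Type*} [TopologicalSpace M]
  [ChartedSpace (EuclideanHalfSpace (n + 1)) M] [IsManifold (𝓡∂ (n + 1)) ∞ M]

/-- The domain of the chart centred at `x₀`. -/
abbrev chartDom (n : ℕ) {M : Type*} [TopologicalSpace M]
    [ChartedSpace (EuclideanHalfSpace (n + 1)) M] (x₀ : M) : Set M :=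
  (chartAt (EuclideanHalfSpace (n + 1)) x₀).source

/-- The image of the chart centred at `x₀` in the coordinate half space. -/
abbrev chartImg (n : ℕ) {M : Type*} [TopologicalSpace M]
    [ChartedSpace (EuclideanHalfSpace (n + 1)) M] (x₀ : M) : Set (Coord n) :=
  (extChartAt (𝓡∂ (n + 1)) x₀).target

/-- The closed coordinate half space. -/
abbrev halfSpace (n : ℕ) : Set (Coord n) := {y | 0 ≤ y 0}

theorem range_model (n : ℕ) : range (𝓡∂ (n + 1)) = halfSpace n :=
  range_modelWithCornersEuclideanHalfSpace (n + 1)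

theorem chartImg_subset (x₀ : M) : chartImg n x₀ ⊆ halfSpace n := by
  rw [← range_model]; exact extChartAt_target_subset_range x₀

theorem chartImg_mem_nhdsWithin {x₀ : M} {y : Coord n} (hy : y ∈ chartImg n x₀) :
    chartImg n x₀ ∈ 𝓝[halfSpace n] y := by
  rw [← range_model]; exact extChartAt_target_mem_nhdsWithin_of_mem hy

theorem convex_halfSpace (n : ℕ) : Convex ℝ (halfSpace n) :=
  range_model n ▸ (𝓡∂ (n + 1)).convex_range

theorem uniqueDiffOn_halfSpace (n : ℕ) : UniqueDiffOn ℝ (halfSpace n) :=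
  range_model n ▸ (𝓡∂ (n + 1)).uniqueDiffOn

theorem isClosed_halfSpace (n : ℕ) : IsClosed (halfSpace n) :=
  range_model n ▸ (𝓡∂ (n + 1)).isClosed_range

theorem vel_frameVec {x₀ x : M} (hx : x ∈ chartDom n x₀) (u : Coord n) :
    vel (n := n) x₀ ⟨x, frameVec x₀ x u⟩ = u := by
  have := (trivializationAt (Coord n) (TangentSpace (𝓡∂ (n + 1)) : M → Type _)
    x₀).continuousLinearMapAt_symmL (R := ℝ) (b := x) (by simpa using hx) u
  rw [Trivialization.continuousLinearMapAt_apply,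
    Trivialization.linearMapAt_apply, if_pos (by simpa using hx)] at this
  exact this

theorem frameVec_vel {x₀ : M} {p : TangentBundle (𝓡∂ (n + 1)) M} (hp : p.1 ∈ chartDom n x₀) :
    frameVec x₀ p.1 (vel x₀ p) = p.2 := by
  have := (trivializationAt (Coord n) (TangentSpace (𝓡∂ (n + 1)) : M → Type _)
    x₀).symmL_continuousLinearMapAt (R := ℝ) (b := p.1) (by simpa using hp) p.2
  rw [Trivialization.continuousLinearMapAt_apply,
    Trivialization.linearMapAt_apply, if_pos (by simpa using hp)] at this
  exact this

theorem frameVec_smul (x₀ x : M) (a : ℝ) (u : Coord n) :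
    frameVec x₀ x (a • u) = a • frameVec x₀ x u := map_smul _ _ _

theorem vel_smul {x₀ x : M} (hx : x ∈ chartDom n x₀) (a : ℝ) (v : TangentSpace (𝓡∂ (n + 1)) x) :
    vel (n := n) x₀ ⟨x, a • v⟩ = a • vel (n := n) x₀ ⟨x, v⟩ := by
  have h := vel_frameVec hx (a • vel (n := n) x₀ ⟨x, v⟩)
  rwa [frameVec_smul, frameVec_vel (p := ⟨x, v⟩) hx] at h

theorem vel_neg {x₀ x : M} (hx : x ∈ chartDom n x₀) (v : TangentSpace (𝓡∂ (n + 1)) x) :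
    vel (n := n) x₀ ⟨x, -v⟩ = - vel (n := n) x₀ ⟨x, v⟩ := by
  have := vel_smul hx (-1) v
  rwa [neg_one_smul, neg_one_smul] at this

theorem pos_mem {x₀ : M} {p : TangentBundle (𝓡∂ (n + 1)) M} (hp : p.1 ∈ chartDom n x₀) :
    pos x₀ p ∈ chartImg n x₀ :=
  (extChartAt (𝓡∂ (n + 1)) x₀).map_source (by simpa using hp)

theorem symm_mem {x₀ : M} {y : Coord n} (hy : y ∈ chartImg n x₀) :
    (extChartAt (𝓡∂ (n + 1)) x₀).symm y ∈ chartDom n x₀ := by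
  simpa using (extChartAt (𝓡∂ (n + 1)) x₀).map_target hy

theorem param_fst_mem {x₀ : M} {z : Coord n × Coord n} (hz : z.1 ∈ chartImg n x₀) :
    (param x₀ z).1 ∈ chartDom n x₀ := symm_mem hz

theorem pos_param {x₀ : M} {z : Coord n × Coord n} (hz : z.1 ∈ chartImg n x₀) :
    pos x₀ (param x₀ z) = z.1 :=
  (extChartAt (𝓡∂ (n + 1)) x₀).right_inv hz

theorem vel_param {x₀ : M} {z : Coord n × Coord n} (hz : z.1 ∈ chartImg n x₀) :
    vel x₀ (param x₀ z) = z.2 := vel_frameVec (symm_mem hz) _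

theorem symm_pos {x₀ : M} {p : TangentBundle (𝓡∂ (n + 1)) M} (hp : p.1 ∈ chartDom n x₀) :
    (extChartAt (𝓡∂ (n + 1)) x₀).symm (pos x₀ p) = p.1 :=
  (extChartAt (𝓡∂ (n + 1)) x₀).left_inv (by simpa using hp)

theorem tangent_mk_congr {x x' : M} (h : x' = x) (x₀ : M) (u : Coord n) :
    (⟨x', frameVec x₀ x' u⟩ : TangentBundle (𝓡∂ (n + 1)) M) = ⟨x, frameVec x₀ x u⟩ := by
  subst h; rfl

theorem param_coord {x₀ : M} {p : TangentBundle (𝓡∂ (n + 1)) M} (hp : p.1 ∈ chartDom n x₀) :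
    param x₀ (pos x₀ p, vel x₀ p) = p := by
  refine (tangent_mk_congr (symm_pos hp) x₀ (vel x₀ p)).trans ?_
  rw [frameVec_vel hp]

/-- Coordinates `(y, u)` on the tangent bundle in the chart centred at `x₀`. -/
def coord (x₀ : M) (p : TangentBundle (𝓡∂ (n + 1)) M) : Coord n × Coord n := (pos x₀ p, vel x₀ p)

theorem isOpen_tangentDom (x₀ : M) :
    IsOpen {p : TangentBundle (𝓡∂ (n + 1)) M | p.1 ∈ chartDom n x₀} :=
  (chartAt _ x₀).open_source.preimage (FiberBundle.continuous_proj (Coord n) _)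

theorem continuousOn_coord (x₀ : M) :
    ContinuousOn (coord (n := n) x₀) {p | p.1 ∈ chartDom n x₀} := by
  refine ContinuousOn.prodMk ?_ ?_
  · exact (continuousOn_extChartAt (I := 𝓡∂ (n + 1)) x₀).comp
      (FiberBundle.continuous_proj (Coord n) _).continuousOn (fun p hp => by simpa using hp)
  · refine continuous_snd.comp_continuousOn ((trivializationAt (Coord n)
      (TangentSpace (𝓡∂ (n + 1)) : M → Type _) x₀).continuousOn.mono fun p hp => ?_)
    simpa using hp

theorem continuousOn_param (x₀ : M) :
    ContinuousOn (param (n := n) x₀) (chartImg n x₀ ×ˢ univ) := by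
  have h := (trivializationAt (Coord n)
      (TangentSpace (𝓡∂ (n + 1)) : M → Type _) x₀).continuousOn_symm
  have h2 : ContinuousOn (fun z : Coord n × Coord n =>
      ((extChartAt (𝓡∂ (n + 1)) x₀).symm z.1, z.2)) (chartImg n x₀ ×ˢ univ) :=
    ((continuousOn_extChartAt_symm x₀).comp continuousOn_fst fun z hz => hz.1).prodMk
      continuousOn_snd
  refine (h.comp h2 fun z hz => ⟨by simpa using symm_mem hz.1, mem_univ _⟩).congr fun z hz => ?_
  unfold param frameVec
  rw [Trivialization.symmL_apply _ (by simpa using symm_mem hz.1)]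
  rfl

/-! ### The metric in coordinates -/

variable (g : Metric n M)

/-- The metric in coordinates as a bilinear form depending on the point. -/
def gramL (x₀ : M) (y : Coord n) : Coord n →L[ℝ] Coord n →L[ℝ] ℝ :=
  let x := (extChartAt (𝓡∂ (n + 1)) x₀).symm y
  let A := (trivializationAt (Coord n) (TangentSpace (𝓡∂ (n + 1)) : M → Type _) x₀).symmL ℝ x
  (ContinuousLinearMap.precomp ℝ A).comp ((g.inner x).comp A)

theorem gramL_apply (x₀ : M) (y u w : Coord n) : gramL g x₀ y u w = gram g x₀ y u w := rfl

theorem gram_comm (x₀ : M) (y u w : Coord n) : gram g x₀ y u w = gram g x₀ y w u := g.symm _ _ _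

theorem gram_pos {x₀ : M} {y : Coord n} (hy : y ∈ chartImg n x₀) {u : Coord n} (hu : u ≠ 0) :
    0 < gram g x₀ y u u := by
  refine g.pos _ _ fun h => hu ?_
  have h1 := vel_frameVec (symm_mem hy) u
  have h2 := vel_smul (n := n) (symm_mem hy) 0 (frameVec x₀ _ u)
  rw [h, zero_smul] at h2
  rw [h, h2, zero_smul] at h1
  exact h1.symm

theorem inner_eq_gram {x₀ : M} {x : M} (hx : x ∈ chartDom n x₀)
    (v w : TangentSpace (𝓡∂ (n + 1)) x) :
    g.inner x v w = gram g x₀ (extChartAt (𝓡∂ (n + 1)) x₀ x)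
      (vel (n := n) x₀ ⟨x, v⟩) (vel (n := n) x₀ ⟨x, w⟩) := by
  unfold gram
  have h : (extChartAt (𝓡∂ (n + 1)) x₀).symm (extChartAt (𝓡∂ (n + 1)) x₀ x) = x :=
    (extChartAt (𝓡∂ (n + 1)) x₀).left_inv (by simpa using hx)
  rw [h, frameVec_vel (p := ⟨x, v⟩) hx, frameVec_vel (p := ⟨x, w⟩) hx]

theorem inner_param (x₀ : M) (z : Coord n × Coord n) :
    g.inner (param x₀ z).1 (param x₀ z).2 (param x₀ z).2 = gram g x₀ z.1 z.2 z.2 := rfl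

theorem contMDiffOn_frameVec (x₀ : M) (u : Coord n) :
    ContMDiffOn (𝓡∂ (n + 1)) ((𝓡∂ (n + 1)).prod 𝓘(ℝ, Coord n)) ∞
      (fun x : M => (⟨x, frameVec x₀ x u⟩ : TangentBundle (𝓡∂ (n + 1)) M)) (chartDom n x₀) := by
  have h := (trivializationAt (Coord n)
      (TangentSpace (𝓡∂ (n + 1)) : M → Type _) x₀).contMDiffOn_symm
      (IB := 𝓡∂ (n + 1)) (n := ∞)
  have h2 : ContMDiffOn (𝓡∂ (n + 1)) ((𝓡∂ (n + 1)).prod 𝓘(ℝ, Coord n)) ∞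
      (fun x : M => ((x, u) : M × Coord n)) (chartDom n x₀) :=
    (contMDiff_id.prodMk contMDiff_const).contMDiffOn
  have hb : ∀ x ∈ chartDom n x₀, x ∈ (trivializationAt (Coord n)
      (TangentSpace (𝓡∂ (n + 1)) : M → Type _) x₀).baseSet := fun x hx => by simpa using hx
  refine (h.comp h2 fun x hx => ?_).congr fun x hx => ?_
  · rw [mem_preimage, Trivialization.target_eq]
    exact ⟨hb x hx, mem_univ _⟩
  unfold frameVec
  rw [Trivialization.symmL_apply _ (hb x hx)]
  exact Trivialization.mk_symm _ (hb x hx) u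

theorem contDiffOn_gram (x₀ : M) (u w : Coord n) :
    ContDiffOn ℝ ∞ (fun y => gram g x₀ y u w) (chartImg n x₀) := by
  have h : ContMDiffOn (𝓡∂ (n + 1)) ((𝓡∂ (n + 1)).prod 𝓘(ℝ, ℝ)) ∞
      (fun x : M => TotalSpace.mk' ℝ (E := Bundle.Trivial M ℝ) x
        (g.inner x (frameVec x₀ x u) (frameVec x₀ x w))) (chartDom n x₀) := by
    intro x hx
    apply ContMDiffWithinAt.clm_bundle_apply₂ (F₁ := Coord n) (F₂ := Coord n)
    · exact g.contMDiff.contMDiffAt.contMDiffWithinAt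
    · exact contMDiffOn_frameVec x₀ u x hx
    · exact contMDiffOn_frameVec x₀ w x hx
  have h' : ContMDiffOn (𝓡∂ (n + 1)) 𝓘(ℝ, ℝ) ∞
      (fun x : M => g.inner x (frameVec x₀ x u) (frameVec x₀ x w)) (chartDom n x₀) := by
    intro x hx
    have := h x hx
    simp only [contMDiffWithinAt_totalSpace] at this
    exact this.2
  have h3 := h'.comp (contMDiffOn_extChartAt_symm (I := 𝓡∂ (n + 1)) (n := ∞) x₀)
    (fun y hy => symm_mem hy)
  exact contMDiffOn_iff_contDiffOn.1 h3

theorem contDiffOn_gramL (x₀ : M) : ContDiffOn ℝ ∞ (gramL g x₀) (chartImg n x₀) :=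
  contDiffOn_clm_apply.2 fun u => contDiffOn_clm_apply.2 fun w => contDiffOn_gram g x₀ u w

end Coordinates


/-! ### Changes of chart and invariance of the geodesic equation. -/

section Transition

variable {n : ℕ} {M : Type*} [TopologicalSpace M]
  [ChartedSpace (EuclideanHalfSpace (n + 1)) M] [IsManifold (𝓡∂ (n + 1)) ∞ M]

/-- The change of coordinates from the chart centred at `x₀` to the chart centred at `x₁`. -/
def trans (n : ℕ) {M : Type*} [TopologicalSpace M]
    [ChartedSpace (EuclideanHalfSpace (n + 1)) M] (x₀ x₁ : M) : Coord n → Coord n :=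
  extChartAt (𝓡∂ (n + 1)) x₁ ∘ (extChartAt (𝓡∂ (n + 1)) x₀).symm

/-- The domain of the change of coordinates. -/
def transDom (n : ℕ) {M : Type*} [TopologicalSpace M]
    [ChartedSpace (EuclideanHalfSpace (n + 1)) M] (x₀ x₁ : M) : Set (Coord n) :=
  {y | y ∈ chartImg n x₀ ∧ (extChartAt (𝓡∂ (n + 1)) x₀).symm y ∈ chartDom n x₁}

/-- The derivative of the change of coordinates. -/
def dtrans (n : ℕ) {M : Type*} [TopologicalSpace M]
    [ChartedSpace (EuclideanHalfSpace (n + 1)) M] (x₀ x₁ : M) (y : Coord n) :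
    Coord n →L[ℝ] Coord n :=
  fderivWithin ℝ (trans n x₀ x₁) (halfSpace n) y

theorem transDom_subset (x₀ x₁ : M) : transDom n x₀ x₁ ⊆ halfSpace n :=
  fun _ hy => chartImg_subset x₀ hy.1

theorem pos_mem_transDom {x₀ x₁ : M} {p : TangentBundle (𝓡∂ (n + 1)) M}
    (h0 : p.1 ∈ chartDom n x₀) (h1 : p.1 ∈ chartDom n x₁) : pos x₀ p ∈ transDom n x₀ x₁ :=
  ⟨pos_mem h0, by rwa [symm_pos h0]⟩

theorem trans_mem {x₀ x₁ : M} {y : Coord n} (hy : y ∈ transDom n x₀ x₁) :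
    trans n x₀ x₁ y ∈ chartImg n x₁ :=
  (extChartAt (𝓡∂ (n + 1)) x₁).map_source (by simpa using hy.2)

theorem transDom_mem_nhdsWithin {x₀ x₁ : M} {y : Coord n} (hy : y ∈ transDom n x₀ x₁) :
    transDom n x₀ x₁ ∈ 𝓝[halfSpace n] y := by
  have h1 : (extChartAt (𝓡∂ (n + 1)) x₀).symm ⁻¹' chartDom n x₁ ∈ 𝓝[chartImg n x₀] y :=
    (continuousOn_extChartAt_symm x₀).continuousWithinAt hy.1
      ((chartAt _ x₁).open_source.mem_nhds hy.2)
  have h2 : 𝓝[halfSpace n] y ≤ 𝓝[chartImg n x₀] y := by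
    rw [nhdsWithin_le_iff]; exact chartImg_mem_nhdsWithin hy.1
  exact Filter.inter_mem (chartImg_mem_nhdsWithin hy.1) (h2 h1)

theorem contDiffWithinAt_trans {x₀ x₁ : M} {y : Coord n} (hy : y ∈ transDom n x₀ x₁) :
    ContDiffWithinAt ℝ ∞ (trans n x₀ x₁) (halfSpace n) y := by
  rw [← range_model]
  refine contDiffWithinAt_ext_coord_change x₁ x₀ ?_
  simp only [PartialEquiv.trans_source, PartialEquiv.symm_source, mem_inter_iff, mem_preimage,
    extChartAt_source]
  exact ⟨hy.1, hy.2⟩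

theorem hasFDerivWithinAt_trans {x₀ x₁ : M} {y : Coord n} (hy : y ∈ transDom n x₀ x₁) :
    HasFDerivWithinAt (trans n x₀ x₁) (dtrans n x₀ x₁ y) (halfSpace n) y :=
  ((contDiffWithinAt_trans hy).differentiableWithinAt (by simp)).hasFDerivWithinAt

theorem contDiffWithinAt_dtrans {x₀ x₁ : M} {y : Coord n} (hy : y ∈ transDom n x₀ x₁) :
    ContDiffWithinAt ℝ 1 (dtrans n x₀ x₁) (halfSpace n) y :=
  (contDiffWithinAt_trans hy).fderivWithin_right (uniqueDiffOn_halfSpace n) (m := 1)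
    (by norm_cast) (transDom_subset _ _ hy)

theorem hasFDerivWithinAt_dtrans {x₀ x₁ : M} {y : Coord n} (hy : y ∈ transDom n x₀ x₁) :
    HasFDerivWithinAt (dtrans n x₀ x₁) (fderivWithin ℝ (dtrans n x₀ x₁) (halfSpace n) y)
      (halfSpace n) y :=
  ((contDiffWithinAt_dtrans hy).differentiableWithinAt (by simp)).hasFDerivWithinAt

theorem interior_halfSpace_dense {y : Coord n} (hy : y ∈ halfSpace n) :
    y ∈ closure (interior (halfSpace n)) := by
  rw [← range_model] at hy ⊢
  exact (𝓡∂ (n + 1)).range_subset_closure_interior hy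

/-- Symmetry of second derivatives persists at boundary points because the half space lies in the
closure of its interior. -/
theorem dtrans_symm {x₀ x₁ : M} {y : Coord n} (hy : y ∈ transDom n x₀ x₁) (u w : Coord n) :
    fderivWithin ℝ (dtrans n x₀ x₁) (halfSpace n) y u w =
      fderivWithin ℝ (dtrans n x₀ x₁) (halfSpace n) y w u :=
  ((contDiffWithinAt_trans hy).isSymmSndFDerivWithinAt
    (by simp only [minSmoothness_of_isRCLikeNormedField]; exact ENat.LEInfty.out) (uniqueDiffOn_halfSpace n)
    (interior_halfSpace_dense (transDom_subset _ _ hy)) (transDom_subset _ _ hy)) u w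

theorem pos_eq_trans {x₀ x₁ : M} {p : TangentBundle (𝓡∂ (n + 1)) M}
    (h0 : p.1 ∈ chartDom n x₀) : pos x₁ p = trans n x₀ x₁ (pos x₀ p) := by
  unfold trans
  rw [Function.comp_apply, symm_pos h0]; rfl

theorem vel_eq_dtrans {x₀ x₁ : M} {p : TangentBundle (𝓡∂ (n + 1)) M}
    (h0 : p.1 ∈ chartDom n x₀) (h1 : p.1 ∈ chartDom n x₁) :
    vel x₁ p = dtrans n x₀ x₁ (pos x₀ p) (vel x₀ p) := by
  have h := tangentCoordChange_comp (I := 𝓡∂ (n + 1)) (w := p.1) (x := x₀) (y := x₁) (z := p.1)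
    (v := p.2) (by simpa using ⟨h0, h1⟩)
  unfold dtrans
  rw [← range_model]
  exact h.symm

theorem gram_eq_trans (g : Metric n M) {x₀ x₁ : M} {y : Coord n} (hy : y ∈ transDom n x₀ x₁)
    (u w : Coord n) :
    gram g x₀ y u w =
      gram g x₁ (trans n x₀ x₁ y) (dtrans n x₀ x₁ y u) (dtrans n x₀ x₁ y w) := by
  have hx0 := symm_mem hy.1
  have key : ∀ u : Coord n, vel (n := n) x₁ ⟨_, frameVec x₀
      ((extChartAt (𝓡∂ (n + 1)) x₀).symm y) u⟩ = dtrans n x₀ x₁ y u := by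
    intro u
    rw [vel_eq_dtrans (p := ⟨_, frameVec x₀ ((extChartAt (𝓡∂ (n + 1)) x₀).symm y) u⟩) hx0 hy.2,
      vel_frameVec hx0]
    congr 1
    exact congrArg _ (pos_param (z := (y, u)) hy.1)
  unfold gram
  rw [inner_eq_gram g hy.2, key, key]
  rfl

theorem dtrans_surjective {x₀ x₁ : M} {y : Coord n} (hy : y ∈ transDom n x₀ x₁) :
    Function.Surjective (dtrans n x₀ x₁ y) := by
  intro w
  have hx0 := symm_mem hy.1
  refine ⟨vel (n := n) x₀ ⟨_, frameVec x₁ ((extChartAt (𝓡∂ (n + 1)) x₀).symm y) w⟩, ?_⟩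
  have h := vel_eq_dtrans (p := ⟨_, frameVec x₁ ((extChartAt (𝓡∂ (n + 1)) x₀).symm y) w⟩) hx0 hy.2
  rw [vel_frameVec hy.2] at h
  refine Eq.trans ?_ h.symm
  congr 1
  exact congrArg _ (pos_param (z := (y, w)) hy.1).symm

theorem hasFDerivWithinAt_gramL (g : Metric n M) {x₀ : M} {y : Coord n} (hy : y ∈ chartImg n x₀) :
    HasFDerivWithinAt (gramL g x₀) (fderivWithin ℝ (gramL g x₀) (halfSpace n) y)
      (halfSpace n) y :=
  ((((contDiffOn_gramL g x₀).differentiableOn (by simp)) y hy).mono_of_mem_nhdsWithin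
    (chartImg_mem_nhdsWithin hy)).hasFDerivWithinAt

theorem dgram_eq (g : Metric n M) {x₀ : M} {y : Coord n} (hy : y ∈ chartImg n x₀)
    (a u w : Coord n) :
    dgram g x₀ y a u w = fderivWithin ℝ (gramL g x₀) (halfSpace n) y a u w := by
  unfold dgram
  rw [range_model]
  have h := ((hasFDerivWithinAt_gramL g hy).clm_apply (hasFDerivWithinAt_const u y _)).clm_apply
    (hasFDerivWithinAt_const w y _)
  have h2 := h.fderivWithin (uniqueDiffOn_halfSpace n y (chartImg_subset _ hy))
  simp only [gramL_apply] at h2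
  rw [h2]
  simp

theorem dgram_trans (g : Metric n M) {x₀ x₁ : M} {y : Coord n} (hy : y ∈ transDom n x₀ x₁)
    (b u w : Coord n) :
    dgram g x₀ y b u w =
      dgram g x₁ (trans n x₀ x₁ y) (dtrans n x₀ x₁ y b) (dtrans n x₀ x₁ y u) (dtrans n x₀ x₁ y w) +
      gram g x₁ (trans n x₀ x₁ y) (fderivWithin ℝ (dtrans n x₀ x₁) (halfSpace n) y b u)
        (dtrans n x₀ x₁ y w) +
      gram g x₁ (trans n x₀ x₁ y) (dtrans n x₀ x₁ y u)
        (fderivWithin ℝ (dtrans n x₀ x₁) (halfSpace n) y b w) := by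
  have hS := transDom_mem_nhdsWithin hy
  have hsub := transDom_subset (n := n) x₀ x₁
  have h1 : HasFDerivWithinAt (fun y' => gramL g x₁ (trans n x₀ x₁ y')) _ (transDom n x₀ x₁) y :=
    HasFDerivWithinAt.comp (g := gramL g x₁) (t := halfSpace n) y
      (by convert hasFDerivWithinAt_gramL g (trans_mem hy) using 1) ((hasFDerivWithinAt_trans hy).mono hsub)
      (fun y' hy' => chartImg_subset _ (trans_mem hy'))
  have h2 := ((hasFDerivWithinAt_dtrans hy).mono hsub).clm_apply
    (hasFDerivWithinAt_const u y (transDom n x₀ x₁))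
  have h3 := ((hasFDerivWithinAt_dtrans hy).mono hsub).clm_apply
    (hasFDerivWithinAt_const w y (transDom n x₀ x₁))
  have h4 := ((h1.clm_apply h2).clm_apply h3).mono_of_mem_nhdsWithin hS
  have h5 := h4.congr_of_eventuallyEq (f₁ := fun y' => gram g x₀ y' u w) (by
    filter_upwards [hS] with y' hy'
    exact gram_eq_trans g hy' u w) (gram_eq_trans g hy u w)
  unfold dgram
  rw [range_model]
  rw [h5.fderivWithin (uniqueDiffOn_halfSpace n y (hsub hy))]
  have h6 := dgram_eq g (trans_mem hy) (dtrans n x₀ x₁ y b) (dtrans n x₀ x₁ y u)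
    (dtrans n x₀ x₁ y w)
  unfold dgram at h6
  rw [range_model] at h6
  rw [h6]
  simp [gramL_apply]
  ring

/-- The classical inhomogeneous transformation law. Differentiating `gram_eq_trans` produces terms
with the second derivative of the chart change; by its symmetry all of them cancel except one. -/
theorem christoffel_trans (g : Metric n M) {x₀ x₁ : M} {y : Coord n} (hy : y ∈ transDom n x₀ x₁)
    (u w : Coord n) :
    christoffel g x₀ y u w =
      christoffel g x₁ (trans n x₀ x₁ y) (dtrans n x₀ x₁ y u) (dtrans n x₀ x₁ y w) +
      gram g x₁ (trans n x₀ x₁ y) (fderivWithin ℝ (dtrans n x₀ x₁) (halfSpace n) y u u)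
        (dtrans n x₀ x₁ y w) := by
  unfold christoffel
  rw [dgram_trans g hy, dgram_trans g hy, dtrans_symm hy w u,
    gram_comm g x₁ _ (fderivWithin ℝ (dtrans n x₀ x₁) (halfSpace n) y u w)]
  ring

/-- The geodesic equation at time `t` in the chart centred at `x₀`. -/
def GeodesicEqAt (g : Metric n M) (x₀ : M) (c : ℝ → UnitBundle g) (J : Set ℝ) (t : ℝ) : Prop :=
  HasDerivWithinAt (fun s => pos x₀ (c s).1) (vel x₀ (c t).1) J t ∧
    ∃ a : Coord n, HasDerivWithinAt (fun s => vel x₀ (c s).1) a J t ∧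
      ∀ w : Coord n, gram g x₀ (pos x₀ (c t).1) a w +
        christoffel g x₀ (pos x₀ (c t).1) (vel x₀ (c t).1) w = 0

theorem UnitBundle.continuous_val (g : Metric n M) :
    Continuous (fun p : UnitBundle g => p.1) := continuous_subtype_val

/-- The acceleration in the new chart contains the derivative of `dtrans` along the curve, which is
the inhomogeneous term of `christoffel_trans`. Thus it suffices to verify the geodesic equation in a
single chart. -/
theorem GeodesicEqAt.change_chart {g : Metric n M} {x₀ x₁ : M} {c : ℝ → UnitBundle g} {J : Set ℝ}
    {t : ℝ} (h : GeodesicEqAt g x₀ c J t) (hc : ContinuousWithinAt c J t)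
    (h0 : (c t).1.1 ∈ chartDom n x₀) (h1 : (c t).1.1 ∈ chartDom n x₁) :
    GeodesicEqAt g x₁ c J t := by
  obtain ⟨hp, a, hv, ha⟩ := h
  have hc' : ContinuousWithinAt (fun s => (c s).1) J t :=
    (UnitBundle.continuous_val g).continuousAt.comp_continuousWithinAt hc
  set K : Set ℝ := {s | s ∈ J ∧ (c s).1.1 ∈ chartDom n x₀ ∧ (c s).1.1 ∈ chartDom n x₁} with hK
  have hKJ : K ⊆ J := fun s hs => hs.1
  have hKn : K ∈ 𝓝[J] t := by
    filter_upwards [self_mem_nhdsWithin, hc' ((isOpen_tangentDom x₀).mem_nhds h0),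
      hc' ((isOpen_tangentDom x₁).mem_nhds h1)] with s a b c using ⟨a, b, c⟩
  have hy := pos_mem_transDom h0 h1
  have hmaps : MapsTo (fun s => pos x₀ (c s).1) K (halfSpace n) :=
    fun s hs => chartImg_subset _ (pos_mem hs.2.1)
  have hp1 : HasDerivWithinAt (fun s => pos x₁ (c s).1) (vel x₁ (c t).1) J t := by
    rw [vel_eq_dtrans h0 h1]
    refine HasDerivWithinAt.mono_of_mem_nhdsWithin (t := K) ?_ hKn
    refine ((hasFDerivWithinAt_trans hy).comp_hasDerivWithinAt t (hp.mono hKJ) hmaps).congr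
      (fun s hs => pos_eq_trans hs.2.1) (pos_eq_trans h0)
  have hD : HasDerivWithinAt (fun s => dtrans n x₀ x₁ (pos x₀ (c s).1)) _ K t :=
    (hasFDerivWithinAt_dtrans hy).comp_hasDerivWithinAt t (hp.mono hKJ) hmaps
  refine ⟨hp1, _, ((hD.clm_apply (hv.mono hKJ)).congr (fun s hs => vel_eq_dtrans hs.2.1 hs.2.2)
    (vel_eq_dtrans h0 h1)).mono_of_mem_nhdsWithin hKn, fun w => ?_⟩
  obtain ⟨w, rfl⟩ := dtrans_surjective hy w
  have e1 := ha w
  rw [gram_eq_trans g hy, christoffel_trans g hy] at e1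
  rw [pos_eq_trans h0, vel_eq_dtrans h0 h1, ← gramL_apply, map_add]
  simp only [add_apply, gramL_apply]
  linarith

end Transition


/-! ### Flows of globally Lipschitz vector fields. -/

section LipschitzFlow

open scoped NNReal

variable {V : Type*} [NormedAddCommGroup V] [NormedSpace ℝ V]

theorem dist_trajectories_le_right {K : ℝ≥0} {F : V → V} (hF : LipschitzWith K F) {f g : ℝ → V}
    {a b : ℝ} (hf : ∀ t ∈ Icc a b, HasDerivWithinAt f (F (f t)) (Icc a b) t)
    (hg : ∀ t ∈ Icc a b, HasDerivWithinAt g (F (g t)) (Icc a b) t)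
    {s t : ℝ} (hs : s ∈ Icc a b) (ht : t ∈ Icc a b) (hst : s ≤ t) :
    dist (f t) (g t) ≤ dist (f s) (g s) * Real.exp (K * (t - s)) := by
  have hsub : Icc s t ⊆ Icc a b := Icc_subset_Icc hs.1 ht.2
  have key : ∀ h : ℝ → V, (∀ t ∈ Icc a b, HasDerivWithinAt h (F (h t)) (Icc a b) t) →
      ContinuousOn h (Icc s t) ∧ ∀ r ∈ Ico s t, HasDerivWithinAt h (F (h r)) (Ici r) r := by
    intro h hh
    refine ⟨fun r hr => ((hh r (hsub hr)).mono hsub).continuousWithinAt, fun r hr => ?_⟩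
    refine (hh r (hsub ⟨hr.1, hr.2.le⟩)).mono_of_mem_nhdsWithin ?_
    filter_upwards [Icc_mem_nhdsGE hr.2] with x hx using
      hsub ⟨hr.1.trans hx.1, hx.2⟩
  exact dist_le_of_trajectories_ODE (v := fun _ => F) (fun _ => hF) (key f hf).1 (key f hf).2
    (key g hg).1 (key g hg).2 le_rfl t ⟨hst, le_rfl⟩

/-- Grönwall in both time directions; the backward case is the forward case for the field `-F`. -/
theorem dist_trajectories_le {K : ℝ≥0} {F : V → V} (hF : LipschitzWith K F) {f g : ℝ → V}
    {a b : ℝ} (hf : ∀ t ∈ Icc a b, HasDerivWithinAt f (F (f t)) (Icc a b) t)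
    (hg : ∀ t ∈ Icc a b, HasDerivWithinAt g (F (g t)) (Icc a b) t)
    {s t : ℝ} (hs : s ∈ Icc a b) (ht : t ∈ Icc a b) :
    dist (f t) (g t) ≤ dist (f s) (g s) * Real.exp (K * |t - s|) := by
  rcases le_total s t with hst | hst
  · rw [abs_of_nonneg (sub_nonneg.2 hst)]
    exact dist_trajectories_le_right hF hf hg hs ht hst
  · have hneg : LipschitzWith K (fun z => -F z) := hF.neg
    have key : ∀ h : ℝ → V, (∀ t ∈ Icc a b, HasDerivWithinAt h (F (h t)) (Icc a b) t) →
        ∀ r ∈ Icc (-b) (-a), HasDerivWithinAt (fun r => h (-r)) (-F (h (-r))) (Icc (-b) (-a)) r := by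
      intro h hh r hr
      have h1 := (hh (-r) ⟨by linarith [hr.2], by linarith [hr.1]⟩).scomp r
        (hasDerivAt_neg r).hasDerivWithinAt (t' := Icc a b) (s := Icc (-b) (-a))
        (fun x hx => ⟨by linarith [hx.2], by linarith [hx.1]⟩)
      simpa [Function.comp_def] using h1
    have := dist_trajectories_le_right hneg (key f hf) (key g hg) (s := -s) (t := -t)
      ⟨by linarith [hs.2], by linarith [hs.1]⟩ ⟨by linarith [ht.2], by linarith [ht.1]⟩
      (by linarith)
    rw [abs_of_nonpos (sub_nonpos.2 hst)]
    simp only [neg_neg] at this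
    convert this using 3
    ring

/-- The existence time can be chosen independently of the initial value: on the ball of radius `‖F
z‖` around `z` the field has norm at most `(1 + K) ‖F z‖`, so an orbit cannot leave this ball before
time `1 / (K + 1)`. -/
theorem exists_lipschitz_flow [CompleteSpace V] {K : ℝ≥0} {F : V → V} (hF : LipschitzWith K F) :
    ∃ ε : ℝ, 0 < ε ∧ ∃ α : V → ℝ → V, (∀ z, α z 0 = z) ∧
      ∀ z, ∀ t ∈ Icc (-ε) ε, HasDerivWithinAt (α z) (F (α z t)) (Icc (-ε) ε) t := by
  set ε : ℝ := 1 / (2 * (K + 1)) with hε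
  have hKpos : (0 : ℝ) < K + 1 := by positivity
  have hεpos : 0 < ε := by positivity
  have h0 : (0 : ℝ) ∈ Icc (-ε) ε := ⟨by linarith, hεpos.le⟩
  refine ⟨ε, hεpos, ?_⟩
  have key : ∀ z : V, ∃ α : ℝ → V, α 0 = z ∧
      ∀ t ∈ Icc (-ε) ε, HasDerivWithinAt α (F (α t)) (Icc (-ε) ε) t := by
    intro z
    set a : ℝ≥0 := ‖F z‖₊ with ha
    have hP : IsPicardLindelof (fun _ => F) (tmin := -ε) (tmax := ε) ⟨0, h0⟩ z a 0
        (‖F z‖₊ + K * a) K := by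
      refine ⟨fun _ _ => hF.lipschitzOnWith, fun _ _ => continuousOn_const, fun _ _ x hx => ?_, ?_⟩
      · have h1 : ‖F x - F z‖ ≤ K * ‖x - z‖ := hF.norm_sub_le x z
        have h2 : ‖x - z‖ ≤ a := by rwa [Metric.mem_closedBall, dist_eq_norm] at hx
        have h3 : ‖F x‖ ≤ ‖F z‖ + ‖F x - F z‖ := by
          have := norm_add_le (F z) (F x - F z); simpa using this
        have h4 : (K : ℝ) * ‖x - z‖ ≤ K * a := mul_le_mul_of_nonneg_left h2 K.2
        push_cast
        linarith [coe_nnnorm (F z)]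
      · simp only [sub_zero, zero_sub, neg_neg, max_self, NNReal.coe_zero]
        push_cast
        rw [hε, ha, coe_nnnorm, ← one_add_mul, mul_one_div, div_le_iff₀ (by positivity)]
        nlinarith [norm_nonneg (F z), mul_nonneg K.2 (norm_nonneg (F z))]
    obtain ⟨α, hα0, hα⟩ := hP.exists_eq_forall_mem_Icc_hasDerivWithinAt (x := z) (by simp)
    exact ⟨α, hα0, hα⟩
  choose α h1 h2 using key
  exact ⟨α, h1, h2⟩

/-- A property that is open and closed along an interval and holds at one point holds
everywhere. -/
theorem forall_mem_Icc_of_clopen {a b s₀ : ℝ} {P : ℝ → Prop} (hs₀ : s₀ ∈ Icc a b) (h₀ : P s₀)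
    (hopen : ∀ s ∈ Icc a b, P s → ∀ᶠ r in 𝓝[Icc a b] s, P r)
    (hclosed : ∀ s ∈ Icc a b, (∃ᶠ r in 𝓝[Icc a b] s, P r) → P s) : ∀ s ∈ Icc a b, P s := by
  set S : Set (Icc a b) := {s | P s} with hS
  have ho : IsOpen S := by
    rw [isOpen_iff_mem_nhds]
    intro s hs
    have := hopen s s.2 hs
    rw [nhdsWithin_eq_map_subtype_coe s.2, Filter.eventually_map] at this
    exact this
  have hc : IsClosed S := by
    refine isClosed_iff_frequently.2 fun s hs => ?_
    refine hclosed s s.2 ?_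
    rw [nhdsWithin_eq_map_subtype_coe s.2, Filter.frequently_map]
    exact hs
  have : PreconnectedSpace (Icc a b) := Subtype.preconnectedSpace isPreconnected_Icc
  have hu : S = univ := IsClopen.eq_univ ⟨hc, ho⟩ ⟨⟨s₀, hs₀⟩, h₀⟩
  intro s hs
  have : (⟨s, hs⟩ : Icc a b) ∈ S := hu ▸ mem_univ _
  exact this

end LipschitzFlow

/-! ### The geodesic spray in coordinates. -/

section Spray

open scoped NNReal

variable {n : ℕ} {M : Type*} [TopologicalSpace M]
  [ChartedSpace (EuclideanHalfSpace (n + 1)) M] [IsManifold (𝓡∂ (n + 1)) ∞ M] (g : Metric n M)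

/-- The derivative of the metric in coordinates. -/
abbrev DgramL (x₀ : M) (y : Coord n) : Coord n →L[ℝ] Coord n →L[ℝ] Coord n →L[ℝ] ℝ :=
  fderivWithin ℝ (gramL g x₀) (halfSpace n) y

theorem contDiffOn_DgramL (x₀ : M) : ContDiffOn ℝ 1 (DgramL g x₀) (chartImg n x₀) := by
  intro y hy
  have h1 : ContDiffWithinAt ℝ ∞ (gramL g x₀) (halfSpace n) y :=
    (contDiffOn_gramL g x₀ y hy).mono_of_mem_nhdsWithin (chartImg_mem_nhdsWithin hy)
  exact (h1.fderivWithin_right (uniqueDiffOn_halfSpace n) (m := 1) (by norm_cast)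
    (chartImg_subset _ hy)).mono (chartImg_subset _)

/-- The Christoffel symbols of the first kind, as a linear form in the last argument. -/
def christoffelL (x₀ : M) (z : Coord n × Coord n) : Coord n →L[ℝ] ℝ :=
  DgramL g x₀ z.1 z.2 z.2 - (1 / 2 : ℝ) •
    ((ContinuousLinearMap.apply ℝ ℝ z.2).comp
      ((ContinuousLinearMap.apply ℝ (Coord n →L[ℝ] ℝ) z.2).comp (DgramL g x₀ z.1)))

theorem christoffelL_apply {x₀ : M} {z : Coord n × Coord n} (hz : z.1 ∈ chartImg n x₀)
    (w : Coord n) : christoffelL g x₀ z w = christoffel g x₀ z.1 z.2 w := by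
  unfold christoffel
  rw [dgram_eq g hz, dgram_eq g hz]
  simp [christoffelL]
  ring

theorem contDiffOn_christoffelL (x₀ : M) :
    ContDiffOn ℝ 1 (christoffelL g x₀) (chartImg n x₀ ×ˢ univ) := by
  have h1 : ContDiffOn ℝ 1 (fun z : Coord n × Coord n => DgramL g x₀ z.1) (chartImg n x₀ ×ˢ univ) :=
    (contDiffOn_DgramL g x₀).comp contDiffOn_fst fun z hz => hz.1
  refine contDiffOn_clm_apply.2 fun w => ?_
  have h2 : ContDiffOn ℝ 1 (fun z : Coord n × Coord n => DgramL g x₀ z.1 z.2 z.2 w -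
      (1 / 2 : ℝ) * DgramL g x₀ z.1 w z.2 z.2) (chartImg n x₀ ×ˢ univ) := by
    refine ContDiffOn.sub ?_ (contDiffOn_const.mul ?_)
    · exact ((h1.clm_apply contDiffOn_snd).clm_apply contDiffOn_snd).clm_apply contDiffOn_const
    · exact ((h1.clm_apply contDiffOn_const).clm_apply contDiffOn_snd).clm_apply contDiffOn_snd
  exact h2.congr fun z _ => by simp [christoffelL]

/-- Positivity gives injectivity, and a space has the same dimension as its dual. -/
theorem gramL_isInvertible {x₀ : M} {y : Coord n} (hy : y ∈ chartImg n x₀) :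
    (gramL g x₀ y).IsInvertible := by
  have hinj : Function.Injective (gramL g x₀ y).toLinearMap := by
    rw [← LinearMap.ker_eq_bot, LinearMap.ker_eq_bot']
    intro u hu
    by_contra hne
    have h1 := gram_pos g hy hne
    rw [← gramL_apply] at h1
    have h2 : gramL g x₀ y u = 0 := hu
    rw [h2] at h1
    simp at h1
  have hdim : Module.finrank ℝ (Coord n) = Module.finrank ℝ (Coord n →L[ℝ] ℝ) := by
    rw [← (LinearMap.toContinuousLinearMap (𝕜 := ℝ) (E := Coord n) (F' := ℝ)).finrank_eq]
    exact (Subspace.dual_finrank_eq (K := ℝ) (V := Coord n)).symm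
  exact ⟨(LinearEquiv.ofInjectiveOfFinrankEq _ hinj hdim).toContinuousLinearEquiv, by
    ext u w; rfl⟩

/-- The acceleration of a geodesic in coordinates. -/
def accel (x₀ : M) (z : Coord n × Coord n) : Coord n :=
  -(gramL g x₀ z.1).inverse (christoffelL g x₀ z)

theorem gram_accel {x₀ : M} {z : Coord n × Coord n} (hz : z.1 ∈ chartImg n x₀) (w : Coord n) :
    gram g x₀ z.1 (accel g x₀ z) w + christoffel g x₀ z.1 z.2 w = 0 := by
  have h := (gramL_isInvertible g hz).self_apply_inverse (christoffelL g x₀ z)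
  rw [← christoffelL_apply g hz, ← gramL_apply, accel, map_neg, h]
  simp

theorem eq_accel {x₀ : M} {z : Coord n × Coord n} (hz : z.1 ∈ chartImg n x₀) {a : Coord n}
    (ha : ∀ w, gram g x₀ z.1 a w + christoffel g x₀ z.1 z.2 w = 0) : a = accel g x₀ z := by
  by_contra hne
  have h1 := gram_pos g hz (sub_ne_zero.2 hne)
  have h2 := ha (a - accel g x₀ z)
  have h3 := gram_accel g hz (a - accel g x₀ z)
  rw [← gramL_apply] at h1 h2 h3
  have h4 : gramL g x₀ z.1 (a - accel g x₀ z) (a - accel g x₀ z) =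
      gramL g x₀ z.1 a (a - accel g x₀ z) - gramL g x₀ z.1 (accel g x₀ z) (a - accel g x₀ z) := by
    rw [map_sub (gramL g x₀ z.1)]; rfl
  linarith

/-- The Christoffel form is quadratic in the velocity. This homogeneity relates orbits through
vectors of arbitrary length to unit speed geodesics. -/
theorem accel_smul {x₀ : M} {z : Coord n × Coord n} (hz : z.1 ∈ chartImg n x₀) (r : ℝ) :
    accel g x₀ (z.1, r • z.2) = r ^ 2 • accel g x₀ z := by
  refine (eq_accel g (z := (z.1, r • z.2)) hz fun w => ?_).symm
  have h := gram_accel g hz w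
  rw [← christoffelL_apply g hz] at h
  have h2 := christoffelL_apply g (z := (z.1, r • z.2)) hz w
  rw [← h2, ← gramL_apply]
  rw [← gramL_apply] at h
  simp only [christoffelL, map_smul, smul_apply, sub_apply, ContinuousLinearMap.comp_apply,
    ContinuousLinearMap.apply_apply, smul_eq_mul] at h ⊢
  linear_combination r ^ 2 * h

theorem contDiffOn_accel (x₀ : M) : ContDiffOn ℝ 1 (accel g x₀) (chartImg n x₀ ×ˢ univ) := by
  refine ContDiffOn.neg (ContDiffOn.clm_apply ?_ (contDiffOn_christoffelL g x₀))
  intro z hz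
  have h1 : ContDiffWithinAt ℝ 1 (fun z : Coord n × Coord n => gramL g x₀ z.1)
      (chartImg n x₀ ×ˢ univ) z :=
    (((contDiffOn_gramL g x₀).of_le (by norm_cast)).comp contDiffOn_fst fun z hz => hz.1) z hz
  exact (gramL_isInvertible g hz.1).contDiffAt_map_inverse.comp_contDiffWithinAt z h1

/-- The length of a tangent vector in coordinates. -/
def speed (x₀ : M) (z : Coord n × Coord n) : ℝ := √(gram g x₀ z.1 z.2 z.2)

theorem speed_pos {x₀ : M} {z : Coord n × Coord n} (hz : z.1 ∈ chartImg n x₀) (hu : z.2 ≠ 0) :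
    0 < speed g x₀ z := Real.sqrt_pos.2 (gram_pos g hz hu)

/-- The generator of the geodesic flow on the tangent bundle without the zero section, scaled so
that all orbits have unit speed. -/
def spray (x₀ : M) (z : Coord n × Coord n) : Coord n × Coord n :=
  ((speed g x₀ z)⁻¹ • z.2, (speed g x₀ z)⁻¹ • accel g x₀ z)

theorem contDiffWithinAt_speed {x₀ : M} {z : Coord n × Coord n} (hz : z.1 ∈ chartImg n x₀)
    (hu : z.2 ≠ 0) : ContDiffWithinAt ℝ 1 (speed g x₀) (chartImg n x₀ ×ˢ univ) z := by
  have h1 : ContDiffOn ℝ 1 (fun z : Coord n × Coord n => gramL g x₀ z.1)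
      (chartImg n x₀ ×ˢ univ) :=
    (((contDiffOn_gramL g x₀).of_le (by norm_cast)).comp contDiffOn_fst fun z hz => hz.1)
  exact (((h1.clm_apply contDiffOn_snd).clm_apply contDiffOn_snd) z ⟨hz, mem_univ _⟩).sqrt
    (gram_pos g hz hu).ne'

theorem contDiffWithinAt_spray {x₀ : M} {z : Coord n × Coord n} (hz : z.1 ∈ chartImg n x₀)
    (hu : z.2 ≠ 0) : ContDiffWithinAt ℝ 1 (spray g x₀) (halfSpace n ×ˢ univ) z := by
  have h1 := (contDiffWithinAt_speed g hz hu).inv (speed_pos g hz hu).ne'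
  have h2 : ContDiffWithinAt ℝ 1 (spray g x₀) (chartImg n x₀ ×ˢ univ) z :=
    (h1.smul contDiffWithinAt_snd).prodMk (h1.smul (contDiffOn_accel g x₀ z ⟨hz, mem_univ _⟩))
  refine h2.mono_of_mem_nhdsWithin ?_
  rw [nhdsWithin_prod_eq]
  exact Filter.prod_mem_prod (chartImg_mem_nhdsWithin hz) Filter.univ_mem

end Spray


/-! ### Flow boxes, and the correspondence of their orbits with geodesics. -/

section FlowBox

open scoped NNReal

variable {n : ℕ} {M : Type*} [TopologicalSpace M]
  [ChartedSpace (EuclideanHalfSpace (n + 1)) M] [IsManifold (𝓡∂ (n + 1)) ∞ M]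

theorem pos_param_mk {x₀ : M} {y : Coord n} (hy : y ∈ chartImg n x₀) (u : Coord n) :
    pos x₀ (param x₀ (y, u)) = y := pos_param (z := (y, u)) hy

theorem vel_param_mk {x₀ : M} {y : Coord n} (hy : y ∈ chartImg n x₀) (u : Coord n) :
    vel x₀ (param x₀ (y, u)) = u := vel_param (z := (y, u)) hy

theorem speed_smul (g : Metric n M) (x₀ : M) (y u : Coord n) {r : ℝ} (hr : 0 ≤ r) :
    speed g x₀ (y, r • u) = r * speed g x₀ (y, u) := by
  unfold speed
  have : gram g x₀ y (r • u) (r • u) = r ^ 2 * gram g x₀ y u u := by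
    simp only [← gramL_apply, map_smul, smul_apply, smul_eq_mul]; ring
  rw [this, Real.sqrt_mul (sq_nonneg r), Real.sqrt_sq hr]

theorem normalize_param (g : Metric n M) (x₀ : M) (z : Coord n × Coord n) :
    normalize g (param x₀ z) = param x₀ (z.1, (speed g x₀ z)⁻¹ • z.2) := by
  unfold param
  rw [frameVec_smul]
  rfl

theorem speed_coord (g : Metric n M) {x₀ : M} (p : UnitBundle g) (hp : p.1.1 ∈ chartDom n x₀) :
    speed g x₀ (coord x₀ p.1) = 1 := by
  have h := inner_eq_gram g hp p.1.2 p.1.2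
  rw [p.2] at h
  exact Real.sqrt_eq_one.2 h.symm

theorem vel_ne_zero (g : Metric n M) {x₀ : M} (p : UnitBundle g) (hp : p.1.1 ∈ chartDom n x₀) :
    vel x₀ p.1 ≠ 0 := by
  intro h
  have h1 := speed_coord g p hp
  unfold speed coord at h1
  rw [h, ← gramL_apply] at h1
  simp at h1

theorem normalize_param_coord (g : Metric n M) {x₀ : M} (p : UnitBundle g)
    (hp : p.1.1 ∈ chartDom n x₀) : normalize g (param x₀ (coord x₀ p.1)) = p.1 := by
  rw [normalize_param, speed_coord g p hp, inv_one, one_smul]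
  exact param_coord hp

theorem inner_normalize (g : Metric n M) {x₀ : M} {z : Coord n × Coord n}
    (hz : z.1 ∈ chartImg n x₀) (hu : z.2 ≠ 0) :
    g.inner (normalize g (param x₀ z)).1 (normalize g (param x₀ z)).2
      (normalize g (param x₀ z)).2 = 1 := by
  rw [normalize_param, inner_param]
  have h1 := speed_pos g hz hu
  have h2 := speed_smul g x₀ z.1 z.2 (inv_nonneg.2 h1.le)
  rw [inv_mul_cancel₀ h1.ne'] at h2
  exact Real.sqrt_eq_one.1 h2

/-- A domain in coordinates on which the scaled geodesic spray is the restriction of a globally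
Lipschitz vector field, with the flow of this vector field for short times. -/
structure FlowBox (g : Metric n M) (x₀ : M) where
  /-- The domain in which the vector field is the spray. -/
  W : Set (Coord n × Coord n)
  isOpen_W : IsOpen W
  /-- The Lipschitz vector field. -/
  field : Coord n × Coord n → Coord n × Coord n
  /-- The Lipschitz constant. -/
  K : ℝ≥0
  lip : LipschitzWith K field
  mem_dom : ∀ z ∈ W, z.1 ∈ halfSpace n → z.1 ∈ chartImg n x₀ ∧ z.2 ≠ 0 ∧ field z = spray g x₀ z
  /-- The set of admissible initial values. -/
  V : Set (Coord n × Coord n)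
  isOpen_V : IsOpen V
  /-- The length of time for which orbits stay in the domain. -/
  ε : ℝ
  ε_pos : 0 < ε
  /-- The flow. -/
  flow : Coord n × Coord n → ℝ → Coord n × Coord n
  flow_zero : ∀ z, flow z 0 = z
  flow_deriv : ∀ z, ∀ t ∈ Icc (-ε) ε,
    HasDerivWithinAt (flow z) (field (flow z t)) (Icc (-ε) ε) t
  flow_mem : ∀ z ∈ V, ∀ t ∈ Icc (-ε) ε, flow z t ∈ W

namespace FlowBox

variable {g : Metric n M} {x₀ : M} (b : FlowBox g x₀)

theorem zero_mem : (0 : ℝ) ∈ Icc (-b.ε) b.ε := ⟨by linarith [b.ε_pos], b.ε_pos.le⟩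

theorem V_subset : b.V ⊆ b.W := fun z hz => by
  simpa [b.flow_zero] using b.flow_mem z hz 0 b.zero_mem

theorem dist_flow_le (z z' : Coord n × Coord n) {s : ℝ} (hs : s ∈ Icc (-b.ε) b.ε) :
    dist (b.flow z s) (b.flow z' s) ≤ dist z z' * Real.exp (b.K * b.ε) := by
  have h := dist_trajectories_le b.lip (b.flow_deriv z) (b.flow_deriv z') b.zero_mem hs
  rw [b.flow_zero, b.flow_zero, sub_zero] at h
  refine h.trans (mul_le_mul_of_nonneg_left ?_ dist_nonneg)
  gcongr
  exact abs_le.2 hs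

/-- Grönwall run from time `s` back to `0`. Together with `dist_flow_le`, each time-`s` map is
bi-Lipschitz; the comparison of null sets relies on this rather than on differentiability of the
flow. -/
theorem le_dist_flow (z z' : Coord n × Coord n) {s : ℝ} (hs : s ∈ Icc (-b.ε) b.ε) :
    dist z z' ≤ dist (b.flow z s) (b.flow z' s) * Real.exp (b.K * b.ε) := by
  have h := dist_trajectories_le b.lip (b.flow_deriv z) (b.flow_deriv z') hs b.zero_mem
  rw [b.flow_zero, b.flow_zero, zero_sub, abs_neg] at h
  refine h.trans (mul_le_mul_of_nonneg_left ?_ dist_nonneg)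
  gcongr
  exact abs_le.2 hs

theorem continuousOn_flow_right (z : Coord n × Coord n) :
    ContinuousOn (b.flow z) (Icc (-b.ε) b.ε) :=
  fun t ht => (b.flow_deriv z t ht).continuousWithinAt

theorem continuousOn_flow :
    ContinuousOn (fun p : (Coord n × Coord n) × ℝ => b.flow p.1 p.2)
      (univ ×ˢ Icc (-b.ε) b.ε) := by
  refine continuousOn_prod_of_continuousOn_lipschitzOnWith _ (Real.exp (b.K * b.ε)).toNNReal
    (fun z _ => b.continuousOn_flow_right z) fun s hs => ?_
  refine LipschitzOnWith.of_dist_le_mul fun z _ z' _ => ?_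
  rw [Real.coe_toNNReal _ (Real.exp_pos _).le, mul_comm]
  exact b.dist_flow_le z z' hs

end FlowBox

/-- The spray is `C¹` up to the boundary, hence Lipschitz near `z₀` relative to the convex half
space, and a Lipschitz map into a finite-dimensional space extends from any subset. Thus orbits
exist for a short time on both sides even from boundary points. -/
theorem exists_flowBox (g : Metric n M) (x₀ : M) {z₀ : Coord n × Coord n}
    (hz : z₀.1 ∈ chartImg n x₀) (hu : z₀.2 ≠ 0) : ∃ b : FlowBox g x₀, z₀ ∈ b.V := by
  obtain ⟨K₀, t, ht, hL⟩ := (contDiffWithinAt_spray g hz hu).exists_lipschitzOnWith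
    ((convex_halfSpace n).prod convex_univ)
  have h1 : chartImg n x₀ ×ˢ (univ : Set (Coord n)) ∈ 𝓝[halfSpace n ×ˢ univ] z₀ := by
    rw [nhdsWithin_prod_eq]
    exact Filter.prod_mem_prod (chartImg_mem_nhdsWithin hz) Filter.univ_mem
  have h2 : {z : Coord n × Coord n | z.2 ≠ 0} ∈ 𝓝[halfSpace n ×ˢ univ] z₀ :=
    nhdsWithin_le_nhds ((isOpen_ne_fun continuous_snd continuous_const).mem_nhds hu)
  obtain ⟨W, hWo, hzW, hW⟩ := mem_nhdsWithin.1 (Filter.inter_mem (Filter.inter_mem ht h1) h2)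
  obtain ⟨F, hF, hFt⟩ := hL.extend_finite_dimension
  obtain ⟨ε, hε, α, hα0, hα⟩ := exists_lipschitz_flow hF
  set K := lipschitzExtensionConstant (Coord n × Coord n) * K₀
  have hmem : ∀ z ∈ W, z.1 ∈ halfSpace n → z.1 ∈ chartImg n x₀ ∧ z.2 ≠ 0 ∧ F z = spray g x₀ z := by
    intro z hz hz'
    have := hW ⟨hz, hz', mem_univ _⟩
    exact ⟨this.1.2.1, this.2, (hFt this.1.1).symm⟩
  -- A provisional box with no admissible initial values, which makes joint continuity of the flow
  -- available; continuity at `(z₀, 0)` then supplies the actual `V` and a shorter time.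
  let b : FlowBox g x₀ := ⟨W, hWo, F, K, hF, hmem, ∅, isOpen_empty, ε, hε, α, hα0, hα, by simp⟩
  have hc := b.continuousOn_flow (z₀, 0) ⟨mem_univ _, b.zero_mem⟩
  have hpre := hc (hWo.mem_nhds (by simpa [b, hα0] using hzW))
  rw [nhdsWithin_prod_eq, nhdsWithin_univ, nhdsWithin_eq_nhds.2
    (Icc_mem_nhds (by simp [b, hε]) (by simp [b, hε]))] at hpre
  obtain ⟨U, hU, S, hS, hUS⟩ := Filter.mem_prod_iff.1 hpre
  obtain ⟨V, hVU, hVo, hzV⟩ := mem_nhds_iff.1 hU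
  obtain ⟨η, hη, hηS⟩ := Metric.mem_nhds_iff.1 hS
  have hsub : Icc (-(min ε (η / 2))) (min ε (η / 2)) ⊆ Icc (-ε) ε :=
    Icc_subset_Icc (neg_le_neg (min_le_left _ _)) (min_le_left _ _)
  refine ⟨⟨W, hWo, F, K, hF, hmem, V, hVo, min ε (η / 2), lt_min hε (by positivity), α, hα0,
    fun z t ht => (hα z t (hsub ht)).mono hsub, fun z hz t ht => ?_⟩, hzV⟩
  refine hUS (show (z, t) ∈ U ×ˢ S from ⟨hVU hz, hηS ?_⟩)
  rw [Metric.mem_ball, Real.dist_0_eq_abs]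
  have := abs_le.2 ht
  linarith [min_le_right ε (η / 2)]

/-! ### Orbits of the spray and geodesics -/

theorem isGeodesicOn_iff {g : Metric n M} {c : ℝ → UnitBundle g} {J : Set ℝ} :
    IsGeodesicOn g c J ↔ ContinuousOn c J ∧ ∀ t ∈ J, ∀ x₀ : M, (c t).1.1 ∈ chartDom n x₀ →
      GeodesicEqAt g x₀ c J t := Iff.rfl

/-- Conservation of energy: the derivative is twice the geodesic equation tested with the velocity,
up to the factor that normalizes the speed. -/
theorem hasDerivWithinAt_speed {g : Metric n M} {x₀ : M} {ζ : ℝ → Coord n × Coord n} {J : Set ℝ}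
    {t : ℝ} (hJ : ∀ s ∈ J, (ζ s).1 ∈ halfSpace n) (hz : (ζ t).1 ∈ chartImg n x₀)
    (h : HasDerivWithinAt ζ (spray g x₀ (ζ t)) J t) :
    HasDerivWithinAt (fun s => gram g x₀ (ζ s).1 (ζ s).2 (ζ s).2) 0 J t := by
  have h1 : HasDerivWithinAt (fun s => (ζ s).1) ((speed g x₀ (ζ t))⁻¹ • (ζ t).2) J t := by
    exact (ContinuousLinearMap.fst ℝ (Coord n) (Coord n)).hasFDerivAt.comp_hasDerivWithinAt t h
  have h2 : HasDerivWithinAt (fun s => (ζ s).2) ((speed g x₀ (ζ t))⁻¹ • accel g x₀ (ζ t)) J t := by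
    exact (ContinuousLinearMap.snd ℝ (Coord n) (Coord n)).hasFDerivAt.comp_hasDerivWithinAt t h
  have h3 : HasDerivWithinAt (fun s => gramL g x₀ (ζ s).1) _ J t :=
    HasFDerivWithinAt.comp_hasDerivWithinAt (l := gramL g x₀) (t := halfSpace n) t
      (by convert hasFDerivWithinAt_gramL g hz using 1) h1 hJ
  have h4 := (h3.clm_apply h2).clm_apply h2
  refine h4.congr_deriv ?_
  have h5 := gram_accel g hz (ζ t).2
  unfold christoffel at h5
  rw [dgram_eq g hz] at h5
  have h6 := gram_comm g x₀ (ζ t).1 (ζ t).2 (accel g x₀ (ζ t))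
  simp only [map_smul, smul_apply, add_apply, smul_eq_mul, gramL_apply]
  rw [h6]
  linear_combination 2 * (speed g x₀ (ζ t))⁻¹ * h5

theorem speed_const {g : Metric n M} {x₀ : M} {ζ : ℝ → Coord n × Coord n} {a b : ℝ}
    (hJ : ∀ s ∈ Icc a b, (ζ s).1 ∈ chartImg n x₀)
    (h : ∀ t ∈ Icc a b, HasDerivWithinAt ζ (spray g x₀ (ζ t)) (Icc a b) t) {s t : ℝ}
    (hs : s ∈ Icc a b) (ht : t ∈ Icc a b) : speed g x₀ (ζ s) = speed g x₀ (ζ t) := by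
  have := (convex_Icc a b).norm_image_sub_le_of_norm_hasDerivWithin_le (C := 0)
    (fun r hr => hasDerivWithinAt_speed (fun s hs => chartImg_subset _ (hJ s hs)) (hJ r hr)
      (h r hr)) (by simp) hs ht
  rw [zero_mul, norm_le_zero_iff, sub_eq_zero] at this
  unfold speed
  rw [this]

/-- Along the orbit the speed is constant, so normalizing divides the velocity by one fixed number,
and by `accel_smul` the result solves the geodesic equation. Other charts follow by
`GeodesicEqAt.change_chart`. -/
theorem isGeodesicOn_of_spray {g : Metric n M} {x₀ : M} {ζ : ℝ → Coord n × Coord n} {a b : ℝ}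
    (hJ : ∀ s ∈ Icc a b, (ζ s).1 ∈ chartImg n x₀)
    (h : ∀ t ∈ Icc a b, HasDerivWithinAt ζ (spray g x₀ (ζ t)) (Icc a b) t)
    {c : ℝ → UnitBundle g} (hc : ∀ s ∈ Icc a b, (c s).1 = normalize g (param x₀ (ζ s))) :
    IsGeodesicOn g c (Icc a b) := by
  rw [isGeodesicOn_iff]
  have hcoord : ∀ t ∈ Icc a b, ∀ s ∈ Icc a b,
      (c s).1 = param x₀ ((ζ s).1, (speed g x₀ (ζ t))⁻¹ • (ζ s).2) := by
    intro t ht s hs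
    rw [hc s hs, normalize_param, speed_const hJ h hs ht]
  have hcont : ContinuousOn c (Icc a b) := by
    rcases (Icc a b).eq_empty_or_nonempty with he | ⟨t, ht⟩
    · rw [he]; exact continuousOn_empty _
    have hζ : ContinuousOn ζ (Icc a b) := fun s hs => (h s hs).continuousWithinAt
    have h1 : ContinuousOn (fun s => (c s).1) (Icc a b) := by
      refine ContinuousOn.congr ?_ (hcoord t ht)
      exact (continuousOn_param x₀).comp
        ((show Continuous fun z : Coord n × Coord n => (z.1, (speed g x₀ (ζ t))⁻¹ • z.2) by
          fun_prop).comp_continuousOn hζ) fun s hs => ⟨hJ s hs, mem_univ _⟩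
    rw [continuousOn_iff_continuous_domRestrict] at h1 ⊢
    exact continuous_induced_rng.2 h1
  refine ⟨hcont, fun t ht x₁ hx₁ => ?_⟩
  have hbase : ∀ s ∈ Icc a b, (c s).1.1 ∈ chartDom n x₀ := fun s hs => by
    rw [hc s hs]; exact param_fst_mem (hJ s hs)
  refine GeodesicEqAt.change_chart (x₀ := x₀) ?_ (hcont t ht) (hbase t ht) hx₁
  set r := (speed g x₀ (ζ t))⁻¹ with hr
  have h1 : HasDerivWithinAt (fun s => (ζ s).1) (r • (ζ t).2) (Icc a b) t := by
    exact (ContinuousLinearMap.fst ℝ (Coord n) (Coord n)).hasFDerivAt.comp_hasDerivWithinAt t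
      (h t ht)
  have h2 : HasDerivWithinAt (fun s => (ζ s).2) (r • accel g x₀ (ζ t)) (Icc a b) t := by
    exact (ContinuousLinearMap.snd ℝ (Coord n) (Coord n)).hasFDerivAt.comp_hasDerivWithinAt t
      (h t ht)
  have hpos : ∀ s ∈ Icc a b, pos x₀ (c s).1 = (ζ s).1 := fun s hs => by
    rw [hcoord t ht s hs, pos_param_mk (hJ s hs)]
  have hvel : ∀ s ∈ Icc a b, vel x₀ (c s).1 = r • (ζ s).2 := fun s hs => by
    rw [hcoord t ht s hs, vel_param_mk (hJ s hs)]
  refine ⟨?_, r • r • accel g x₀ (ζ t), ?_, fun w => ?_⟩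
  · rw [hvel t ht]
    exact h1.congr hpos (hpos t ht)
  · exact (h2.const_smul r).congr hvel (hvel t ht)
  · rw [hpos t ht, hvel t ht, smul_smul, ← pow_two, ← accel_smul g (hJ t ht)]
    exact gram_accel g (z := ((ζ t).1, r • (ζ t).2)) (hJ t ht) w

theorem FlowBox.isGeodesicOn {g : Metric n M} {x₀ : M} (b : FlowBox g x₀)
    {z : Coord n × Coord n} (hz : z ∈ b.V) {s t : ℝ} (hst : Icc s t ⊆ Icc (-b.ε) b.ε)
    (hH : ∀ r ∈ Icc s t, (b.flow z r).1 ∈ halfSpace n) {c : ℝ → UnitBundle g}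
    (hc : ∀ r ∈ Icc s t, (c r).1 = normalize g (param x₀ (b.flow z r))) :
    IsGeodesicOn g c (Icc s t) := by
  have hm := fun r (hr : r ∈ Icc s t) => b.mem_dom _ (b.flow_mem z hz r (hst hr)) (hH r hr)
  refine isGeodesicOn_of_spray (fun r hr => (hm r hr).1)
    (fun r hr => ?_) hc
  rw [← (hm r hr).2.2]
  exact (b.flow_deriv z r (hst hr)).mono hst

/-- Converse to `isGeodesicOn_of_spray`. The factor `r` is free because null sets are later tested
on whole cones of vectors and not on unit vectors. -/
theorem IsGeodesicOn.hasDerivWithinAt_coord {g : Metric n M} {c : ℝ → UnitBundle g} {J : Set ℝ}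
    (hc : IsGeodesicOn g c J) {x₀ : M} {t : ℝ} (ht : t ∈ J) (hx : (c t).1.1 ∈ chartDom n x₀)
    {r : ℝ} (hr : 0 < r) :
    HasDerivWithinAt (fun s => (pos x₀ (c s).1, r • vel x₀ (c s).1))
      (spray g x₀ (pos x₀ (c t).1, r • vel x₀ (c t).1)) J t := by
  obtain ⟨h1, a, h2, ha⟩ := (isGeodesicOn_iff.1 hc).2 t ht x₀ hx
  have hz := pos_mem hx
  have ha' : a = accel g x₀ (coord x₀ (c t).1) := eq_accel g (z := coord x₀ (c t).1) hz ha
  refine (h1.prodMk (h2.const_smul r)).congr_deriv ?_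
  have hsp : speed g x₀ (pos x₀ (c t).1, r • vel x₀ (c t).1) = r := by
    rw [speed_smul g x₀ _ _ hr.le]
    have := speed_coord g (c t) hx
    unfold coord at this
    rw [this, mul_one]
  unfold spray
  rw [hsp]
  refine Prod.ext ?_ ?_
  · simp only [smul_smul, inv_mul_cancel₀ hr.ne', one_smul]
  · have := accel_smul g (z := coord x₀ (c t).1) hz r
    simp only [coord] at this ha' ⊢
    rw [this, ← ha', smul_smul, pow_two, ← mul_assoc, inv_mul_cancel₀ hr.ne', one_mul]

/-- Two points that cannot be separated have the same base point, hence lie in one chart, where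
their coordinates agree. -/
instance tangentT2 [T2Space M] : T2Space (TangentBundle (𝓡∂ (n + 1)) M) := by
  refine t2_iff_nhds.2 fun {p q} h => ?_
  set l := 𝓝 p ⊓ 𝓝 q with hl
  have hcont : Continuous (fun p : TangentBundle (𝓡∂ (n + 1)) M => p.1) :=
    FiberBundle.continuous_proj (Coord n) _
  have hbase : p.1 = q.1 := tendsto_nhds_unique (f := fun p => p.1) (l := l)
    (hcont.continuousAt.mono_left inf_le_left) (hcont.continuousAt.mono_left inf_le_right)
  have hp : p.1 ∈ chartDom n p.1 := mem_chart_source _ _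
  have hq : q.1 ∈ chartDom n p.1 := hbase ▸ hp
  have hcp := (continuousOn_coord (n := n) p.1).continuousAt ((isOpen_tangentDom p.1).mem_nhds hp)
  have hcq := (continuousOn_coord (n := n) p.1).continuousAt ((isOpen_tangentDom p.1).mem_nhds hq)
  have h1 : coord (n := n) p.1 p = coord p.1 q := tendsto_nhds_unique (l := l)
    (hcp.mono_left inf_le_left) (hcq.mono_left inf_le_right)
  have h2 := param_coord (n := n) hp
  have h3 := param_coord (n := n) hq
  unfold coord at h1
  rw [← h2, h1, h3]

instance unitT2 [T2Space M] (g : Metric n M) : T2Space (UnitBundle g) :=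
  inferInstanceAs (T2Space {p : TangentBundle (𝓡∂ (n + 1)) M // g.inner p.1 p.2 p.2 = 1})

/-- Geodesics that start in a flow box follow its flow. -/
theorem FlowBox.eq_flow [T2Space M] {g : Metric n M} {x₀ : M} (b : FlowBox g x₀)
    {z : Coord n × Coord n} (hz : z ∈ b.V) (hzH : z.1 ∈ halfSpace n) {s t : ℝ} (h0 : 0 ∈ Icc s t)
    (hst : Icc s t ⊆ Icc (-b.ε) b.ε)
    {c : ℝ → UnitBundle g} (hc : IsGeodesicOn g c (Icc s t))
    (hc0 : (c 0).1 = normalize g (param x₀ z)) :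
    ∀ r ∈ Icc s t, (b.flow z r).1 ∈ halfSpace n ∧
      (c r).1 = normalize g (param x₀ (b.flow z r)) := by
  set ρ := speed g x₀ z with hρ
  have hz1 := b.mem_dom z (b.V_subset hz) hzH
  have hρpos : 0 < ρ := speed_pos g hz1.1 hz1.2.1
  -- A clopen argument in `r`. The normalizing factor is frozen at its initial value `ρ⁻¹`;
  -- constancy of the speed is available only after the orbit is known to stay in the half space.
  set Q : ℝ → Prop := fun r => (b.flow z r).1 ∈ halfSpace n ∧
    (c r).1 = param x₀ ((b.flow z r).1, ρ⁻¹ • (b.flow z r).2) with hQ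
  have hdom : ∀ r ∈ Icc s t, Q r → (b.flow z r).1 ∈ chartImg n x₀ := fun r hr h =>
    (b.mem_dom _ (b.flow_mem z hz r (hst hr)) h.1).1
  have hcv : ContinuousOn (fun r => (c r).1) (Icc s t) :=
    (UnitBundle.continuous_val g).comp_continuousOn hc.1
  have hfl : ContinuousOn (b.flow z) (Icc s t) := (b.continuousOn_flow_right z).mono hst
  have hall : ∀ r ∈ Icc s t, Q r := by
    refine forall_mem_Icc_of_clopen h0 ?_ ?_ ?_
    · simp only [hQ, b.flow_zero]
      exact ⟨hzH, by rw [hc0, normalize_param]⟩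
    · intro r hr hPr
      have hdr := hdom r hr hPr
      have hsrc : (c r).1.1 ∈ chartDom n x₀ := by rw [hPr.2]; exact param_fst_mem hdr
      set ζ : ℝ → Coord n × Coord n := fun r => (pos x₀ (c r).1, ρ • vel x₀ (c r).1) with hζ
      have hζr : ζ r = b.flow z r := by
        simp only [hζ, hPr.2]
        rw [pos_param_mk hdr, vel_param_mk hdr, smul_smul, mul_inv_cancel₀ hρpos.ne', one_smul]
      have hζc : ContinuousWithinAt ζ (Icc s t) r :=
        (hc.hasDerivWithinAt_coord hr hsrc hρpos).continuousWithinAt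
      have e1 : ∀ᶠ q in 𝓝[Icc s t] r, ζ q ∈ b.W :=
        hζc (b.isOpen_W.mem_nhds (hζr ▸ b.flow_mem z hz r (hst hr)))
      have e2 : ∀ᶠ q in 𝓝[Icc s t] r, (c q).1.1 ∈ chartDom n x₀ :=
        hcv r hr ((isOpen_tangentDom x₀).mem_nhds hsrc)
      obtain ⟨η, hη, hball⟩ := Metric.mem_nhdsWithin_iff.1 (e1.and e2)
      have hsub : Icc (max s (r - η / 2)) (min t (r + η / 2)) ⊆
          Metric.ball r η ∩ Icc s t := by
        intro q hq
        refine ⟨?_, (le_max_left _ _).trans hq.1, hq.2.trans (min_le_left _ _)⟩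
        rw [Metric.mem_ball, Real.dist_eq, abs_lt]
        constructor
        · linarith [(le_max_right s (r - η / 2)).trans hq.1]
        · linarith [hq.2.trans (min_le_right t (r + η / 2))]
      have hsub' : Icc (max s (r - η / 2)) (min t (r + η / 2)) ⊆ Icc s t :=
        fun q hq => (hsub hq).2
      have hrI : r ∈ Icc (max s (r - η / 2)) (min t (r + η / 2)) :=
        ⟨max_le hr.1 (by linarith), le_min hr.2 (by linarith)⟩
      have hfl1 : ∀ q ∈ Icc (max s (r - η / 2)) (min t (r + η / 2)),
          HasDerivWithinAt ζ (b.field (ζ q)) (Icc (max s (r - η / 2)) (min t (r + η / 2))) q := by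
        intro q hq
        have h1 := hball (hsub hq)
        have h2 : (ζ q).1 ∈ halfSpace n := chartImg_subset _ (pos_mem h1.2)
        rw [(b.mem_dom _ h1.1 h2).2.2]
        exact (hc.hasDerivWithinAt_coord (hsub' hq) h1.2 hρpos).mono hsub'
      have hfl2 : ∀ q ∈ Icc (max s (r - η / 2)) (min t (r + η / 2)),
          HasDerivWithinAt (b.flow z) (b.field (b.flow z q))
            (Icc (max s (r - η / 2)) (min t (r + η / 2))) q := fun q hq =>
        (b.flow_deriv z q (hst (hsub' hq))).mono (hsub'.trans hst)
      have hmemI : Icc (max s (r - η / 2)) (min t (r + η / 2)) ∈ 𝓝[Icc s t] r := by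
        filter_upwards [self_mem_nhdsWithin, nhdsWithin_le_nhds
          (Icc_mem_nhds (show r - η / 2 < r by linarith) (show r < r + η / 2 by linarith))]
          with q hq1 hq2
        exact ⟨max_le hq1.1 hq2.1, le_min hq1.2 hq2.2⟩
      -- Near `r` the rescaled geodesic and the extended flow solve the same Lipschitz equation with
      -- the same value at `r`, so they coincide; the former lies in the half space.
      filter_upwards [hmemI] with q hq
      have hd := dist_trajectories_le b.lip hfl1 hfl2 hrI hq
      rw [hζr, dist_self, zero_mul] at hd
      have heq : ζ q = b.flow z q := dist_le_zero.1 hd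
      have h1 := hball (hsub hq)
      refine ⟨by rw [← heq]; exact chartImg_subset _ (pos_mem h1.2), ?_⟩
      rw [← heq]
      simp only [hζ]
      rw [smul_smul, inv_mul_cancel₀ hρpos.ne', one_smul, param_coord h1.2]
    · intro r hr hfreq
      have hH : (b.flow z r).1 ∈ halfSpace n := by
        have h1 : ContinuousWithinAt (fun q => (b.flow z q).1) (Icc s t) r :=
          continuous_fst.continuousAt.comp_continuousWithinAt (hfl r hr)
        by_contra hcon
        have := h1 ((isClosed_halfSpace n).isOpen_compl.mem_nhds hcon)
        obtain ⟨q, hq1, hq2⟩ := (hfreq.and_eventually this).exists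
        exact hq2 hq1.1
      have hdr := (b.mem_dom _ (b.flow_mem z hz r (hst hr)) hH).1
      refine ⟨hH, ?_⟩
      by_contra hne
      have hfreq' : ∃ᶠ q in 𝓝[{q | q ∈ Icc s t ∧ Q q}] r,
          (c q).1 = param x₀ ((b.flow z q).1, ρ⁻¹ • (b.flow z q).2) := by
        have : {q | q ∈ Icc s t ∧ Q q} = Icc s t ∩ {q | Q q} := rfl
        rw [this, nhdsWithin_inter', Filter.frequently_inf_principal]
        exact hfreq.mono fun q hq => ⟨hq, hq.2⟩
      have c1 : ContinuousWithinAt (fun q => (c q).1) {q | q ∈ Icc s t ∧ Q q} r :=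
        (hcv r hr).mono fun q hq => hq.1
      have c2 : ContinuousWithinAt
          (fun q => param x₀ ((b.flow z q).1, ρ⁻¹ • (b.flow z q).2)) {q | q ∈ Icc s t ∧ Q q} r := by
        have h1 := (hfl r hr).mono (fun q (hq : q ∈ {q | q ∈ Icc s t ∧ Q q}) => hq.1)
        have h2 : ContinuousWithinAt (fun q => ((b.flow z q).1, ρ⁻¹ • (b.flow z q).2))
            {q | q ∈ Icc s t ∧ Q q} r :=
          (show Continuous fun z : Coord n × Coord n => (z.1, ρ⁻¹ • z.2) by
            fun_prop).continuousAt.comp_continuousWithinAt h1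
        exact ContinuousWithinAt.comp (t := chartImg n x₀ ×ˢ univ) (g := param x₀)
          (f := fun q => ((b.flow z q).1, ρ⁻¹ • (b.flow z q).2))
          (continuousOn_param x₀ ((b.flow z r).1, ρ⁻¹ • (b.flow z r).2) ⟨hdr, mem_univ _⟩) h2
          fun q hq => ⟨hdom q hq.1 hq.2, mem_univ _⟩
      have hne' := (c1.prodMk c2) ((isOpen_ne_fun continuous_fst continuous_snd).mem_nhds hne)
      obtain ⟨q, hq1, hq2⟩ := (hfreq'.and_eventually hne').exists
      exact hq2 hq1
  intro r hr
  refine ⟨(hall r hr).1, ?_⟩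
  have hconst : speed g x₀ (b.flow z r) = ρ := by
    rw [hρ]
    conv_rhs => rw [← b.flow_zero z]
    refine speed_const (fun q hq => hdom q hq (hall q hq)) (fun q hq => ?_) hr h0
    rw [← (b.mem_dom _ (b.flow_mem z hz q (hst hq)) (hall q hq).1).2.2]
    exact (b.flow_deriv z q (hst hq)).mono hst
  rw [normalize_param, hconst]
  exact (hall r hr).2

end FlowBox


/-! ### Topology of the unit sphere bundle and reversal of vectors. -/

section UnitBundleTopology

variable {n : ℕ} {M : Type*} [TopologicalSpace M]
  [ChartedSpace (EuclideanHalfSpace (n + 1)) M] [IsManifold (𝓡∂ (n + 1)) ∞ M]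

theorem continuousOn_normalize_param (g : Metric n M) (x₀ : M) :
    ContinuousOn (fun z => normalize g (param x₀ z)) (chartImg n x₀ ×ˢ {0}ᶜ) := by
  have h1 : ContinuousOn (speed g x₀) (chartImg n x₀ ×ˢ {0}ᶜ) := fun z hz =>
    (contDiffWithinAt_speed g hz.1 hz.2).continuousWithinAt.mono
      (prod_mono le_rfl (subset_univ _))
  have h2 : ContinuousOn (fun z : Coord n × Coord n => (z.1, (speed g x₀ z)⁻¹ • z.2))
      (chartImg n x₀ ×ˢ {0}ᶜ) :=
    continuousOn_fst.prodMk ((h1.inv₀ fun z hz => (speed_pos g hz.1 hz.2).ne').smul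
      continuousOn_snd)
  exact ((continuousOn_param x₀).comp h2 fun z hz => ⟨hz.1, mem_univ _⟩).congr
    fun z hz => normalize_param g x₀ z

/-- Finitely many compact coordinate pieces cover `M`, and over each of them the unit vectors are
the normalized images of the coordinate unit sphere. -/
instance unitCompact [T2Space M] [CompactSpace M] (g : Metric n M) : CompactSpace (UnitBundle g) := by
  suffices h : IsCompact {p : TangentBundle (𝓡∂ (n + 1)) M | g.inner p.1 p.2 p.2 = 1} from
    isCompact_iff_compactSpace.1 h
  have hK : ∀ x : M, ∃ K : Set M, K ∈ 𝓝 x ∧ K ⊆ chartDom n x ∧ IsCompact K := fun x =>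
    local_compact_nhds ((chartAt _ x).open_source.mem_nhds (mem_chart_source _ x))
  choose K hKn hKs hKc using hK
  obtain ⟨t, ht⟩ := finite_cover_nhds hKn
  have hcov : {p : TangentBundle (𝓡∂ (n + 1)) M | g.inner p.1 p.2 p.2 = 1} =
      ⋃ x ∈ t, (fun z => normalize g (param x z)) ''
        ((extChartAt (𝓡∂ (n + 1)) x '' K x) ×ˢ Metric.sphere (0 : Coord n) 1) := by
    ext p
    simp only [mem_ofPred_eq, mem_iUnion]
    constructor
    · intro hp
      have hmem : p.1 ∈ ⋃ x ∈ t, K x := ht ▸ mem_univ _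
      simp only [mem_iUnion] at hmem
      obtain ⟨x, hx, hpx⟩ := hmem
      set q : UnitBundle g := ⟨p, hp⟩
      have hv : vel x p ≠ 0 := vel_ne_zero g q (hKs x hpx)
      have hnorm : 0 < ‖vel x p‖ := norm_pos_iff.2 hv
      refine ⟨x, hx, (pos x p, ‖vel x p‖⁻¹ • vel x p), ⟨⟨p.1, hpx, rfl⟩, ?_⟩, ?_⟩
      · simp [norm_smul, hnorm.ne']
      · have h1 := speed_coord g q (hKs x hpx)
        simp only [normalize_param]
        rw [speed_smul g x _ _ (inv_nonneg.2 hnorm.le)]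
        have h2 : speed g x (pos x p, vel x p) = 1 := h1
        rw [h2, mul_one, inv_inv, smul_smul, mul_inv_cancel₀ hnorm.ne', one_smul]
        exact param_coord (hKs x hpx)
    · rintro ⟨x, -, z, ⟨⟨y, hy, hyz⟩, hz⟩, rfl⟩
      refine inner_normalize g ?_ ?_
      · rw [← hyz]; exact (extChartAt (𝓡∂ (n + 1)) x).map_source (by simpa using hKs x hy)
      · intro h; rw [h] at hz; simp at hz
  rw [hcov]
  refine t.isCompact_biUnion fun x _ => ?_
  have hc : IsCompact (extChartAt (𝓡∂ (n + 1)) x '' K x) :=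
    (hKc x).image_of_continuousOn ((continuousOn_extChartAt x).mono
      (by rw [extChartAt_source]; exact hKs x))
  refine (hc.prod (isCompact_sphere _ _)).image_of_continuousOn
    ((continuousOn_normalize_param g x).mono ?_)
  rintro z ⟨⟨y, hy, hyz⟩, hz⟩
  refine ⟨?_, ?_⟩
  · rw [← hyz]; exact (extChartAt (𝓡∂ (n + 1)) x).map_source (by simpa using hKs x hy)
  · intro h; rw [h] at hz; simp at hz

/-- Finitely many charts suffice. Second countability makes the product σ-algebra on `ℝ × UnitBundle
g` the Borel one. -/
instance tangentSecondCountable [CompactSpace M] :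
    SecondCountableTopology (TangentBundle (𝓡∂ (n + 1)) M) := by
  obtain ⟨t, ht⟩ := finite_cover_nhds (X := M) fun x =>
    (chartAt (EuclideanHalfSpace (n + 1)) x).open_source.mem_nhds (mem_chart_source _ x)
  have : SecondCountableTopology (EuclideanHalfSpace (n + 1)) :=
    inferInstanceAs (SecondCountableTopology {x : Coord n // 0 ≤ x 0})
  have : SecondCountableTopology (ModelProd (EuclideanHalfSpace (n + 1)) (Coord n)) :=
    inferInstanceAs (SecondCountableTopology (EuclideanHalfSpace (n + 1) × Coord n))
  refine ChartedSpace.secondCountable_of_countable_cover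
    (ModelProd (EuclideanHalfSpace (n + 1)) (Coord n))
    (s := (fun x : M => (⟨x, 0⟩ : TangentBundle (𝓡∂ (n + 1)) M)) '' t) ?_
    (t.countable_toSet.image _)
  refine eq_univ_of_forall fun p => ?_
  have hmem : p.1 ∈ ⋃ x ∈ t, (chartAt (EuclideanHalfSpace (n + 1)) x).source := ht ▸ mem_univ _
  simp only [mem_iUnion] at hmem ⊢
  obtain ⟨x, hx, hpx⟩ := hmem
  refine ⟨⟨x, 0⟩, ⟨x, hx, rfl⟩, ?_⟩
  rw [TangentBundle.mem_chart_source_iff]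
  exact hpx

instance unitSecondCountable [CompactSpace M] (g : Metric n M) :
    SecondCountableTopology (UnitBundle g) :=
  Topology.IsInducing.secondCountableTopology (f := fun p : UnitBundle g => p.1)
    Topology.IsInducing.subtypeVal

instance unitBorel (g : Metric n M) : BorelSpace (UnitBundle g) :=
  inferInstanceAs (BorelSpace {p : TangentBundle (𝓡∂ (n + 1)) M // g.inner p.1 p.2 p.2 = 1})

/-- The reversal `(x, v) ↦ (x, -v)`. -/
def flip (g : Metric n M) (p : UnitBundle g) : UnitBundle g :=
  ⟨⟨p.1.1, -p.1.2⟩, by simpa using p.2⟩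

theorem flip_flip (g : Metric n M) (p : UnitBundle g) : flip g (flip g p) = p :=
  Subtype.ext (by
    change (⟨p.1.1, - -p.1.2⟩ : TangentBundle (𝓡∂ (n + 1)) M) = p.1
    rw [neg_neg])

theorem coord_flip (g : Metric n M) {x₀ : M} (p : UnitBundle g) (hp : p.1.1 ∈ chartDom n x₀) :
    vel x₀ (flip g p).1 = -vel x₀ p.1 := vel_neg hp _

theorem continuous_flip (g : Metric n M) : Continuous (flip g) := by
  refine continuous_induced_rng.2 (continuous_iff_continuousAt.2 fun p => ?_)
  set x₀ := p.1.1
  have hp : p.1.1 ∈ chartDom n x₀ := mem_chart_source _ _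
  have hnhds : {q : UnitBundle g | q.1.1 ∈ chartDom n x₀} ∈ 𝓝 p :=
    ((isOpen_tangentDom x₀).preimage (UnitBundle.continuous_val g)).mem_nhds hp
  have h1 : ContinuousOn (fun q : UnitBundle g => coord x₀ q.1) {q | q.1.1 ∈ chartDom n x₀} :=
    (continuousOn_coord x₀).comp (UnitBundle.continuous_val g).continuousOn fun q hq => hq
  have h2 : ContinuousOn (fun q : UnitBundle g => param x₀ (pos x₀ q.1, -vel x₀ q.1))
      {q | q.1.1 ∈ chartDom n x₀} :=
    (continuousOn_param x₀).comp
      ((show Continuous fun z : Coord n × Coord n => (z.1, -z.2) by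
        fun_prop).comp_continuousOn h1) fun q hq => ⟨pos_mem hq, mem_univ _⟩
  refine (h2.continuousAt hnhds).congr ?_
  filter_upwards [hnhds] with q hq
  have := param_coord (p := (flip g q).1) (x₀ := x₀) hq
  rw [coord_flip g q hq] at this
  exact this

end UnitBundleTopology

/-! ### Operations on geodesics and their uniqueness. -/

section Geodesics

variable {n : ℕ} {M : Type*} [TopologicalSpace M]
  [ChartedSpace (EuclideanHalfSpace (n + 1)) M] [IsManifold (𝓡∂ (n + 1)) ∞ M] {g : Metric n M}

theorem GeodesicEqAt.mono {x₀ : M} {c : ℝ → UnitBundle g} {J J' : Set ℝ} {t : ℝ}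
    (h : GeodesicEqAt g x₀ c J t) (hJ : J' ⊆ J) : GeodesicEqAt g x₀ c J' t :=
  ⟨h.1.mono hJ, h.2.imp fun _ ha => ⟨ha.1.mono hJ, ha.2⟩⟩

theorem GeodesicEqAt.mono_of_mem {x₀ : M} {c : ℝ → UnitBundle g} {J J' : Set ℝ} {t : ℝ}
    (h : GeodesicEqAt g x₀ c J t) (hJ : J ∈ 𝓝[J'] t) : GeodesicEqAt g x₀ c J' t :=
  ⟨h.1.mono_of_mem_nhdsWithin hJ, h.2.imp fun _ ha => ⟨ha.1.mono_of_mem_nhdsWithin hJ, ha.2⟩⟩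

/-- Both one-sided accelerations solve the same nondegenerate linear equation, so they agree and
form one derivative. This is what allows geodesics to be concatenated without a corner. -/
theorem GeodesicEqAt.union {x₀ : M} {c : ℝ → UnitBundle g} {J J' : Set ℝ} {t : ℝ}
    (hx : (c t).1.1 ∈ chartDom n x₀)
    (h : GeodesicEqAt g x₀ c J t) (h' : GeodesicEqAt g x₀ c J' t) :
    GeodesicEqAt g x₀ c (J ∪ J') t := by
  obtain ⟨h1, a, ha, ha'⟩ := h
  obtain ⟨h2, a', hb, hb'⟩ := h'
  have e1 := eq_accel g (z := coord x₀ (c t).1) (pos_mem hx) ha'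
  have e2 := eq_accel g (z := coord x₀ (c t).1) (pos_mem hx) hb'
  rw [← e1] at e2
  subst e2
  exact ⟨h1.union h2, a', ha.union hb, ha'⟩

theorem GeodesicEqAt.congr {x₀ : M} {c c' : ℝ → UnitBundle g} {J : Set ℝ} {t : ℝ}
    (h : GeodesicEqAt g x₀ c J t) (ht : t ∈ J) (hcc : EqOn c' c J) : GeodesicEqAt g x₀ c' J t := by
  obtain ⟨h1, a, h2, ha⟩ := h
  have e := hcc ht
  refine ⟨?_, a, ?_, ?_⟩
  · rw [e]; exact h1.congr (fun s hs => by rw [hcc hs]) (by rw [e])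
  · exact h2.congr (fun s hs => by rw [hcc hs]) (by rw [e])
  · rw [e]; exact ha

theorem IsGeodesicOn.mono {c : ℝ → UnitBundle g} {J J' : Set ℝ} (h : IsGeodesicOn g c J)
    (hJ : J' ⊆ J) : IsGeodesicOn g c J' := by
  rw [isGeodesicOn_iff] at *
  exact ⟨h.1.mono hJ, fun t ht x₀ hx => (h.2 t (hJ ht) x₀ hx).mono hJ⟩

theorem IsGeodesicOn.congr {c c' : ℝ → UnitBundle g} {J : Set ℝ} (h : IsGeodesicOn g c J)
    (hcc : EqOn c' c J) : IsGeodesicOn g c' J := by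
  rw [isGeodesicOn_iff] at *
  exact ⟨h.1.congr hcc, fun t ht x₀ hx =>
    (h.2 t ht x₀ (by rw [← hcc ht]; exact hx)).congr ht hcc⟩

theorem IsGeodesicOn.shift {c : ℝ → UnitBundle g} {a b : ℝ} (h : IsGeodesicOn g c (Icc a b))
    (r : ℝ) : IsGeodesicOn g (fun s => c (s + r)) (Icc (a - r) (b - r)) := by
  have hm : MapsTo (fun s => s + r) (Icc (a - r) (b - r)) (Icc a b) := fun s hs =>
    ⟨by linarith [hs.1], by linarith [hs.2]⟩
  have hd : ∀ t, HasDerivWithinAt (fun s => s + r) 1 (Icc (a - r) (b - r)) t := fun t =>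
    ((hasDerivAt_id t).add_const r).hasDerivWithinAt
  rw [isGeodesicOn_iff] at *
  refine ⟨h.1.comp (by fun_prop) hm, fun t ht x₀ hx => ?_⟩
  obtain ⟨h1, α, h2, hα⟩ := h.2 (t + r) (hm ht) x₀ hx
  refine ⟨?_, α, ?_, hα⟩
  · simpa [Function.comp_def] using h1.scomp t (hd t) hm
  · simpa [Function.comp_def] using h2.scomp t (hd t) hm

theorem christoffel_neg (g : Metric n M) {x₀ : M} {y : Coord n} (hy : y ∈ chartImg n x₀)
    (u w : Coord n) : christoffel g x₀ y (-u) w = christoffel g x₀ y u w := by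
  unfold christoffel
  rw [dgram_eq g hy, dgram_eq g hy, dgram_eq g hy, dgram_eq g hy]
  simp only [map_neg, neg_apply, neg_neg]

theorem IsGeodesicOn.reverse {c : ℝ → UnitBundle g} {a b : ℝ} (h : IsGeodesicOn g c (Icc a b)) :
    IsGeodesicOn g (fun s => flip g (c (-s))) (Icc (-b) (-a)) := by
  have hm : MapsTo (fun s : ℝ => -s) (Icc (-b) (-a)) (Icc a b) := fun s hs =>
    ⟨by linarith [hs.2], by linarith [hs.1]⟩
  have hd : ∀ t : ℝ, HasDerivWithinAt (fun s : ℝ => -s) (-1) (Icc (-b) (-a)) t := fun t =>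
    (hasDerivAt_neg t).hasDerivWithinAt
  rw [isGeodesicOn_iff] at *
  have hcont : ContinuousOn (fun s => flip g (c (-s))) (Icc (-b) (-a)) :=
    (continuous_flip g).comp_continuousOn (h.1.comp (by fun_prop) hm)
  refine ⟨hcont, fun t ht x₀ hx => ?_⟩
  have hx' : (c (-t)).1.1 ∈ chartDom n x₀ := hx
  obtain ⟨h1, α, h2, hα⟩ := h.2 (-t) (hm ht) x₀ hx'
  have hcv : ContinuousWithinAt (fun s => (c (-s)).1) (Icc (-b) (-a)) t :=
    (UnitBundle.continuous_val g).continuousAt.comp_continuousWithinAt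
      ((h.1.comp (by fun_prop) hm) t ht)
  have hev : ∀ᶠ s in 𝓝[Icc (-b) (-a)] t, (c (-s)).1.1 ∈ chartDom n x₀ :=
    hcv ((isOpen_tangentDom x₀).mem_nhds hx')
  refine ⟨?_, α, ?_, ?_⟩
  · rw [coord_flip g _ hx']
    have := h1.scomp t (hd t) hm
    rw [neg_one_smul] at this
    exact this
  · have h3 : HasDerivWithinAt (fun s => -vel x₀ (c (-s)).1) α (Icc (-b) (-a)) t := by
      have := (h2.scomp t (hd t) hm).neg
      rw [neg_one_smul, neg_neg] at this
      exact this
    refine h3.congr_of_eventuallyEq ?_ (coord_flip g _ hx')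
    filter_upwards [hev] with s hs using coord_flip g _ hs
  · intro w
    rw [coord_flip g _ hx', christoffel_neg g (pos_mem (p := (flip g (c (-t))).1) hx')]
    exact hα w

theorem IsGeodesicOn.concat {c : ℝ → UnitBundle g} {a m b : ℝ} (ham : a ≤ m) (hmb : m ≤ b)
    (h1 : IsGeodesicOn g c (Icc a m)) (h2 : IsGeodesicOn g c (Icc m b)) :
    IsGeodesicOn g c (Icc a b) := by
  rw [isGeodesicOn_iff] at *
  have hU : Icc a m ∪ Icc m b = Icc a b := Icc_union_Icc_eq_Icc ham hmb
  refine ⟨hU ▸ h1.1.union_of_isClosed h2.1 isClosed_Icc isClosed_Icc, fun t ht x₀ hx => ?_⟩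
  rcases lt_trichotomy t m with htm | rfl | htm
  · refine (h1.2 t ⟨ht.1, htm.le⟩ x₀ hx).mono_of_mem ?_
    filter_upwards [self_mem_nhdsWithin, nhdsWithin_le_nhds (Iio_mem_nhds htm)] with s hs1 hs2
    exact ⟨hs1.1, le_of_lt hs2⟩
  · rw [← hU]
    exact (h1.2 t ⟨ham, le_rfl⟩ x₀ hx).union hx (h2.2 t ⟨le_rfl, hmb⟩ x₀ hx)
  · refine (h2.2 t ⟨htm.le, ht.2⟩ x₀ hx).mono_of_mem ?_
    filter_upwards [self_mem_nhdsWithin, nhdsWithin_le_nhds (Ioi_mem_nhds htm)] with s hs1 hs2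
    exact ⟨le_of_lt hs2, hs1.2⟩

theorem exists_flowBox_at (p : UnitBundle g) {x₀ : M} (hp : p.1.1 ∈ chartDom n x₀) :
    ∃ b : FlowBox g x₀, coord x₀ p.1 ∈ b.V :=
  exists_flowBox g x₀ (z₀ := coord x₀ p.1) (pos_mem hp) (vel_ne_zero g p hp)

/-- The coincidence set is open, since near a common point both curves follow the flow of one flow
box, and closed, since the unit bundle is Hausdorff. -/
theorem IsGeodesicOn.eqOn [T2Space M] {c c' : ℝ → UnitBundle g} {a b s₀ : ℝ}
    (h : IsGeodesicOn g c (Icc a b)) (h' : IsGeodesicOn g c' (Icc a b)) (hs₀ : s₀ ∈ Icc a b)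
    (heq : c s₀ = c' s₀) : EqOn c c' (Icc a b) := by
  refine forall_mem_Icc_of_clopen (P := fun r => c r = c' r) hs₀ heq ?_ ?_
  · intro r hr hrr
    have hsrc : (c r).1.1 ∈ chartDom n (c r).1.1 := mem_chart_source _ _
    obtain ⟨B, hB⟩ := exists_flowBox_at (c r) hsrc
    have hsub : Icc (max (a - r) (-B.ε)) (min (b - r) B.ε) ⊆ Icc (a - r) (b - r) :=
      Icc_subset_Icc (le_max_left _ _) (min_le_left _ _)
    have hsubε : Icc (max (a - r) (-B.ε)) (min (b - r) B.ε) ⊆ Icc (-B.ε) B.ε :=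
      Icc_subset_Icc (le_max_right _ _) (min_le_right _ _)
    have h0 : (0 : ℝ) ∈ Icc (max (a - r) (-B.ε)) (min (b - r) B.ε) :=
      ⟨max_le (by linarith [hr.1]) (by linarith [B.ε_pos]),
        le_min (by linarith [hr.2]) B.ε_pos.le⟩
    have e1 := B.eq_flow hB (chartImg_subset _ (pos_mem hsrc)) h0 hsubε ((h.shift r).mono hsub)
      (by simp only [zero_add]; exact (normalize_param_coord g (c r) hsrc).symm)
    have e2 := B.eq_flow hB (chartImg_subset _ (pos_mem hsrc)) h0 hsubε ((h'.shift r).mono hsub)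
      (by simp only [zero_add, ← hrr]; exact (normalize_param_coord g (c r) hsrc).symm)
    filter_upwards [self_mem_nhdsWithin, nhdsWithin_le_nhds (Icc_mem_nhds
      (show r - B.ε < r by linarith [B.ε_pos]) (show r < r + B.ε by linarith [B.ε_pos]))]
      with q hq1 hq2
    have hq : q - r ∈ Icc (max (a - r) (-B.ε)) (min (b - r) B.ε) :=
      ⟨max_le (by linarith [hq1.1]) (by linarith [hq2.1]),
        le_min (by linarith [hq1.2]) (by linarith [hq2.2])⟩
    have := ((e1 _ hq).2).trans ((e2 _ hq).2).symm
    rw [sub_add_cancel] at this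
    exact Subtype.ext this
  · intro r hr hfreq
    by_contra hne
    have hc := ((h.1 r hr).prodMk (h'.1 r hr))
      ((isOpen_ne_fun continuous_fst continuous_snd).mem_nhds hne)
    obtain ⟨q, hq1, hq2⟩ := (hfreq.and_eventually hc).exists
    exact hq2 hq1

end Geodesics


/-! ### The backward geodesic flow. -/

section BackFlow

variable {n : ℕ} {M : Type*} [TopologicalSpace M]
  [ChartedSpace (EuclideanHalfSpace (n + 1)) M] [IsManifold (𝓡∂ (n + 1)) ∞ M]

/-- The geodesic through `p` can be followed backwards for the time `s`. -/
def BackReach (g : Metric n M) (s : ℝ) (p : UnitBundle g) : Prop :=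
  0 ≤ s ∧ ∃ c : ℝ → UnitBundle g, c 0 = p ∧ IsGeodesicOn g c (Icc (-s) 0)

/-- A unit vector as a point of the unit sphere bundle. -/
def UnitBundle.mk {g : Metric n M} (p : TangentBundle (𝓡∂ (n + 1)) M)
    (h : g.inner p.1 p.2 p.2 = 1) : UnitBundle g := ⟨p, h⟩

open Classical in
/-- The geodesic flow at time `-s`, as long as the orbit exists. -/
def backFlow (g : Metric n M) (s : ℝ) (p : UnitBundle g) : UnitBundle g :=
  if h : BackReach g s p then h.2.choose (-s) else p

variable {g : Metric n M}

/-- Within a one-point set every vector is a derivative, so `accel` can serve as the acceleration.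
The set of reachable times in `backwardTime` thus contains `0` and is never empty. -/
theorem isGeodesicOn_singleton (c : ℝ → UnitBundle g) (t : ℝ) : IsGeodesicOn g c {t} := by
  rw [isGeodesicOn_iff]
  refine ⟨continuousOn_singleton _ _, fun s hs x₀ hx => ⟨?_, accel g x₀ (coord x₀ (c s).1), ?_,
    fun w => gram_accel g (z := coord x₀ (c s).1) (pos_mem hx) w⟩⟩
  all_goals
    rw [mem_singleton_iff] at hs; subst hs; exact HasFDerivWithinAt.of_subsingleton subsingleton_singleton

theorem backReach_zero (p : UnitBundle g) : BackReach g 0 p :=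
  ⟨le_rfl, fun _ => p, rfl, by simpa using isGeodesicOn_singleton _ _⟩

variable [T2Space M]

/-- Uniqueness removes the choice in `backFlow`: any geodesic through `p` computes it. -/
theorem IsGeodesicOn.backFlow_eq {c : ℝ → UnitBundle g} {p : UnitBundle g} {s r : ℝ}
    (hc : IsGeodesicOn g c (Icc (-s) 0)) (h0 : c 0 = p) (hr : 0 ≤ r) (hrs : r ≤ s) :
    BackReach g r p ∧ backFlow g r p = c (-r) := by
  have hsub : Icc (-r) 0 ⊆ Icc (-s) 0 := Icc_subset_Icc (by linarith) le_rfl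
  have h : BackReach g r p := ⟨hr, c, h0, hc.mono hsub⟩
  refine ⟨h, ?_⟩
  unfold backFlow
  rw [dif_pos h]
  exact h.2.choose_spec.2.eqOn (hc.mono hsub) (s₀ := 0) ⟨by linarith, le_rfl⟩
    (h.2.choose_spec.1.trans h0.symm) ⟨le_rfl, by linarith⟩

theorem BackReach.mono {p : UnitBundle g} {s r : ℝ} (h : BackReach g s p) (hr : 0 ≤ r)
    (hrs : r ≤ s) : BackReach g r p := by
  obtain ⟨c, h0, hc⟩ := h.2
  exact (hc.backFlow_eq h0 hr hrs).1

theorem backFlow_zero (p : UnitBundle g) : backFlow g 0 p = p := by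
  obtain ⟨c, h0, hc⟩ := (backReach_zero p).2
  have := (hc.backFlow_eq h0 le_rfl le_rfl).2
  rw [this, neg_zero, h0]

theorem BackReach.isGeodesicOn {p : UnitBundle g} {s : ℝ} (h : BackReach g s p) :
    IsGeodesicOn g (fun t => backFlow g (-t) p) (Icc (-s) 0) := by
  obtain ⟨c, h0, hc⟩ := h.2
  refine hc.congr fun t ht => ?_
  rw [(hc.backFlow_eq h0 (r := -t) (by linarith [ht.2]) (by linarith [ht.1])).2, neg_neg]

theorem BackReach.add {p : UnitBundle g} {r s : ℝ} (hr : BackReach g r p)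
    (hs : BackReach g s (backFlow g r p)) :
    BackReach g (r + s) p ∧ backFlow g (r + s) p = backFlow g s (backFlow g r p) := by
  set c : ℝ → UnitBundle g := fun t =>
    if -r ≤ t then backFlow g (-t) p else backFlow g (-(t + r)) (backFlow g r p) with hc
  have h1 : IsGeodesicOn g c (Icc (-r) 0) := hr.isGeodesicOn.congr fun t ht => by
    simp only [hc, if_pos ht.1]
  have h2 : IsGeodesicOn g c (Icc (-(r + s)) (-r)) := by
    have h3 := hs.isGeodesicOn.shift r
    rw [zero_sub, show -s - r = -(r + s) by ring] at h3
    refine h3.congr fun t ht => ?_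
    simp only [hc]
    split_ifs with hif
    · obtain rfl : t = -r := le_antisymm ht.2 hif
      rw [neg_neg, neg_add_cancel, neg_zero, backFlow_zero]
    · rfl
  have h4 := h2.concat (by linarith [hs.1]) (by linarith [hr.1]) h1
  have h0 : c 0 = p := by
    simp only [hc]
    rw [if_pos (by linarith [hr.1]), neg_zero, backFlow_zero]
  obtain ⟨h5, h6⟩ := h4.backFlow_eq h0 (add_nonneg hr.1 hs.1) le_rfl
  refine ⟨h5, h6.trans ?_⟩
  simp only [hc]
  split_ifs with hif
  · have : s = 0 := le_antisymm (by linarith) hs.1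
    subst this
    simp [backFlow_zero]
  · congr 1; ring

theorem BackReach.sub {p : UnitBundle g} {r s : ℝ} (h : BackReach g (r + s) p) (hr : 0 ≤ r)
    (hs : 0 ≤ s) : BackReach g s (backFlow g r p) ∧
      backFlow g s (backFlow g r p) = backFlow g (r + s) p := by
  have h1 := (h.isGeodesicOn.shift (-r)).mono (J' := Icc (-s) 0)
    (Icc_subset_Icc (by linarith) (by linarith))
  have h2 := h1.backFlow_eq (p := backFlow g r p) (by simp) hs le_rfl
  refine ⟨h2.1, h2.2.trans ?_⟩
  congr 1; ring

/-- The same orbit traversed in the opposite direction. The forward flow is thereby expressed as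
`backFlow` conjugated with `flip`. -/
theorem BackReach.flip {p : UnitBundle g} {s : ℝ} (h : BackReach g s p) {r : ℝ} (hr : 0 ≤ r)
    (hrs : r ≤ s) : BackReach g r (flip g (backFlow g s p)) ∧
      backFlow g r (TransportIP.flip g (backFlow g s p)) =
        TransportIP.flip g (backFlow g (s - r) p) := by
  have h1 := h.isGeodesicOn.reverse.shift s
  rw [neg_zero, zero_sub, neg_neg, sub_self] at h1
  have h2 := h1.backFlow_eq (p := TransportIP.flip g (backFlow g s p)) (by simp) hr hrs
  refine ⟨h2.1, h2.2.trans ?_⟩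
  congr 2; ring

/-- `NonTrapping` bounds geodesics forward in time; it is applied to the reversed vector. -/
theorem NonTrapping.bddAbove (h : NonTrapping g) (p : UnitBundle g) :
    BddAbove {s | BackReach g s p} := by
  refine BddAbove.mono (fun s (hs : BackReach g s p) => ?_) (h (flip g p))
  refine ⟨hs.1, fun t => flip g (backFlow g t p), ?_, ?_⟩
  · simp [backFlow_zero]
  · have := hs.isGeodesicOn.reverse
    rw [neg_zero, neg_neg] at this
    simpa using this

/-! ### The backward flow in a flow box -/

theorem FlowBox.exists_curve {x₀ : M} (b : FlowBox g x₀) {z : Coord n × Coord n} (hz : z ∈ b.V)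
    {p : UnitBundle g} {s t : ℝ} (hst : Icc s t ⊆ Icc (-b.ε) b.ε)
    (hH : ∀ r ∈ Icc s t, (b.flow z r).1 ∈ halfSpace n)
    (h0 : 0 ∈ Icc s t) (hp : p.1 = normalize g (param x₀ z)) :
    ∃ c : ℝ → UnitBundle g, IsGeodesicOn g c (Icc s t) ∧ c 0 = p ∧
      ∀ r ∈ Icc s t, (c r).1 = normalize g (param x₀ (b.flow z r)) := by
  classical
  set c : ℝ → UnitBundle g := fun r =>
    if h : g.inner (normalize g (param x₀ (b.flow z r))).1 (normalize g (param x₀ (b.flow z r))).2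
      (normalize g (param x₀ (b.flow z r))).2 = 1 then UnitBundle.mk _ h else p with hc
  have hcv : ∀ r ∈ Icc s t, (c r).1 = normalize g (param x₀ (b.flow z r)) := by
    intro r hr
    have hm := b.mem_dom _ (b.flow_mem z hz r (hst hr)) (hH r hr)
    simp only [hc]
    rw [dif_pos (inner_normalize g hm.1 hm.2.1)]
    rfl
  refine ⟨c, b.isGeodesicOn hz hst hH hcv, ?_, hcv⟩
  exact Subtype.ext (by rw [hcv 0 h0, b.flow_zero, hp])

/-- The bridge between the manifold and the extended equation: leaving the manifold means that the
extended orbit leaves the half space. The right-hand side is a closed condition in the initial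
value. -/
theorem FlowBox.backReach_iff {x₀ : M} (b : FlowBox g x₀) {z : Coord n × Coord n} (hz : z ∈ b.V)
    (hzH : z.1 ∈ halfSpace n) {p : UnitBundle g} (hp : p.1 = normalize g (param x₀ z)) {s : ℝ}
    (hs : 0 ≤ s) (hsε : s ≤ b.ε) :
    BackReach g s p ↔ ∀ r ∈ Icc 0 s, (b.flow z (-r)).1 ∈ halfSpace n := by
  have hsub : Icc (-s) 0 ⊆ Icc (-b.ε) b.ε := Icc_subset_Icc (by linarith) b.ε_pos.le
  have h0 : (0 : ℝ) ∈ Icc (-s) 0 := ⟨by linarith, le_rfl⟩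
  constructor
  · rintro ⟨-, c, hc0, hc⟩ r hr
    exact (b.eq_flow hz hzH h0 hsub hc (by rw [hc0, hp]) (-r)
      ⟨by linarith [hr.2], by linarith [hr.1]⟩).1
  · intro h
    obtain ⟨c, hc, hc0, -⟩ := b.exists_curve hz hsub (fun r hr => by
      have := h (-r) ⟨by linarith [hr.2], by linarith [hr.1]⟩
      rwa [neg_neg] at this) h0 hp
    exact ⟨hs, c, hc0, hc⟩

theorem FlowBox.backFlow_eq {x₀ : M} (b : FlowBox g x₀) {z : Coord n × Coord n} (hz : z ∈ b.V)
    (hzH : z.1 ∈ halfSpace n) {p : UnitBundle g} (hp : p.1 = normalize g (param x₀ z)) {s : ℝ}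
    (hsε : s ≤ b.ε) (h : BackReach g s p) :
    (backFlow g s p).1 = normalize g (param x₀ (b.flow z (-s))) := by
  have hsub : Icc (-s) 0 ⊆ Icc (-b.ε) b.ε := Icc_subset_Icc (by linarith) b.ε_pos.le
  have h0 : (0 : ℝ) ∈ Icc (-s) 0 := ⟨by linarith [h.1], le_rfl⟩
  have := b.eq_flow hz hzH h0 hsub h.isGeodesicOn (by simp [backFlow_zero, hp]) (-s)
    ⟨le_rfl, by linarith [h.1]⟩
  simpa using this.2

theorem isOpen_coord_preimage {x₀ : M} {V : Set (Coord n × Coord n)} (hV : IsOpen V) :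
    IsOpen {p : UnitBundle g | p.1.1 ∈ chartDom n x₀ ∧ coord x₀ p.1 ∈ V} := by
  have h := (continuousOn_coord (n := n) x₀).isOpen_inter_preimage (isOpen_tangentDom x₀) hV
  exact h.preimage (UnitBundle.continuous_val g)

/-- By compactness finitely many flow boxes cover all unit vectors, and their times have a positive
minimum. -/
theorem exists_uniform_flowBox [CompactSpace M] (g : Metric n M) :
    ∃ ε₀ : ℝ, 0 < ε₀ ∧ ∃ (B : ∀ q : UnitBundle g, FlowBox g q.1.1) (t : Finset (UnitBundle g)),
      (∀ q ∈ t, ε₀ ≤ (B q).ε) ∧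
      ∀ p : UnitBundle g, ∃ q ∈ t, p.1.1 ∈ chartDom n q.1.1 ∧ coord q.1.1 p.1 ∈ (B q).V := by
  have hB : ∀ q : UnitBundle g, ∃ b : FlowBox g q.1.1, coord q.1.1 q.1 ∈ b.V := fun q =>
    exists_flowBox_at q (mem_chart_source _ _)
  choose B hB using hB
  obtain ⟨t, ht⟩ := finite_cover_nhds (X := UnitBundle g)
    (U := fun q => {p | p.1.1 ∈ chartDom n q.1.1 ∧ coord q.1.1 p.1 ∈ (B q).V}) fun q =>
    (isOpen_coord_preimage (B q).isOpen_V).mem_nhds ⟨mem_chart_source _ _, hB q⟩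
  have hε : ∃ ε₀ : ℝ, 0 < ε₀ ∧ ∀ q ∈ t, ε₀ ≤ (B q).ε := by
    rcases t.eq_empty_or_nonempty with rfl | hne
    · exact ⟨1, one_pos, by simp⟩
    · exact ⟨t.inf' hne fun q => (B q).ε, by simpa using fun q _ => (B q).ε_pos,
        fun q hq => Finset.inf'_le _ hq⟩
  obtain ⟨ε₀, h0, h1⟩ := hε
  refine ⟨ε₀, h0, B, t, h1, fun p => ?_⟩
  have : p ∈ ⋃ q ∈ t, {p : UnitBundle g | p.1.1 ∈ chartDom n q.1.1 ∧
    coord q.1.1 p.1 ∈ (B q).V} := ht ▸ mem_univ _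
  simp only [mem_iUnion] at this
  obtain ⟨q, hq, hq'⟩ := this
  exact ⟨q, hq, hq'⟩

theorem coord_mem_half {x₀ : M} {p : UnitBundle g} (hp : p.1.1 ∈ chartDom n x₀) :
    (coord x₀ p.1).1 ∈ halfSpace n := chartImg_subset _ (pos_mem hp)

variable [CompactSpace M]

/-- In a flow box reachability is membership of a continuously varying orbit segment in the closed
half space, and the backward flow is a composition of continuous maps. -/
theorem isClosed_backReach_short (g : Metric n M) : ∃ ε₀ : ℝ, 0 < ε₀ ∧
    IsClosed {q : ℝ × UnitBundle g | BackReach g q.1 q.2 ∧ q.1 ≤ ε₀} ∧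
    ContinuousOn (fun q : ℝ × UnitBundle g => backFlow g q.1 q.2)
      {q : ℝ × UnitBundle g | BackReach g q.1 q.2 ∧ q.1 ≤ ε₀} := by
  obtain ⟨ε₀, hε₀, B, t, ht, hcov⟩ := exists_uniform_flowBox g
  refine ⟨ε₀, hε₀, ?_, ?_⟩
  · refine isClosed_iff_frequently.2 ?_
    rintro ⟨s₀, p₀⟩ hfreq
    obtain ⟨q, hq, hqd, hqV⟩ := hcov p₀
    have hs0 : 0 ≤ s₀ := by
      by_contra hcon
      have : ∀ᶠ x : ℝ × UnitBundle g in 𝓝 (s₀, p₀), x.1 < 0 :=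
        continuous_fst.continuousAt (Iio_mem_nhds (not_le.1 hcon))
      obtain ⟨x, h1, h2⟩ := (hfreq.and_eventually this).exists
      exact absurd h1.1.1 (not_le.2 h2)
    have hsε : s₀ ≤ ε₀ := by
      by_contra hcon
      have : ∀ᶠ x : ℝ × UnitBundle g in 𝓝 (s₀, p₀), ε₀ < x.1 :=
        continuous_fst.continuousAt (Ioi_mem_nhds (not_le.1 hcon))
      obtain ⟨x, h1, h2⟩ := (hfreq.and_eventually this).exists
      exact absurd h1.2 (not_le.2 h2)
    refine ⟨?_, hsε⟩
    rw [(B q).backReach_iff hqV (coord_mem_half hqd) (normalize_param_coord g p₀ hqd).symm hs0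
      (hsε.trans (ht q hq))]
    -- Times are written as fractions `θ s`, so that one fixed `θ` can be followed while `(s, p)`
    -- varies.
    suffices hθ : ∀ θ ∈ Icc (0 : ℝ) 1, ((B q).flow (coord q.1.1 p₀.1) (-(θ * s₀))).1 ∈
        halfSpace n by
      intro r hr
      rcases hs0.eq_or_lt with h | h
      · have := hθ 0 ⟨le_rfl, zero_le_one⟩
        rw [← h] at hr
        rw [zero_mul] at this
        rwa [le_antisymm hr.2 hr.1]
      · have := hθ (r / s₀) ⟨div_nonneg hr.1 hs0, div_le_one_of_le₀ hr.2 hs0⟩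
        rwa [div_mul_cancel₀ _ h.ne'] at this
    intro θ hθ
    by_contra hcon
    have hV : ∀ᶠ x : ℝ × UnitBundle g in 𝓝 (s₀, p₀), x.2.1.1 ∈ chartDom n q.1.1 ∧
        coord q.1.1 x.2.1 ∈ (B q).V :=
      continuous_snd.continuousAt ((isOpen_coord_preimage (B q).isOpen_V).mem_nhds ⟨hqd, hqV⟩)
    -- The time is clipped to `[0, ε]` because nearby values of `s` may fall outside the interval on
    -- which the flow is continuous.
    have hclip : ContinuousAt (fun x : ℝ × UnitBundle g =>
        ((B q).flow (coord q.1.1 x.2.1) (-(θ * (max 0 (min x.1 (B q).ε))))).1) (s₀, p₀) := by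
      have h1 : ContinuousAt (fun x : ℝ × UnitBundle g => coord q.1.1 x.2.1) (s₀, p₀) := by
        have h2 : ContinuousAt (fun x : ℝ × UnitBundle g => x.2.1) (s₀, p₀) :=
          ((UnitBundle.continuous_val g).comp continuous_snd).continuousAt
        exact ((continuousOn_coord q.1.1).continuousAt
          ((isOpen_tangentDom q.1.1).mem_nhds hqd)).comp (x := (s₀, p₀)) h2
      have h3 : ContinuousAt (fun x : ℝ × UnitBundle g => (coord q.1.1 x.2.1,
          -(θ * (max 0 (min x.1 (B q).ε))))) (s₀, p₀) := by
        refine h1.prodMk (Continuous.continuousAt ?_)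
        fun_prop
      have h4 := (B q).continuousOn_flow
      rw [← continuousWithinAt_univ] at h3 ⊢
      have hmem : ∀ x : ℝ, -(θ * (max 0 (min x (B q).ε))) ∈ Icc (-(B q).ε) (B q).ε := by
        intro x
        have e1 : 0 ≤ max 0 (min x (B q).ε) := le_max_left _ _
        have e2 : max 0 (min x (B q).ε) ≤ (B q).ε := max_le (B q).ε_pos.le (min_le_right _ _)
        constructor <;> nlinarith [hθ.1, hθ.2, (B q).ε_pos]
      exact continuous_fst.continuousAt.comp_continuousWithinAt
        (ContinuousWithinAt.comp (t := univ ×ˢ Icc (-(B q).ε) (B q).ε)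
        (g := fun p : (Coord n × Coord n) × ℝ => (B q).flow p.1 p.2)
        (f := fun x : ℝ × UnitBundle g => (coord q.1.1 x.2.1, -(θ * (max 0 (min x.1 (B q).ε)))))
        (h4 _ ⟨mem_univ _, hmem _⟩) h3 fun x _ => ⟨mem_univ _, hmem _⟩)
    have hs_clip : max 0 (min s₀ (B q).ε) = s₀ := by
      rw [min_eq_left (hsε.trans (ht q hq)), max_eq_right hs0]
    have hev := hclip ((isClosed_halfSpace n).isOpen_compl.mem_nhds (by
      simp only [hs_clip]; exact hcon))
    obtain ⟨⟨s, p⟩, ⟨h1, h1'⟩, h2, h3⟩ := (hfreq.and_eventually (hV.and hev)).exists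
    have hsB : s ≤ (B q).ε := le_trans h1' (ht q hq)
    have h4 := ((B q).backReach_iff h2.2 (coord_mem_half h2.1)
      (normalize_param_coord g p h2.1).symm h1.1 hsB).1 h1 (θ * s)
      ⟨mul_nonneg hθ.1 h1.1, mul_le_of_le_one_left h1.1 hθ.2⟩
    refine h3 ?_
    have : max 0 (min s (B q).ε) = s := by rw [min_eq_left hsB, max_eq_right h1.1]
    simp only [this]
    exact h4
  · rintro ⟨s₀, p₀⟩ ⟨hr₀, hs₀⟩
    obtain ⟨q, hq, hqd, hqV⟩ := hcov p₀
    set S : Set (ℝ × UnitBundle g) := {q | BackReach g q.1 q.2 ∧ q.1 ≤ ε₀} with hS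
    set S' : Set (ℝ × UnitBundle g) := S ∩ {x | x.2.1.1 ∈ chartDom n q.1.1 ∧
        coord q.1.1 x.2.1 ∈ (B q).V} with hS'
    have hV : {x : ℝ × UnitBundle g | x.2.1.1 ∈ chartDom n q.1.1 ∧
        coord q.1.1 x.2.1 ∈ (B q).V} ∈ 𝓝 (s₀, p₀) :=
      continuous_snd.continuousAt ((isOpen_coord_preimage (B q).isOpen_V).mem_nhds ⟨hqd, hqV⟩)
    have hS'n : S' ∈ 𝓝[S] (s₀, p₀) := Filter.inter_mem self_mem_nhdsWithin
      (nhdsWithin_le_nhds hV)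
    refine ContinuousWithinAt.mono_of_mem_nhdsWithin ?_ hS'n
    have hmemS' : (s₀, p₀) ∈ S' := ⟨⟨hr₀, hs₀⟩, hqd, hqV⟩
    have hval : ∀ x ∈ S', (backFlow g x.1 x.2).1 =
        normalize g (param q.1.1 ((B q).flow (coord q.1.1 x.2.1) (-x.1))) := fun x hx =>
      (B q).backFlow_eq hx.2.2 (coord_mem_half hx.2.1)
        (normalize_param_coord g x.2 hx.2.1).symm (hx.1.2.trans (ht q hq)) hx.1.1
    have hI : ∀ x ∈ S', -x.1 ∈ Icc (-(B q).ε) (B q).ε := fun x hx =>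
      ⟨by linarith [hx.1.2.trans (ht q hq)], by linarith [hx.1.1.1, (B q).ε_pos]⟩
    have hdom : ∀ x ∈ S', (B q).flow (coord q.1.1 x.2.1) (-x.1) ∈ chartImg n q.1.1 ×ˢ {0}ᶜ := by
      intro x hx
      have h1 := ((B q).backReach_iff hx.2.2 (coord_mem_half hx.2.1)
        (normalize_param_coord g x.2 hx.2.1).symm hx.1.1.1 (hx.1.2.trans (ht q hq))).1 hx.1.1 x.1
        ⟨hx.1.1.1, le_rfl⟩
      have h2 := (B q).mem_dom _ ((B q).flow_mem _ hx.2.2 _ (hI x hx)) h1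
      exact ⟨h2.1, h2.2.1⟩
    have hc1 : ContinuousOn (fun x : ℝ × UnitBundle g => coord q.1.1 x.2.1) S' :=
      (continuousOn_coord q.1.1).comp
        ((UnitBundle.continuous_val g).comp continuous_snd).continuousOn fun x hx => hx.2.1
    have hc2 : ContinuousOn (fun x : ℝ × UnitBundle g =>
        (B q).flow (coord q.1.1 x.2.1) (-x.1)) S' :=
      (B q).continuousOn_flow.comp (f := fun x : ℝ × UnitBundle g => (coord q.1.1 x.2.1, -x.1))
        (hc1.prodMk continuous_fst.neg.continuousOn) fun x hx => ⟨mem_univ _, hI x hx⟩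
    have hc3 := ((continuousOn_normalize_param g q.1.1).comp hc2 hdom).congr hval
    rw [continuousWithinAt_iff_continuousAt_domRestrict _ hmemS']
    have hc4 : Continuous (S'.domRestrict fun x => (backFlow g x.1 x.2)) :=
      continuous_induced_rng.2 (continuousOn_iff_continuous_domRestrict.1 hc3)
    exact hc4.continuousAt

end BackFlow


/-! ### Closedness, continuity and measurability of the flow; bounded travel times. -/

section GlobalFlow

variable {n : ℕ} {M : Type*} [TopologicalSpace M]
  [ChartedSpace (EuclideanHalfSpace (n + 1)) M] [IsManifold (𝓡∂ (n + 1)) ∞ M]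
  [T2Space M] [CompactSpace M]

/-- Induction on the number of steps of length `ε₀`: going back by `s` is going back by `min s ε₀`
and then by the rest. The new domain is the preimage of a closed set under a map that is continuous
on a closed set. -/
theorem isClosed_backReach_bounded (g : Metric n M) {ε₀ : ℝ} (hε₀ : 0 < ε₀)
    (hcl : IsClosed {q : ℝ × UnitBundle g | BackReach g q.1 q.2 ∧ q.1 ≤ ε₀})
    (hco : ContinuousOn (fun q : ℝ × UnitBundle g => backFlow g q.1 q.2)
      {q : ℝ × UnitBundle g | BackReach g q.1 q.2 ∧ q.1 ≤ ε₀}) (k : ℕ) :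
    IsClosed {q : ℝ × UnitBundle g | BackReach g q.1 q.2 ∧ q.1 ≤ k * ε₀} ∧
    ContinuousOn (fun q : ℝ × UnitBundle g => backFlow g q.1 q.2)
      {q : ℝ × UnitBundle g | BackReach g q.1 q.2 ∧ q.1 ≤ k * ε₀} := by
  induction k with
  | zero =>
    have h : {q : ℝ × UnitBundle g | BackReach g q.1 q.2 ∧ q.1 ≤ (0 : ℕ) * ε₀} =
        {q : ℝ × UnitBundle g | BackReach g q.1 q.2 ∧ q.1 ≤ ε₀} ∩ {q | q.1 ≤ 0} := by
      ext q
      simp only [Nat.cast_zero, zero_mul, mem_inter_iff, mem_ofPred_eq]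
      exact ⟨fun h => ⟨⟨h.1, h.2.trans hε₀.le⟩, h.2⟩, fun h => ⟨h.1.1, h.2⟩⟩
    rw [h]
    exact ⟨hcl.inter (isClosed_le continuous_fst continuous_const), hco.mono inter_subset_left⟩
  | succ k ih =>
    obtain ⟨ih1, ih2⟩ := ih
    set m : ℝ × UnitBundle g → ℝ × UnitBundle g := fun q => (min q.1 ε₀, q.2) with hm
    have hmc : Continuous m := by fun_prop
    set A : Set (ℝ × UnitBundle g) :=
      m ⁻¹' {q : ℝ × UnitBundle g | BackReach g q.1 q.2 ∧ q.1 ≤ ε₀} with hA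
    have hAc : IsClosed A := hcl.preimage hmc
    set G : ℝ × UnitBundle g → ℝ × UnitBundle g := fun q =>
      (q.1 - min q.1 ε₀, backFlow g (min q.1 ε₀) q.2) with hG
    have hGc : ContinuousOn G A := by
      refine ContinuousOn.prodMk (Continuous.continuousOn (by fun_prop)) ?_
      exact hco.comp hmc.continuousOn fun q hq => hq
    have hsplit : {q : ℝ × UnitBundle g | BackReach g q.1 q.2 ∧ q.1 ≤ (k + 1 : ℕ) * ε₀} =
        A ∩ G ⁻¹' {q : ℝ × UnitBundle g | BackReach g q.1 q.2 ∧ q.1 ≤ k * ε₀} := by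
      ext q
      simp only [hA, hG, hm, mem_inter_iff, mem_preimage, mem_ofPred_eq]
      push_cast
      constructor
      · rintro ⟨h1, h2⟩
        have h0 : 0 ≤ min q.1 ε₀ := le_min h1.1 hε₀.le
        have h3 : 0 ≤ q.1 - min q.1 ε₀ := sub_nonneg.2 (min_le_left _ _)
        refine ⟨⟨h1.mono h0 (min_le_left _ _), min_le_right _ _⟩, ?_, ?_⟩
        · exact (BackReach.sub (r := min q.1 ε₀) (s := q.1 - min q.1 ε₀)
            (by simpa using h1) h0 h3).1
        · rcases le_total q.1 ε₀ with h | h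
          · rw [min_eq_left h, sub_self]; positivity
          · rw [min_eq_right h]; linarith
      · rintro ⟨⟨h1, h2⟩, h3, h4⟩
        have h5 := (h1.add h3).1
        rw [add_sub_cancel] at h5
        exact ⟨h5, by linarith⟩
    refine ⟨hsplit ▸ hGc.preimage_isClosed_of_isClosed hAc ih1, ?_⟩
    rw [hsplit]
    refine (ih2.comp (hGc.mono inter_subset_left) fun q hq => hq.2).congr fun q hq => ?_
    have h5 := (BackReach.add hq.1.1 hq.2.1).2
    simp only [hm, hG, add_sub_cancel] at h5
    exact h5

theorem backReach_closed_continuousOn (g : Metric n M) :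
    IsClosed {q : ℝ × UnitBundle g | BackReach g q.1 q.2} ∧
    ContinuousOn (fun q : ℝ × UnitBundle g => backFlow g q.1 q.2)
      {q : ℝ × UnitBundle g | BackReach g q.1 q.2} := by
  obtain ⟨ε₀, hε₀, hcl, hco⟩ := isClosed_backReach_short g
  have hk := isClosed_backReach_bounded g hε₀ hcl hco
  have hlt : ∀ q : ℝ × UnitBundle g, ∃ k : ℕ, ∀ᶠ q' in 𝓝 q, q'.1 ≤ k * ε₀ := by
    intro q
    obtain ⟨k, hk⟩ := exists_nat_gt (q.1 / ε₀)
    rw [div_lt_iff₀ hε₀] at hk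
    refine ⟨k, ?_⟩
    filter_upwards [continuous_fst.continuousAt (x := q) (Iio_mem_nhds hk)] with q' hq'
    exact le_of_lt hq'
  constructor
  · refine isClosed_iff_frequently.2 fun q hq => ?_
    obtain ⟨k, hkq⟩ := hlt q
    exact ((isClosed_iff_frequently.1 (hk k).1) q (hq.and_eventually hkq)).1
  · intro q hq
    obtain ⟨k, hkq⟩ := hlt q
    refine ((hk k).2 q ⟨hq, hkq.self_of_nhds⟩).mono_of_mem_nhdsWithin ?_
    exact Filter.inter_mem self_mem_nhdsWithin (nhdsWithin_le_nhds hkq)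

theorem isClosed_setOf_backReach (g : Metric n M) (s : ℝ) :
    IsClosed {p : UnitBundle g | BackReach g s p} :=
  (backReach_closed_continuousOn g).1.preimage (Continuous.prodMk_right s)

/-- If travel times were unbounded, the nested nonempty compact sets of vectors that can be followed
back for time `k` would share a point, and its orbit would be trapped. The bound serves as `T₀`. -/
theorem exists_backReach_bound {g : Metric n M} (hnt : NonTrapping g) :
    ∃ T : ℝ, 0 < T ∧ ∀ (p : UnitBundle g) (s : ℝ), BackReach g s p → s < T := by
  by_contra! hcon
  have hne : ∀ k : ℕ, {p : UnitBundle g | BackReach g k p}.Nonempty := by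
    intro k
    obtain ⟨p, s, h1, h2⟩ := hcon (k + 1) (by positivity)
    exact ⟨p, h1.mono (Nat.cast_nonneg k) (by linarith)⟩
  obtain ⟨p, hp⟩ := IsCompact.nonempty_iInter_of_sequence_nonempty_isCompact_isClosed
    (fun k : ℕ => {p : UnitBundle g | BackReach g k p})
    (fun k p hp => BackReach.mono (s := ((k + 1 : ℕ) : ℝ)) hp (Nat.cast_nonneg k) (by simp))
    hne (isClosed_setOf_backReach g _).isCompact fun k => isClosed_setOf_backReach g _
  obtain ⟨b, hb⟩ := hnt.bddAbove p
  obtain ⟨k, hk⟩ := exists_nat_gt b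
  exact absurd (hb (mem_iInter.1 hp k)) (not_le.2 hk)

variable {g : Metric n M}

/-- The supremum is attained because the set of reachable times is closed: orbits extend to the
boundary. -/
theorem backReach_backwardTime (hnt : NonTrapping g) (p : UnitBundle g) :
    BackReach g (backwardTime g p) p := by
  have hcl : IsClosed {s | BackReach g s p} :=
    (backReach_closed_continuousOn g).1.preimage (Continuous.prodMk_left p)
  exact hcl.csSup_mem ⟨0, backReach_zero p⟩ (hnt.bddAbove p)

theorem backReach_iff_le (hnt : NonTrapping g) {p : UnitBundle g} {s : ℝ} :
    BackReach g s p ↔ 0 ≤ s ∧ s ≤ backwardTime g p :=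
  ⟨fun h => ⟨h.1, le_csSup (hnt.bddAbove p) h⟩,
    fun h => (backReach_backwardTime hnt p).mono h.1 h.2⟩

theorem backwardTime_nonneg (hnt : NonTrapping g) (p : UnitBundle g) : 0 ≤ backwardTime g p :=
  (backReach_backwardTime hnt p).1

theorem backwardTime_backFlow (hnt : NonTrapping g) {p : UnitBundle g} {r : ℝ} (hr : 0 ≤ r)
    (hrp : r ≤ backwardTime g p) :
    backwardTime g (backFlow g r p) = backwardTime g p - r := by
  have h1 : BackReach g r p := (backReach_iff_le hnt).2 ⟨hr, hrp⟩
  apply le_antisymm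
  · have := (backReach_iff_le hnt).1 (h1.add (backReach_backwardTime hnt _)).1
    linarith [this.2]
  · refine ((backReach_iff_le hnt).1 (BackReach.sub (r := r) (s := backwardTime g p - r) ?_ hr
      (by linarith)).1).2
    rw [add_sub_cancel]; exact backReach_backwardTime hnt p

theorem backFlow_backFlow (hnt : NonTrapping g) {p : UnitBundle g} {r s : ℝ} (hr : 0 ≤ r)
    (hs : 0 ≤ s) (hrs : r + s ≤ backwardTime g p) :
    backFlow g s (backFlow g r p) = backFlow g (r + s) p :=
  (BackReach.sub ((backReach_iff_le hnt).2 ⟨by linarith, hrs⟩) hr hs).2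

/-- Superlevel sets are closed, so the travel time is upper semicontinuous. -/
theorem measurable_backwardTime (hnt : NonTrapping g) : Measurable (backwardTime g) := by
  refine measurable_of_Ici fun s => ?_
  rcases le_total 0 s with hs | hs
  · have : backwardTime g ⁻¹' Ici s = {p | BackReach g s p} := by
      ext p; simp [backReach_iff_le hnt, hs]
    rw [this]
    exact (isClosed_setOf_backReach g s).measurableSet
  · have : backwardTime g ⁻¹' Ici s = univ :=
      eq_univ_of_forall fun p => hs.trans (backwardTime_nonneg hnt p)
    rw [this]; exact MeasurableSet.univ

theorem measurable_backFlow (g : Metric n M) :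
    Measurable (fun q : ℝ × UnitBundle g => backFlow g q.1 q.2) := by
  classical
  obtain ⟨hcl, hco⟩ := backReach_closed_continuousOn g
  have h := hco.measurable_piecewise (g := fun q : ℝ × UnitBundle g => q.2)
    continuous_snd.continuousOn hcl.measurableSet
  convert h using 1
  ext1 q
  by_cases hq : BackReach g q.1 q.2
  · have hq' : q ∈ {q : ℝ × UnitBundle g | BackReach g q.1 q.2} := hq
    rw [piecewise_eq_of_mem _ _ _ hq']
  · have hq' : q ∉ {q : ℝ × UnitBundle g | BackReach g q.1 q.2} := hq
    rw [piecewise_eq_of_notMem _ _ _ hq']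
    exact dif_neg hq

theorem measurable_flip (g : Metric n M) : Measurable (flip g) := (continuous_flip g).measurable

end GlobalFlow

/-! ### Strict convexity: interior and outgoing vectors in terms of travel times. -/

section Convexity

variable {n : ℕ} {M : Type*} [TopologicalSpace M]
  [ChartedSpace (EuclideanHalfSpace (n + 1)) M] [IsManifold (𝓡∂ (n + 1)) ∞ M] {g : Metric n M}

theorem mem_boundary_iff {x x₀ : M} (hx : x ∈ chartDom n x₀) :
    x ∈ (𝓡∂ (n + 1)).boundary M ↔ extChartAt (𝓡∂ (n + 1)) x₀ x 0 = 0 := by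
  have hy : extChartAt (𝓡∂ (n + 1)) x₀ x ∈ chartImg n x₀ :=
    (extChartAt (𝓡∂ (n + 1)) x₀).map_source (by simpa using hx)
  have h0 : 0 ≤ extChartAt (𝓡∂ (n + 1)) x₀ x 0 := chartImg_subset x₀ hy
  have h1 : (𝓡∂ (n + 1)).IsInteriorPoint x ↔
      extChartAt (𝓡∂ (n + 1)) x₀ x ∈ interior (chartImg n x₀) :=
    (𝓡∂ (n + 1)).isInteriorPoint_iff_of_mem_atlas (n := ∞) (by simp)
      (chart_mem_atlas _ x₀) hx
  have h2 : extChartAt (𝓡∂ (n + 1)) x₀ x ∈ interior (chartImg n x₀) ↔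
      0 < extChartAt (𝓡∂ (n + 1)) x₀ x 0 := by
    have h3 := interior_range_modelWithCornersEuclideanHalfSpace (n + 1)
    constructor
    · intro h
      have h4 := interior_mono (extChartAt_target_subset_range x₀) h
      rw [h3] at h4
      exact h4
    · intro h
      rw [mem_interior_iff_mem_nhds]
      have h5 : halfSpace n ∈ 𝓝 (extChartAt (𝓡∂ (n + 1)) x₀ x) := by
        rw [← range_model, ← mem_interior_iff_mem_nhds, h3]; exact h
      have h6 := chartImg_mem_nhdsWithin hy
      rwa [nhdsWithin_eq_nhds.2 h5] at h6
  change (𝓡∂ (n + 1)).IsBoundaryPoint x ↔ _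
  rw [ModelWithCorners.isBoundaryPoint_iff_not_isInteriorPoint, h1, h2, not_lt]
  exact ⟨fun h => le_antisymm h h0, fun h => h.le⟩

/-- The normalized metric dual of minus the zeroth coordinate form. -/
theorem exists_isOuterUnitNormal (g : Metric n M) (x : M) : ∃ ν, IsOuterUnitNormal g x ν := by
  have hx : x ∈ chartDom n x := mem_chart_source _ _
  have hy : extChartAt (𝓡∂ (n + 1)) x x ∈ chartImg n x :=
    (extChartAt (𝓡∂ (n + 1)) x).map_source (by simp)
  set y := extChartAt (𝓡∂ (n + 1)) x x
  set π₀ : Coord n →L[ℝ] ℝ := EuclideanSpace.proj 0 with hπ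
  set e : Coord n := (gramL g x y).inverse (-π₀) with he
  have hge : ∀ w : Coord n, gram g x y e w = -(w 0) := by
    intro w
    rw [← gramL_apply, he, (gramL_isInvertible g hy).self_apply_inverse]
    rfl
  have hene : e ≠ 0 := by
    intro h
    have := hge (EuclideanSpace.single 0 1)
    rw [h, ← gramL_apply] at this
    simp at this
  have hpos := gram_pos g hy hene
  have hsp : 0 < speed g x (y, e) := Real.sqrt_pos.2 hpos
  have hvel : ∀ u : Coord n, vel (n := n) x ⟨x, frameVec x x u⟩ = u := fun u => vel_frameVec hx u
  refine ⟨frameVec x x ((speed g x (y, e))⁻¹ • e), ?_, fun w hw => ?_, ?_⟩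
  · rw [inner_eq_gram g hx, hvel]
    have h1 := speed_smul g x y e (inv_nonneg.2 hsp.le)
    rw [inv_mul_cancel₀ hsp.ne'] at h1
    exact Real.sqrt_eq_one.1 h1
  · rw [inner_eq_gram g hx, hvel, ← gramL_apply, map_smul, smul_apply, gramL_apply, hge, hw]
    simp
  · rw [hvel]
    have h1 := hge e
    rw [h1] at hpos
    simp only [PiLp.smul_apply, smul_eq_mul]
    exact mul_neg_of_pos_of_neg (inv_pos.2 hsp) (by linarith)

/-- Subtracting the multiple of `ν` with the same zeroth component leaves a tangential vector, which
is orthogonal to `ν`. Signs of inner products with `ν` thus become signs of zeroth components. -/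
theorem IsOuterUnitNormal.inner_eq {x : M} {ν : TangentSpace (𝓡∂ (n + 1)) x}
    (h : IsOuterUnitNormal g x ν) (v : TangentSpace (𝓡∂ (n + 1)) x) :
    g.inner x ν v = vel (n := n) x ⟨x, v⟩ 0 / vel (n := n) x ⟨x, ν⟩ 0 := by
  have hx : x ∈ chartDom n x := mem_chart_source _ _
  set r := vel (n := n) x ⟨x, v⟩ 0 / vel (n := n) x ⟨x, ν⟩ 0 with hr
  have h1 := h.2.1 (frameVec x x (vel (n := n) x ⟨x, v⟩ - r • vel (n := n) x ⟨x, ν⟩)) (by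
    rw [vel_frameVec hx]
    simp only [PiLp.sub_apply, PiLp.smul_apply, smul_eq_mul, hr]
    rw [div_mul_cancel₀ _ h.2.2.ne, sub_self])
  have h2 := h.1
  rw [inner_eq_gram g hx] at h1 h2 ⊢
  rw [vel_frameVec hx] at h1
  rw [← gramL_apply] at h1 h2 ⊢
  rw [map_sub, map_smul, h2] at h1
  simpa [sub_eq_zero] using h1

theorem mem_outgoing_iff {p : UnitBundle g} :
    p ∈ outgoing g ↔ p.1.1 ∈ (𝓡∂ (n + 1)).boundary M ∧ vel p.1.1 p.1 0 < 0 := by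
  constructor
  · rintro ⟨h1, ν, hν, h2⟩
    refine ⟨h1, ?_⟩
    rw [hν.inner_eq] at h2
    by_contra hcon
    exact absurd h2 (not_lt.2 (div_nonpos_of_nonneg_of_nonpos (not_lt.1 hcon) hν.2.2.le))
  · rintro ⟨h1, h2⟩
    obtain ⟨ν, hν⟩ := exists_isOuterUnitNormal g p.1.1
    exact ⟨h1, ν, hν, by rw [hν.inner_eq]; exact div_pos_of_neg_of_neg h2 hν.2.2⟩

/-- The convexity condition says that the acceleration has positive inner product with `ν`, whose
zeroth component is negative. Geometrically, a geodesic tangent to the boundary bends out of the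
half space. -/
theorem accel_zero_neg (hconv : StrictlyConvexBoundary g) {x : M}
    (hx : x ∈ (𝓡∂ (n + 1)).boundary M) {u : Coord n} (hu0 : u 0 = 0) (hu : u ≠ 0) :
    accel g x (extChartAt (𝓡∂ (n + 1)) x x, u) 0 < 0 := by
  have hxd : x ∈ chartDom n x := mem_chart_source _ _
  have hy : extChartAt (𝓡∂ (n + 1)) x x ∈ chartImg n x :=
    (extChartAt (𝓡∂ (n + 1)) x).map_source (by simp)
  obtain ⟨ν, hν⟩ := exists_isOuterUnitNormal g x
  have h1 := hconv x hx ν hν u hu0 hu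
  have h2 := gram_accel g (z := (extChartAt (𝓡∂ (n + 1)) x x, u)) hy (vel (n := n) x ⟨x, ν⟩)
  have h3 := hν.inner_eq (frameVec x x (accel g x (extChartAt (𝓡∂ (n + 1)) x x, u)))
  rw [inner_eq_gram g hxd, vel_frameVec hxd, gram_comm] at h3
  simp only at h2
  rw [h3] at h2
  by_contra hcon
  have := div_nonpos_of_nonneg_of_nonpos (not_lt.1 hcon) hν.2.2.le
  linarith

theorem exists_neg_of_deriv_neg {h v : ℝ → ℝ} {a b : ℝ} (hab : a < b) (h0 : h a = 0)
    (hh : ∀ s ∈ Icc a b, HasDerivWithinAt h (v s) (Icc a b) s)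
    (hv : ∀ᶠ s in 𝓝[>] a, v s < 0) : ∃ s ∈ Icc a b, h s < 0 := by
  obtain ⟨d, hd, hvd⟩ := (mem_nhdsGT_iff_exists_Ioo_subset).1 hv
  set s := (a + min b d) / 2 with hs
  have hmin : a < min b d := lt_min hab hd
  have has : a < s := by rw [hs]; linarith
  have hsm : s < min b d := by rw [hs]; linarith
  have hsub : Icc a s ⊆ Icc a b := Icc_subset_Icc le_rfl (hsm.le.trans (min_le_left _ _))
  refine ⟨s, hsub ⟨has.le, le_rfl⟩, ?_⟩
  obtain ⟨c, hc, hce⟩ := exists_hasDerivAt_eq_slope h v has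
    (fun r hr => ((hh r (hsub hr)).mono hsub).continuousWithinAt) fun r hr =>
      (hh r (hsub ⟨hr.1.le, hr.2.le⟩)).hasDerivAt
        (Icc_mem_nhds hr.1 (hr.2.trans (hsm.trans_le (min_le_left _ _))))
  have h1 : v c < 0 := hvd ⟨hc.1, hc.2.trans (hsm.trans_le (min_le_right _ _))⟩
  rw [hce, h0, sub_zero] at h1
  have h2 : 0 < s - a := sub_pos.2 has
  by_contra hcon
  exact absurd h1 (not_lt.2 (div_nonneg (not_lt.1 hcon) h2.le))

/-- A geodesic that starts on a strictly convex boundary points inwards. -/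
theorem IsGeodesicOn.vel_start_pos (hconv : StrictlyConvexBoundary g) {c : ℝ → UnitBundle g}
    {a b : ℝ} (hab : a < b) (hc : IsGeodesicOn g c (Icc a b))
    (hbd : (c a).1.1 ∈ (𝓡∂ (n + 1)).boundary M) : 0 < vel (c a).1.1 (c a).1 0 := by
  set x := (c a).1.1 with hx
  have hxd : (c a).1.1 ∈ chartDom n x := mem_chart_source _ _
  have haI : a ∈ Icc a b := ⟨le_rfl, hab.le⟩
  have hcv : ContinuousWithinAt (fun s => (c s).1) (Icc a b) a :=
    (UnitBundle.continuous_val g).continuousAt.comp_continuousWithinAt (hc.1 a haI)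
  obtain ⟨η, hη, hball⟩ := Metric.mem_nhdsWithin_iff.1
    (hcv ((isOpen_tangentDom x).mem_nhds hxd))
  set b' := min b (a + η / 2) with hb'
  have hab' : a < b' := lt_min hab (by linarith)
  have hsub : Icc a b' ⊆ Icc a b := Icc_subset_Icc le_rfl (min_le_left _ _)
  have hdom : ∀ s ∈ Icc a b', (c s).1.1 ∈ chartDom n x := by
    intro s hs
    refine hball ⟨?_, hsub hs⟩
    rw [Metric.mem_ball, Real.dist_eq, abs_of_nonneg (by linarith [hs.1])]
    linarith [hs.2.trans (min_le_right b (a + η / 2))]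
  have hc' := isGeodesicOn_iff.1 (hc.mono hsub)
  have haI' : a ∈ Icc a b' := ⟨le_rfl, hab'.le⟩
  have hproj : ∀ {f : ℝ → Coord n} {f' : Coord n} {s : ℝ}, HasDerivWithinAt f f' (Icc a b') s →
      HasDerivWithinAt (fun s => f s 0) (f' 0) (Icc a b') s := fun h =>
    (EuclideanSpace.proj (𝕜 := ℝ) (0 : Fin (n + 1))).hasFDerivAt.comp_hasDerivWithinAt _ h
  have hpos : ∀ s ∈ Icc a b', HasDerivWithinAt (fun s => pos x (c s).1 0) (vel x (c s).1 0)
      (Icc a b') s := fun s hs => hproj (hc'.2 s hs x (hdom s hs)).1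
  obtain ⟨-, α, hα, hαe⟩ := hc'.2 a haI' x hxd
  have hα0 := hproj hα
  have hz0 : pos x (c a).1 0 = 0 := (mem_boundary_iff hxd).1 hbd
  by_contra hcon
  -- If the initial normal velocity is not positive, it becomes negative at once: by continuity if
  -- it is negative, by the convexity of the boundary if it is zero. The curve would then leave the
  -- half space.
  have hev : ∀ᶠ s in 𝓝[>] a, vel x (c s).1 0 < 0 := by
    have hle : 𝓝[>] a ≤ 𝓝[Icc a b'] a := by
      rw [← nhdsWithin_Ioo_eq_nhdsGT hab']
      exact nhdsWithin_mono _ Ioo_subset_Icc_self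
    rcases (not_lt.1 hcon).lt_or_eq with hlt | heq
    · exact (hα0.continuousWithinAt.mono_left hle) (Iio_mem_nhds hlt)
    · have hαeq : α = accel g x (coord x (c a).1) :=
        eq_accel g (z := coord x (c a).1) (pos_mem hxd) hαe
      have hneg : α 0 < 0 := by
        rw [hαeq]
        exact accel_zero_neg hconv hbd heq (vel_ne_zero g (c a) hxd)
      have hsl := hasDerivWithinAt_iff_tendsto_slope.1 hα0
      have hle2 : 𝓝[>] a ≤ 𝓝[Icc a b' \ {a}] a := by
        rw [← nhdsWithin_Ioo_eq_nhdsGT hab']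
        exact nhdsWithin_mono _ fun s hs => ⟨Ioo_subset_Icc_self hs, hs.1.ne'⟩
      filter_upwards [(hsl.mono_left hle2) (Iio_mem_nhds hneg), self_mem_nhdsWithin] with s hs1 hs2
      have hs2' : a < s := hs2
      have h1 : slope (fun s => vel x (c s).1 0) a s < 0 := hs1
      rw [slope_def_field, heq, sub_zero] at h1
      by_contra h2
      exact absurd h1 (not_lt.2 (div_nonneg (not_lt.1 h2) (by linarith)))
  obtain ⟨s, hs, hneg⟩ := exists_neg_of_deriv_neg hab' hz0 hpos hev
  have h0 : (0 : ℝ) ≤ pos x (c s).1 0 := chartImg_subset x (pos_mem (hdom s hs))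
  exact absurd hneg (not_lt.2 h0)

theorem vel_flip_self (p : UnitBundle g) : vel (flip g p).1.1 (flip g p).1 0 = -vel p.1.1 p.1 0 := by
  have h := coord_flip g (x₀ := p.1.1) p (mem_chart_source _ _)
  have h2 : vel (flip g p).1.1 (flip g p).1 = -vel p.1.1 p.1 := h
  rw [h2]; rfl

variable [T2Space M] [CompactSpace M]

theorem vel_neg_of_backwardTime_pos (hnt : NonTrapping g) (hconv : StrictlyConvexBoundary g)
    {p : UnitBundle g} (hp : 0 < backwardTime g p) (hbd : p.1.1 ∈ (𝓡∂ (n + 1)).boundary M) :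
    vel p.1.1 p.1 0 < 0 := by
  have h := (backReach_backwardTime hnt p).isGeodesicOn.reverse
  rw [neg_zero, neg_neg] at h
  have h1 := h.vel_start_pos hconv hp (by
    simp only [neg_zero, backFlow_zero]; exact hbd)
  simp only [neg_zero, backFlow_zero] at h1
  rw [vel_flip_self] at h1
  linarith

theorem backwardTime_pos_of_exists (hnt : NonTrapping g) {p : UnitBundle g} {s : ℝ} (hs : 0 < s)
    (h : BackReach g s p) : 0 < backwardTime g p :=
  hs.trans_le ((backReach_iff_le hnt).1 h).2

/-- The zeroth coordinate of the extended backward orbit is positive at the start, or vanishes there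
with positive derivative; in both cases the orbit stays in the half space for a while. -/
theorem backwardTime_pos_of_interior_or (hnt : NonTrapping g) {p : UnitBundle g}
    (hp : 0 < pos p.1.1 p.1 0 ∨ vel p.1.1 p.1 0 < 0) : 0 < backwardTime g p := by
  have hd : p.1.1 ∈ chartDom n p.1.1 := mem_chart_source _ _
  obtain ⟨B, hB⟩ := exists_flowBox_at p hd
  set z := coord p.1.1 p.1 with hz
  have hzH : z.1 ∈ halfSpace n := coord_mem_half hd
  have hz0 := B.mem_dom z (B.V_subset hB) hzH
  set y : ℝ → ℝ := fun s => (B.flow z (-s)).1 0 with hy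
  have hIcc : Icc (-B.ε) B.ε ∈ 𝓝 (0 : ℝ) :=
    Icc_mem_nhds (by linarith [B.ε_pos]) B.ε_pos
  have hd0 : HasDerivAt y (-((spray g p.1.1 z).1 0)) 0 := by
    have h1 := (B.flow_deriv z 0 B.zero_mem).hasDerivAt hIcc
    rw [B.flow_zero, hz0.2.2] at h1
    have h2 : HasDerivAt (fun s => (B.flow z s).1 0) ((spray g p.1.1 z).1 0) (-0) := by
      rw [neg_zero]
      exact ((EuclideanSpace.proj (𝕜 := ℝ) (0 : Fin (n + 1))).comp
        (ContinuousLinearMap.fst ℝ (Coord n) (Coord n))).hasFDerivAt.comp_hasDerivAt 0 h1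
    have h3 := h2.scomp (0 : ℝ) (hasDerivAt_neg 0)
    rw [neg_one_smul] at h3
    exact h3
  have hy0 : y 0 = pos p.1.1 p.1 0 := by simp only [hy, neg_zero, B.flow_zero]; rfl
  have hev : ∀ᶠ s in 𝓝[>] (0 : ℝ), 0 ≤ y s := by
    rcases (show 0 ≤ pos p.1.1 p.1 0 from hzH).lt_or_eq with h0 | h0
    · have : ∀ᶠ s in 𝓝 (0 : ℝ), 0 < y s :=
        hd0.continuousAt.eventually_mem (Ioi_mem_nhds (by rw [hy0]; exact h0))
      exact nhdsWithin_le_nhds (this.mono fun s hs => le_of_lt hs)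
    · have hv : vel p.1.1 p.1 0 < 0 := hp.resolve_left (by rw [← h0]; exact lt_irrefl _)
      have hneg : 0 < -((spray g p.1.1 z).1 0) := by
        have h1 : (spray g p.1.1 z).1 0 = (speed g p.1.1 z)⁻¹ * vel p.1.1 p.1 0 := rfl
        rw [h1, hz, speed_coord g p hd]
        linarith
      have hsl := hasDerivAt_iff_tendsto_slope.1 hd0
      have hle : 𝓝[>] (0 : ℝ) ≤ 𝓝[≠] 0 := nhdsWithin_mono _ fun s hs => ne_of_gt hs
      filter_upwards [(hsl.mono_left hle) (Ioi_mem_nhds hneg), self_mem_nhdsWithin] with s hs1 hs2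
      have h1 : 0 < slope y 0 s := hs1
      have hs2' : 0 < s := hs2
      rw [slope_def_field, hy0, ← h0, sub_zero, sub_zero] at h1
      by_contra h2
      exact absurd h1 (not_lt.2 (div_nonpos_of_nonpos_of_nonneg (not_le.1 h2).le hs2'.le))
  obtain ⟨d, hd, hsub⟩ := (mem_nhdsGT_iff_exists_Ioo_subset).1 hev
  have hd' : (0 : ℝ) < d := hd
  set s := min (d / 2) B.ε with hs
  have hspos : 0 < s := lt_min (by linarith) B.ε_pos
  refine backwardTime_pos_of_exists hnt hspos ?_
  rw [B.backReach_iff hB hzH (normalize_param_coord g p (mem_chart_source _ _)).symm hspos.le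
    (min_le_right _ _)]
  intro r hr
  rcases hr.1.eq_or_lt with h | h
  · rw [← h, neg_zero, B.flow_zero]; exact hzH
  · exact hsub ⟨h, by linarith [hr.2, min_le_left (d / 2) B.ε]⟩

/-- A boundary vector that can be followed both ways would have negative normal velocity in both
directions. This and `mem_outgoing_iff_times` also give the measurability of the boundary and of
`outgoing g`. -/
theorem mem_interior_iff_times (hnt : NonTrapping g) (hconv : StrictlyConvexBoundary g)
    {p : UnitBundle g} : p.1.1 ∉ (𝓡∂ (n + 1)).boundary M ↔
      0 < backwardTime g p ∧ 0 < backwardTime g (flip g p) := by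
  constructor
  · intro h
    have h1 : 0 < pos p.1.1 p.1 0 := by
      refine lt_of_le_of_ne (coord_mem_half (p := p) (mem_chart_source _ _)) fun h2 => h ?_
      exact (mem_boundary_iff (mem_chart_source _ _)).2 h2.symm
    exact ⟨backwardTime_pos_of_interior_or hnt (Or.inl h1),
      backwardTime_pos_of_interior_or hnt (p := flip g p) (Or.inl h1)⟩
  · rintro ⟨h1, h2⟩ hbd
    have h3 := vel_neg_of_backwardTime_pos hnt hconv h1 hbd
    have h4 := vel_neg_of_backwardTime_pos hnt hconv h2 hbd
    rw [vel_flip_self] at h4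
    linarith

theorem mem_outgoing_iff_times (hnt : NonTrapping g) (hconv : StrictlyConvexBoundary g)
    {p : UnitBundle g} : p ∈ outgoing g ↔
      0 < backwardTime g p ∧ backwardTime g (flip g p) = 0 := by
  rw [mem_outgoing_iff]
  constructor
  · rintro ⟨h1, h2⟩
    refine ⟨backwardTime_pos_of_interior_or hnt (Or.inr h2), ?_⟩
    by_contra hne
    have h3 := vel_neg_of_backwardTime_pos hnt hconv (p := flip g p)
      (lt_of_le_of_ne (backwardTime_nonneg hnt _) (Ne.symm hne)) h1
    rw [vel_flip_self] at h3
    linarith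
  · rintro ⟨h1, h2⟩
    have hbd : p.1.1 ∈ (𝓡∂ (n + 1)).boundary M := by
      by_contra h
      exact absurd h2 ((mem_interior_iff_times hnt hconv).1 h).2.ne'
    exact ⟨hbd, vel_neg_of_backwardTime_pos hnt hconv h1 hbd⟩

end Convexity



/-! ### Lipschitz maps and null sets. -/

section LipschitzNull

variable {E F : Type*} [NormedAddCommGroup E] [NormedSpace ℝ E] [FiniteDimensional ℝ E]
  [MeasurableSpace E] [BorelSpace E] [NormedAddCommGroup F] [NormedSpace ℝ F]
  [FiniteDimensional ℝ F] [MeasurableSpace F] [BorelSpace F]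

/-- In the common dimension Haar and Hausdorff measures have the same null sets, and Lipschitz maps
do not create Hausdorff measure. Source and target may be different spaces, as needed for flowing
from the boundary. -/
theorem addHaar_image_eq_zero_of_lipschitzOn (μ : Measure E) [μ.IsAddHaarMeasure] (ν : Measure F)
    [ν.IsAddHaarMeasure] (hd : Module.finrank ℝ E = Module.finrank ℝ F) {f : E → F} {s : Set E}
    {K : NNReal} (hf : LipschitzOnWith K f s) (hs : μ s = 0) : ν (f '' s) = 0 := by
  have h1 : Measure.hausdorffMeasure (Module.finrank ℝ E : ℝ) s = 0 :=
    (Measure.absolutelyContinuous_isAddHaarMeasure (Measure.hausdorffMeasure _) μ) hs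
  have h2 := hf.hausdorffMeasure_image_le (d := (Module.finrank ℝ E : ℝ)) (by positivity)
  rw [h1, mul_zero, nonpos_iff_eq_zero] at h2
  rw [hd] at h2
  exact (Measure.absolutelyContinuous_isAddHaarMeasure ν (Measure.hausdorffMeasure _)) h2

theorem addHaar_eq_zero_of_le_dist (μ : Measure E) [μ.IsAddHaarMeasure] (ν : Measure F)
    [ν.IsAddHaarMeasure] (hd : Module.finrank ℝ E = Module.finrank ℝ F) {f : E → F} {s : Set E}
    {C : ℝ} (hC : 0 ≤ C) (hf : ∀ x ∈ s, ∀ y ∈ s, dist x y ≤ C * dist (f x) (f y)) {t : Set F}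
    (ht : ν t = 0) : μ {x ∈ s | f x ∈ t} = 0 := by
  have hinj : InjOn f s := fun x hx y hy h => dist_le_zero.1 (by
    have := hf x hx y hy; rwa [h, dist_self, mul_zero] at this)
  rcases s.eq_empty_or_nonempty with rfl | hne
  · simp
  have : Nonempty E := ⟨hne.some⟩
  set G := Function.invFunOn f s
  have hG : ∀ x ∈ s, G (f x) = x := fun x hx => hinj.leftInvOn_invFunOn hx
  have hL : LipschitzOnWith (⟨C, hC⟩ : NNReal) G (t ∩ f '' s) := by
    refine LipschitzOnWith.of_dist_le_mul ?_
    rintro _ ⟨-, x, hx, rfl⟩ _ ⟨-, y, hy, rfl⟩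
    rw [hG x hx, hG y hy]
    exact hf x hx y hy
  refine measure_mono_null ?_ (addHaar_image_eq_zero_of_lipschitzOn ν μ hd.symm hL
    (measure_mono_null (inter_subset_left (s := t) (t := f '' s)) ht))
  rintro x ⟨hx, hxt⟩
  exact ⟨f x, ⟨hxt, x, hx, rfl⟩, hG x hx⟩

end LipschitzNull

/-- Valid for uncountable families: every `μ i` lies below the restriction of the supremum to `sᶜ`,
hence so does the supremum. It applies to the volumes, which are suprema over all chart centres. -/
theorem iSup_measure_eq_zero_iff {α ι : Type*} [MeasurableSpace α] {μ : ι → Measure α} {s : Set α}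
    (hs : MeasurableSet s) : (⨆ i, μ i) s = 0 ↔ ∀ i, μ i s = 0 := by
  refine ⟨fun h i => le_antisymm ((le_iSup μ i s).trans h.le) bot_le, fun h => ?_⟩
  have h1 : (⨆ i, μ i) ≤ (⨆ i, μ i).restrict sᶜ := by
    refine iSup_le fun i => ?_
    have h2 : (μ i).restrict sᶜ = μ i :=
      Measure.restrict_eq_self_of_ae_mem (measure_eq_zero_iff_ae_notMem.1 (h i))
    rw [← h2]
    exact Measure.restrict_mono le_rfl (le_iSup μ i)
  have h3 := h1 s
  rw [Measure.restrict_apply hs, inter_compl_self, measure_empty] at h3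
  exact le_antisymm h3 bot_le

/-! ### Cones over sets of unit vectors. -/

section Cones

variable {n : ℕ} {M : Type*} [TopologicalSpace M]
  [ChartedSpace (EuclideanHalfSpace (n + 1)) M] [IsManifold (𝓡∂ (n + 1)) ∞ M]

/-- The cone over a subset of the unit sphere bundle, in the chart centred at `x₀`. -/
def cone (g : Metric n M) (x₀ : M) (A : Set (UnitBundle g)) : Set (Coord n × Coord n) :=
  {z | z.1 ∈ chartImg n x₀ ∧ z.2 ≠ 0 ∧ ∃ p ∈ A, p.1 = normalize g (param x₀ z)}

variable {g : Metric n M} {x₀ x₁ : M}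

theorem coord_eq_of_normalize {z : Coord n × Coord n} (hz : z.1 ∈ chartImg n x₀)
    {p : UnitBundle g} (hp : p.1 = normalize g (param x₀ z)) :
    p.1.1 ∈ chartDom n x₀ ∧ coord x₀ p.1 = (z.1, (speed g x₀ z)⁻¹ • z.2) := by
  rw [hp, normalize_param]
  exact ⟨param_fst_mem (z := (z.1, (speed g x₀ z)⁻¹ • z.2)) hz,
    Prod.ext (pos_param_mk hz _) (vel_param_mk hz _)⟩

theorem smul_mem_cone {A : Set (UnitBundle g)} {z : Coord n × Coord n} (hz : z ∈ cone g x₀ A)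
    {r : ℝ} (hr : 0 < r) : (z.1, r • z.2) ∈ cone g x₀ A := by
  obtain ⟨h1, h2, p, hp, hpz⟩ := hz
  refine ⟨h1, smul_ne_zero hr.ne' h2, p, hp, ?_⟩
  rw [hpz, normalize_param, normalize_param, speed_smul g x₀ _ _ hr.le, smul_smul]
  congr 3
  have := (speed_pos g h1 h2).ne'
  have h3 : speed g x₀ (z.1, z.2) ≠ 0 := this
  change (speed g x₀ (z.1, z.2))⁻¹ = _
  field_simp

theorem coord_mem_cone {A : Set (UnitBundle g)} {p : UnitBundle g} (hp : p ∈ A)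
    (hx : p.1.1 ∈ chartDom n x₀) : coord x₀ p.1 ∈ cone g x₀ A :=
  ⟨pos_mem hx, vel_ne_zero g p hx, p, hp, (normalize_param_coord g p hx).symm⟩

theorem measurableSet_chartImg (x₀ : M) : MeasurableSet (chartImg n x₀) := by
  rw [chartImg, extChartAt_target]
  exact ((chartAt _ x₀).open_target.preimage (𝓡∂ (n + 1)).continuous_symm).measurableSet.inter
    (𝓡∂ (n + 1)).isClosed_range.measurableSet

theorem exists_measurable_normalize_param (p₀ : UnitBundle g) (x₀ : M) :
    ∃ e : Coord n × Coord n → UnitBundle g, Measurable e ∧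
      ∀ z ∈ chartImg n x₀ ×ˢ ({0}ᶜ : Set (Coord n)), (e z).1 = normalize g (param x₀ z) := by
  classical
  set D : Set (Coord n × Coord n) := chartImg n x₀ ×ˢ {0}ᶜ with hD
  have hDm : MeasurableSet D :=
    (measurableSet_chartImg x₀).prod (measurableSet_singleton 0).compl
  set e : Coord n × Coord n → UnitBundle g := fun z =>
    if h : z.1 ∈ chartImg n x₀ ∧ z.2 ≠ 0 then
      UnitBundle.mk (normalize g (param x₀ z)) (inner_normalize g h.1 h.2) else p₀ with he
  have hval : ∀ z ∈ D, (e z).1 = normalize g (param x₀ z) := by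
    intro z hz
    have : e z = UnitBundle.mk (normalize g (param x₀ z)) (inner_normalize g hz.1 hz.2) :=
      dif_pos ⟨hz.1, hz.2⟩
    rw [this]; rfl
  have hec : ContinuousOn e D := by
    have : ContinuousOn (fun z => (e z).1) D :=
      (continuousOn_normalize_param g x₀).congr hval
    exact (Topology.IsInducing.subtypeVal.continuousOn_iff (f := e)).2 this
  refine ⟨D.piecewise e fun _ => p₀, hec.measurable_piecewise continuousOn_const hDm,
    fun z hz => ?_⟩
  rw [piecewise_eq_of_mem _ _ _ hz, hval z hz]

theorem continuous_inner (g : Metric n M) :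
    Continuous fun p : TangentBundle (𝓡∂ (n + 1)) M => g.inner p.1 p.2 p.2 := by
  refine continuous_iff_continuousAt.2 fun p => ?_
  have hp : p.1 ∈ chartDom n p.1 := mem_chart_source _ _
  have h1 : ContinuousOn (fun q : TangentBundle (𝓡∂ (n + 1)) M =>
      gramL g p.1 (coord p.1 q).1 (coord p.1 q).2 (coord p.1 q).2) {q | q.1 ∈ chartDom n p.1} := by
    have hc := continuousOn_coord (n := n) p.1
    have h2 : ContinuousOn (fun q : TangentBundle (𝓡∂ (n + 1)) M => gramL g p.1 (coord p.1 q).1)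
        {q | q.1 ∈ chartDom n p.1} :=
      (contDiffOn_gramL g p.1).continuousOn.comp (continuous_fst.comp_continuousOn hc)
        fun q hq => pos_mem hq
    have h3 := continuous_snd.comp_continuousOn hc
    exact (h2.clm_apply h3).clm_apply h3
  refine ((h1.congr fun q hq => ?_).continuousAt ((isOpen_tangentDom p.1).mem_nhds hp))
  exact inner_eq_gram g hq _ _

theorem continuousOn_normalize (g : Metric n M) :
    ContinuousOn (normalize g) {p | 0 < g.inner p.1 p.2 p.2} := by
  intro p hp
  have hx : p.1 ∈ chartDom n p.1 := mem_chart_source _ _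
  have hev : ∀ᶠ q in 𝓝[{p | 0 < g.inner p.1 p.2 p.2}] p, q.1 ∈ chartDom n p.1 :=
    mem_nhdsWithin_of_mem_nhds ((isOpen_tangentDom p.1).mem_nhds hx)
  have key : ∀ q : TangentBundle (𝓡∂ (n + 1)) M, q.1 ∈ chartDom n p.1 →
      0 < g.inner q.1 q.2 q.2 → (coord p.1 q) ∈ chartImg n p.1 ×ˢ {0}ᶜ := by
    intro q hq h0
    refine ⟨pos_mem hq, fun h => ?_⟩
    rw [inner_eq_gram g hq] at h0
    have : vel p.1 (⟨q.1, q.2⟩ : TangentBundle (𝓡∂ (n + 1)) M) = 0 := h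
    rw [this, ← gramL_apply, map_zero] at h0
    exact lt_irrefl _ h0
  have h1 : ContinuousWithinAt (fun q => normalize g (param p.1 (coord p.1 q)))
      {p | 0 < g.inner p.1 p.2 p.2} p := by
    set S : Set (TangentBundle (𝓡∂ (n + 1)) M) :=
      {p | 0 < g.inner p.1 p.2 p.2} ∩ {q | q.1 ∈ chartDom n p.1} with hS
    have h3 : ContinuousOn (coord (n := n) p.1) S :=
      (continuousOn_coord p.1).mono inter_subset_right
    have h2 : ContinuousWithinAt (fun q => normalize g (param p.1 (coord p.1 q))) S p :=
      ((continuousOn_normalize_param g p.1).comp h3 fun q hq => key q hq.2 hq.1) p ⟨hp, hx⟩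
    exact h2.mono_of_mem_nhdsWithin (Filter.inter_mem self_mem_nhdsWithin hev)
  refine h1.congr_of_eventuallyEq ?_ ?_
  · filter_upwards [hev] with q hq
    change _ = normalize g (param p.1 (pos p.1 q, vel p.1 q))
    rw [param_coord hq]
  · change _ = normalize g (param p.1 (pos p.1 p, vel p.1 p))
    rw [param_coord hx]

theorem aemeasurable_normalize (g : Metric n M)
    (μ : Measure (TangentBundle (𝓡∂ (n + 1)) M)) :
    AEMeasurable (normalize g)
      (μ.restrict {p | 0 < g.inner p.1 p.2 p.2 ∧ g.inner p.1 p.2 p.2 ≤ 1}) := by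
  exact ((continuousOn_normalize g).aemeasurable (isOpen_lt continuous_const (continuous_inner g)).measurableSet).mono_measure
    (Measure.restrict_mono (fun p hp => hp.1) le_rfl)

theorem measurableSet_val (g : Metric n M) :
    MeasurableSet {p : TangentBundle (𝓡∂ (n + 1)) M | g.inner p.1 p.2 p.2 = 1} :=
  (isClosed_eq (continuous_inner g) continuous_const).measurableSet

theorem measurableSet_image_val {A : Set (UnitBundle g)} (hA : MeasurableSet A) :
    MeasurableSet {q : TangentBundle (𝓡∂ (n + 1)) M | ∃ p ∈ A, p.1 = q} :=
  (MeasurableEmbedding.subtype_coe (measurableSet_val g)).measurableSet_image.2 hA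

/-- Reduces null sets on the sphere bundle to null sets of truncated cones in the tangent bundle;
the dimensional factor is nonzero. -/
theorem sphereMeasure_eq_zero_iff (μ : Measure (TangentBundle (𝓡∂ (n + 1)) M))
    {A : Set (UnitBundle g)} (hA : MeasurableSet A) :
    sphereMeasure g μ A = 0 ↔
      (μ.restrict {p | 0 < g.inner p.1 p.2 p.2 ∧ g.inner p.1 p.2 p.2 ≤ 1})
        {q | ∃ p ∈ A, p.1 = normalize g q} = 0 := by
  have h1 : sphereMeasure g μ A = ((n + 1 : ℕ) : ℝ≥0∞) *
      (Measure.map (normalize g)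
      (μ.restrict {p | 0 < g.inner p.1 p.2 p.2 ∧ g.inner p.1 p.2 p.2 ≤ 1}))
        {q : TangentBundle (𝓡∂ (n + 1)) M | ∃ p ∈ A, p.1 = q} := by
    unfold sphereMeasure
    rw [Measure.smul_apply, smul_eq_mul]
    congr 1
    exact (MeasurableEmbedding.subtype_coe (measurableSet_val g)).comap_apply _ _
  rw [h1, Measure.map_apply_of_aemeasurable (aemeasurable_normalize g μ)
    (measurableSet_image_val hA)]
  simp only [mul_eq_zero, Nat.cast_eq_zero, Nat.succ_ne_zero, false_or]
  rfl

end Cones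



instance isAddHaarMeasure_volume_prod {E F : Type*} [NormedAddCommGroup E] [NormedSpace ℝ E]
    [FiniteDimensional ℝ E] [MeasureSpace E] [BorelSpace E] [(volume : Measure E).IsAddHaarMeasure]
    [NormedAddCommGroup F] [NormedSpace ℝ F] [FiniteDimensional ℝ F] [MeasureSpace F] [BorelSpace F]
    [(volume : Measure F).IsAddHaarMeasure] : (volume : Measure (E × F)).IsAddHaarMeasure :=
  have := FiniteDimensional.proper ℝ E
  have := FiniteDimensional.proper ℝ F
  Measure.prod.instIsAddHaarMeasure _ _

/-! ### Measures whose null sets are read off from cones in charts. -/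

section Conical

variable {n : ℕ} {M : Type*} [TopologicalSpace M]
  [ChartedSpace (EuclideanHalfSpace (n + 1)) M] [IsManifold (𝓡∂ (n + 1)) ∞ M]
  {Y : Type*} [NormedAddCommGroup Y] [NormedSpace ℝ Y] [FiniteDimensional ℝ Y] [MeasureSpace Y]
  [BorelSpace Y] [(volume : Measure Y).IsAddHaarMeasure]
  {g : Metric n M} {x₀ x₁ : M}

/-- A subset of the unit sphere bundle is null if and only if its cones in all charts, restricted
to the subspace parametrized by `j`, are null. -/
def IsConical (ν : Measure (UnitBundle g)) (j : Y →L[ℝ] Coord n) : Prop :=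
  ∀ A, MeasurableSet A → (ν A = 0 ↔ ∀ x₀ : M,
    volume {z : Y × Coord n | (j z.1, z.2) ∈ cone g x₀ A} = 0)

/-- The subspace parametrized by `j` is preserved by changes of coordinates. -/
def IsChartInvariant (M : Type*) [TopologicalSpace M]
    [ChartedSpace (EuclideanHalfSpace (n + 1)) M] (j : Y →L[ℝ] Coord n) : Prop :=
  (∃ r : Coord n →L[ℝ] Y, ∀ w, r (j w) = w) ∧
    ∀ (x₀ x₁ : M) (w : Y), j w ∈ transDom n x₀ x₁ → ∃ w', j w' = trans n x₀ x₁ (j w)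

theorem volume_rescale_eq_zero {S : Set (Y × Coord n)} (hS : volume S = 0) {r : ℝ} (hr : r ≠ 0) :
    volume {z : Y × Coord n | (z.1, r • z.2) ∈ S} = 0 := by
  set L : Y × Coord n →L[ℝ] Y × Coord n :=
    (ContinuousLinearMap.fst ℝ Y (Coord n)).prod (r⁻¹ • ContinuousLinearMap.snd ℝ Y (Coord n))
  refine measure_mono_null ?_ (addHaar_image_eq_zero_of_lipschitzOn volume volume rfl
    (L.lipschitz.lipschitzOnWith (s := S)) hS)
  intro z hz
  refine ⟨_, hz, Prod.ext rfl ?_⟩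
  change r⁻¹ • r • z.2 = z.2
  rw [smul_smul, inv_mul_cancel₀ hr, one_smul]

/-- Chart changes are differentiable and linear in the velocity, so they carry the cone in one chart
onto the relevant part of the cone in another and preserve null sets. -/
theorem IsConical.of_chart {ν : Measure (UnitBundle g)} {j : Y →L[ℝ] Coord n}
    (h : IsConical ν j) (hj : IsChartInvariant M j) {A : Set (UnitBundle g)}
    (hA : MeasurableSet A) (hAx : ∀ p ∈ A, p.1.1 ∈ chartDom n x₀)
    (hnull : volume {z : Y × Coord n | (j z.1, z.2) ∈ cone g x₀ A} = 0) : ν A = 0 := by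
  obtain ⟨⟨r, hr⟩, hj⟩ := hj
  refine (h A hA).2 fun x₁ => ?_
  set T : Set (Y × Coord n) := {z | (j z.1, z.2) ∈ cone g x₀ A ∧ j z.1 ∈ transDom n x₀ x₁}
  set F : Y × Coord n → Y × Coord n := fun z =>
    (r (trans n x₀ x₁ (j z.1)), dtrans n x₀ x₁ (j z.1) z.2)
  have hF : DifferentiableOn ℝ F T := by
    intro z hz
    have hJ : HasFDerivWithinAt (fun z : Y × Coord n => j z.1)
        (j.comp (ContinuousLinearMap.fst ℝ Y (Coord n))) T z :=
      (j.comp (ContinuousLinearMap.fst ℝ Y (Coord n))).hasFDerivWithinAt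
    have hm : MapsTo (fun z : Y × Coord n => j z.1) T (halfSpace n) :=
      fun z hz => transDom_subset _ _ hz.2
    have h1 : DifferentiableWithinAt ℝ (fun z : Y × Coord n => trans n x₀ x₁ (j z.1)) T z :=
      DifferentiableWithinAt.comp (g := trans n x₀ x₁) z
        (hasFDerivWithinAt_trans hz.2).differentiableWithinAt hJ.differentiableWithinAt hm
    have h2 : DifferentiableWithinAt ℝ (fun z : Y × Coord n => dtrans n x₀ x₁ (j z.1)) T z :=
      DifferentiableWithinAt.comp (g := dtrans n x₀ x₁) z
        (hasFDerivWithinAt_dtrans hz.2).differentiableWithinAt hJ.differentiableWithinAt hm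
    exact (r.differentiableAt.comp_differentiableWithinAt z h1).prodMk
      (h2.clm_apply differentiableWithinAt_snd)
  refine measure_mono_null ?_ (addHaar_image_eq_zero_of_differentiableOn_of_addHaar_eq_zero volume
    hF (measure_mono_null (fun z hz => hz.1) hnull))
  rintro z ⟨h1, h2, p, hp, hpz⟩
  obtain ⟨hx1, hc1⟩ := coord_eq_of_normalize (z := (j z.1, z.2)) h1 hpz
  have hx0 := hAx p hp
  have hpos : pos x₁ p.1 = j z.1 := congrArg Prod.fst hc1
  have hvel : vel x₁ p.1 = (speed g x₁ (j z.1, z.2))⁻¹ • z.2 := congrArg Prod.snd hc1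
  have hs := speed_pos g (z := (j z.1, z.2)) h1 h2
  have hT := pos_mem_transDom hx1 hx0
  obtain ⟨w, hw⟩ := hj x₁ x₀ z.1 (hpos ▸ hT)
  have hw' : j w = pos x₀ p.1 := by rw [hw, ← hpos, ← pos_eq_trans hx1]
  refine ⟨(w, speed g x₁ (j z.1, z.2) • vel x₀ p.1), ⟨?_, ?_⟩, Prod.ext ?_ ?_⟩
  · change (j w, _) ∈ _
    rw [hw']
    exact smul_mem_cone (coord_mem_cone hp hx0) hs
  · change j w ∈ _
    rw [hw']
    exact pos_mem_transDom hx0 hx1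
  · change r (trans n x₀ x₁ (j w)) = z.1
    rw [hw', ← pos_eq_trans hx0, hpos, hr]
  · change dtrans n x₀ x₁ (j w) _ = z.2
    rw [hw', map_smul, ← vel_eq_dtrans hx0 hx1, hvel, smul_smul, mul_inv_cancel₀ hs.ne', one_smul]

/-- To show that a set is null it suffices to look at one chart, and to look near unit vectors. -/
theorem IsConical.of_chart_open {ν : Measure (UnitBundle g)} {j : Y →L[ℝ] Coord n}
    (h : IsConical ν j) (hj : IsChartInvariant M j) {A : Set (UnitBundle g)}
    (hA : MeasurableSet A) {V : Set (Coord n × Coord n)} (hV : IsOpen V)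
    (hAx : ∀ p ∈ A, p.1.1 ∈ chartDom n x₀ ∧ coord x₀ p.1 ∈ V)
    (hnull : volume {z : Y × Coord n | (j z.1, z.2) ∈ V ∩ cone g x₀ A} = 0) : ν A = 0 := by
  refine h.of_chart hj hA (fun p hp => (hAx p hp).1) ?_
  -- Every ray of the cone passes through the open set `V` at its unit vector, hence also at a
  -- positive rational multiple of the given vector; countably many dilations of a null set suffice.
  have hcov : {z : Y × Coord n | (j z.1, z.2) ∈ cone g x₀ A} ⊆
      ⋃ r : {r : ℚ // 0 < r}, {z : Y × Coord n | (z.1, ((r : ℚ) : ℝ) • z.2) ∈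
        {z : Y × Coord n | (j z.1, z.2) ∈ V ∩ cone g x₀ A}} := by
    intro z hz
    obtain ⟨h1, h2, p, hp, hpz⟩ := id hz
    have hs := speed_pos g (z := (j z.1, z.2)) h1 h2
    obtain ⟨-, hc⟩ := coord_eq_of_normalize (z := (j z.1, z.2)) h1 hpz
    have hV' := (hAx p hp).2
    rw [hc] at hV'
    have hcont : Continuous fun r : ℝ => (j z.1, r • z.2) := by fun_prop
    have hO : IsOpen ((fun r : ℝ => (j z.1, r • z.2)) ⁻¹' V ∩ Ioi 0) :=
      (hV.preimage hcont).inter isOpen_Ioi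
    obtain ⟨r, hr⟩ := Rat.denseRange_cast.exists_mem_open hO
      ⟨(speed g x₀ (j z.1, z.2))⁻¹, hV', inv_pos.2 hs⟩
    have hr0 : (0 : ℝ) < r := hr.2
    refine mem_iUnion.2 ⟨⟨r, by exact_mod_cast hr0⟩, ?_⟩
    exact ⟨hr.1, smul_mem_cone (z := (j z.1, z.2)) hz hr0⟩
  refine measure_mono_null hcov (measure_iUnion_null fun r => ?_)
  exact volume_rescale_eq_zero hnull (by exact_mod_cast r.2.ne')

/-- The measure is absolutely continuous with respect to a finite sum of push-forwards of Lebesgue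
measure from charts. S-finiteness is what Fubini arguments require. -/
theorem IsConical.sFinite [CompactSpace M] {ν : Measure (UnitBundle g)} {j : Y →L[ℝ] Coord n}
    (h : IsConical ν j) (hj : IsChartInvariant M j) : SFinite ν := by
  rcases isEmpty_or_nonempty (UnitBundle g) with he | ⟨⟨p₀⟩⟩
  · rw [Measure.eq_zero_of_isEmpty ν]; infer_instance
  choose e hem he using exists_measurable_normalize_param (g := g) p₀
  obtain ⟨t, ht⟩ := finite_cover_nhds (X := M) fun x =>
    (chartAt (EuclideanHalfSpace (n + 1)) x).open_source.mem_nhds (mem_chart_source _ x)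
  set J : Y × Coord n → Coord n × Coord n := fun z => (j z.1, z.2)
  have hJ : Measurable J := by
    have : Continuous J := by fun_prop
    exact this.measurable
  set ρ : Measure (UnitBundle g) := Measure.sum fun x : t =>
    Measure.map (e x ∘ J) volume
  have hv : SFinite (volume : Measure (Y × Coord n)) := inferInstance
  have hm : ∀ x : t, SFinite (Measure.map (e x ∘ J) (volume : Measure (Y × Coord n))) :=
    fun x => inferInstance
  have : SFinite ρ := inferInstance
  refine sFinite_of_absolutelyContinuous (ν := ρ) (Measure.AbsolutelyContinuous.mk fun A hA h0 => ?_)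
  rw [Measure.sum_apply_eq_zero] at h0
  have hcov : A ⊆ ⋃ x : t, A ∩ {p | p.1.1 ∈ chartDom n (x : M)} := by
    intro p hp
    have hm : p.1.1 ∈ ⋃ x ∈ t, chartDom n x := ht ▸ mem_univ _
    simp only [mem_iUnion] at hm
    obtain ⟨x, hx, hpx⟩ := hm
    exact mem_iUnion.2 ⟨⟨x, hx⟩, hp, hpx⟩
  refine measure_mono_null hcov (measure_iUnion_null fun x => ?_)
  have hop : IsOpen {p : UnitBundle g | p.1.1 ∈ chartDom n (x : M)} :=
    (isOpen_tangentDom (x : M)).preimage (UnitBundle.continuous_val g)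
  refine h.of_chart hj (hA.inter hop.measurableSet) (fun p hp => hp.2) ?_
  have h1 := h0 x
  rw [Measure.map_apply ((hem x).comp hJ) hA] at h1
  refine measure_mono_null ?_ h1
  rintro z ⟨hz1, hz2, p, hp, hpz⟩
  have : e x (J z) = p := Subtype.ext ((he x _ ⟨hz1, hz2⟩).trans hpz.symm)
  change e x (J z) ∈ A
  rw [this]; exact hp.1

/-- Positive densities do not affect null sets, and in coordinates the condition concerns the cone
truncated at length one. The full cone is a countable union of dilates of the truncated one. -/
theorem isConical_sphereMeasure (g : Metric n M) (j : Y →L[ℝ] Coord n)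
    (D : M → Coord n → ℝ) (hD : ∀ x₀, ContinuousOn (D x₀) (chartImg n x₀))
    (hpos : ∀ x₀, ∀ y ∈ chartImg n x₀, 0 < D x₀ y) :
    IsConical (sphereMeasure g (⨆ x₀ : M, Measure.map (fun z => param x₀ (j z.1, z.2))
      (((volume : Measure (Y × Coord n)).restrict {z | j z.1 ∈ chartImg n x₀}).withDensity
        fun z => ENNReal.ofReal (D x₀ (j z.1))))) j := by
  intro A hA
  have hQ : MeasurableSet {p : TangentBundle (𝓡∂ (n + 1)) M |
      0 < g.inner p.1 p.2 p.2 ∧ g.inner p.1 p.2 p.2 ≤ 1} :=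
    (isOpen_lt continuous_const (continuous_inner g)).measurableSet.inter
      (isClosed_le (continuous_inner g) continuous_const).measurableSet
  rw [sphereMeasure_eq_zero_iff _ hA]
  set Q := {p : TangentBundle (𝓡∂ (n + 1)) M |
      0 < g.inner p.1 p.2 p.2 ∧ g.inner p.1 p.2 p.2 ≤ 1}
  set S := {q : TangentBundle (𝓡∂ (n + 1)) M | ∃ p ∈ A, p.1 = normalize g q}
  have hE : ∀ x₀ : M, MeasurableSet {z : Y × Coord n | j z.1 ∈ chartImg n x₀} := fun x₀ =>
    (j.continuous.measurable.comp measurable_fst) (measurableSet_chartImg x₀)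
  have hcone : ∀ x₀ : M, ∀ z : Y × Coord n, j z.1 ∈ chartImg n x₀ →
      (param x₀ (j z.1, z.2) ∈ S ∩ Q ↔
        (j z.1, z.2) ∈ cone g x₀ A ∧ speed g x₀ (j z.1, z.2) ≤ 1) := by
    intro x₀ z hz
    constructor
    · rintro ⟨⟨p, hp, hpz⟩, h0, h1⟩
      rw [inner_param] at h0 h1
      refine ⟨⟨hz, ?_, p, hp, hpz⟩, Real.sqrt_le_one.2 h1⟩
      rintro (h2 : z.2 = 0)
      rw [h2, ← gramL_apply, map_zero] at h0
      exact lt_irrefl _ h0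
    · rintro ⟨⟨-, h2, p, hp, hpz⟩, h1⟩
      refine ⟨⟨p, hp, hpz⟩, ?_, ?_⟩
      · rw [inner_param]; exact gram_pos g hz h2
      · rw [inner_param]; exact Real.sqrt_le_one.1 h1
  have hparam : ∀ x₀ : M, AEMeasurable (fun z : Y × Coord n => param x₀ (j z.1, z.2))
      (volume.restrict {z | j z.1 ∈ chartImg n x₀}) := by
    intro x₀
    refine ContinuousOn.aemeasurable ?_ (hE x₀)
    exact (continuousOn_param x₀).comp (by fun_prop) fun z hz => ⟨hz, mem_univ _⟩
  have hdens : ∀ x₀ : M, AEMeasurable (fun z : Y × Coord n => ENNReal.ofReal (D x₀ (j z.1)))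
      (volume.restrict {z | j z.1 ∈ chartImg n x₀}) := by
    intro x₀
    refine AEMeasurable.ennreal_ofReal (ContinuousOn.aemeasurable ?_ (hE x₀))
    exact (hD x₀).comp (by fun_prop) fun z hz => hz
  have hmeas : ∀ x₀ : M, ∀ R : Set (TangentBundle (𝓡∂ (n + 1)) M), MeasurableSet R →
      ((Measure.map (fun z => param x₀ (j z.1, z.2))
      (((volume : Measure (Y × Coord n)).restrict {z | j z.1 ∈ chartImg n x₀}).withDensity
        fun z => ENNReal.ofReal (D x₀ (j z.1)))) R = 0 ↔
      volume {z : Y × Coord n | j z.1 ∈ chartImg n x₀ ∧ param x₀ (j z.1, z.2) ∈ R} = 0) := by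
    intro x₀ R hR
    rw [Measure.map_apply_of_aemeasurable
      ((hparam x₀).mono_ac (withDensity_absolutelyContinuous _ _)) hR,
      withDensity_apply_eq_zero' (hdens x₀), Measure.restrict_apply₀']
    · have : ({z : Y × Coord n | ENNReal.ofReal (D x₀ (j z.1)) ≠ 0} ∩
          (fun z => param x₀ (j z.1, z.2)) ⁻¹' R) ∩ {z | j z.1 ∈ chartImg n x₀} =
          {z : Y × Coord n | j z.1 ∈ chartImg n x₀ ∧ param x₀ (j z.1, z.2) ∈ R} := by
        ext z
        constructor
        · rintro ⟨⟨-, h2⟩, h3⟩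
          exact ⟨h3, h2⟩
        · rintro ⟨h1, h2⟩
          exact ⟨⟨(ENNReal.ofReal_pos.2 (hpos x₀ _ h1)).ne', h2⟩, h1⟩
      rw [this]
    · exact (hE x₀).nullMeasurableSet
  have hSQ : MeasurableSet (S ∩ Q) := by
    classical
    set U := {p : TangentBundle (𝓡∂ (n + 1)) M | 0 < g.inner p.1 p.2 p.2}
    have hU : MeasurableSet U := (isOpen_lt continuous_const (continuous_inner g)).measurableSet
    have hf : Measurable (U.piecewise (normalize g) id) :=
      (continuousOn_normalize g).measurable_piecewise continuousOn_id hU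
    have : S ∩ Q = U.piecewise (normalize g) id ⁻¹' {q | ∃ p ∈ A, p.1 = q} ∩ Q := by
      ext q
      refine and_congr_left fun hq => ?_
      have hq' : q ∈ U := hq.1
      rw [mem_preimage, piecewise_eq_of_mem _ _ _ hq']
      rfl
    rw [this]
    exact (hf (measurableSet_image_val hA)).inter hQ
  rw [Measure.restrict_apply' hQ, iSup_measure_eq_zero_iff hSQ]
  refine forall_congr' fun x₀ => ?_
  rw [hmeas x₀ _ hSQ]
  constructor
  · intro h0
    have hcov : {z : Y × Coord n | (j z.1, z.2) ∈ cone g x₀ A} ⊆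
        ⋃ k : ℕ, {z : Y × Coord n | (z.1, ((k : ℝ) + 1)⁻¹ • z.2) ∈
          {z : Y × Coord n | j z.1 ∈ chartImg n x₀ ∧ param x₀ (j z.1, z.2) ∈ S ∩ Q}} := by
      intro z hz
      obtain ⟨k, hk⟩ := exists_nat_gt (speed g x₀ (j z.1, z.2))
      have hk0 : (0 : ℝ) < k + 1 := by positivity
      refine mem_iUnion.2 ⟨k, hz.1, (hcone x₀ (z.1, ((k : ℝ) + 1)⁻¹ • z.2) hz.1).2
        ⟨smul_mem_cone (z := (j z.1, z.2)) hz (inv_pos.2 hk0), ?_⟩⟩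
      change speed g x₀ (j z.1, ((k : ℝ) + 1)⁻¹ • z.2) ≤ 1
      rw [speed_smul g x₀ _ _ (inv_nonneg.2 hk0.le), inv_mul_le_one₀ hk0]
      linarith
    refine measure_mono_null hcov (measure_iUnion_null fun k => ?_)
    exact volume_rescale_eq_zero h0 (by positivity)
  · refine measure_mono_null fun z hz => ?_
    exact ((hcone x₀ z hz.1).1 hz.2).1

end Conical

/-! ### The volumes of the sphere bundle and of its boundary. -/

section Volumes

variable {n : ℕ} {M : Type*} [TopologicalSpace M]
  [ChartedSpace (EuclideanHalfSpace (n + 1)) M] [IsManifold (𝓡∂ (n + 1)) ∞ M]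
  {g : Metric n M} {x₀ x₁ : M}

theorem posDef_gramMatrix (g : Metric n M) {y : Coord n} (hy : y ∈ chartImg n x₀) :
    (gramMatrix g x₀ y).PosDef := by
  refine Matrix.PosDef.of_dotProduct_mulVec_pos ?_ ?_
  · ext i k
    simp [gramMatrix, Matrix.conjTranspose_apply, gram_comm g x₀ y]
  · intro u hu
    have hu' : WithLp.toLp 2 u ≠ 0 := fun h => hu (by simpa using congrArg (WithLp.ofLp) h)
    have h := gram_pos g hy hu'
    have hsum : (WithLp.toLp 2 u : Coord n) = ∑ i, u i • EuclideanSpace.single i (1 : ℝ) := by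
      ext k
      simp [Finset.sum_apply, Pi.single_apply]
    rw [← gramL_apply, hsum] at h
    simp only [map_sum, map_smul, sum_apply, smul_apply, smul_eq_mul,
      gramL_apply] at h
    simp only [dotProduct, Matrix.mulVec, gramMatrix, Matrix.of_apply, star_trivial]
    refine h.trans_eq (Finset.sum_congr rfl fun i _ => ?_)
    congr 1
    refine Finset.sum_congr rfl fun k _ => ?_
    rw [gram_comm, mul_comm]

theorem continuousOn_gramMatrix (g : Metric n M) (x₀ : M) :
    ContinuousOn (gramMatrix g x₀) (chartImg n x₀) := by
  refine continuousOn_pi.2 fun i => continuousOn_pi.2 fun k => ?_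
  exact (contDiffOn_gram g x₀ _ _).continuousOn

theorem isConical_sphereVolume (g : Metric n M) :
    IsConical (sphereVolume g) (ContinuousLinearMap.id ℝ (Coord n)) := by
  have h := isConical_sphereMeasure g (ContinuousLinearMap.id ℝ (Coord n))
    (fun x₀ y => (gramMatrix g x₀ y).det)
    (fun x₀ => continuous_id.matrix_det.comp_continuousOn (continuousOn_gramMatrix g x₀))
    (fun x₀ y hy => (posDef_gramMatrix g hy).det_pos)
  have h1 : ∀ x₀ : M, {z : Coord n × Coord n | z.1 ∈ chartImg n x₀} =
      (extChartAt (𝓡∂ (n + 1)) x₀).target ×ˢ univ := fun x₀ =>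
    Set.ext fun z => (and_iff_left (mem_univ z.2)).symm
  simp only [ContinuousLinearMap.id_apply, h1] at h
  exact h

theorem isChartInvariant_id :
    IsChartInvariant M (ContinuousLinearMap.id ℝ (Coord n)) :=
  ⟨⟨ContinuousLinearMap.id ℝ _, fun _ => rfl⟩, fun x₀ x₁ w _ => ⟨trans n x₀ x₁ w, rfl⟩⟩

/-- The inclusion of the boundary hyperplane. -/
def bdryL (n : ℕ) : EuclideanSpace ℝ (Fin n) →L[ℝ] Coord n :=
  LinearMap.toContinuousLinearMap
    { toFun := bdryPt
      map_add' := fun x y => by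
        ext i; refine Fin.cases ?_ (fun i => ?_) i <;> simp [bdryPt]
      map_smul' := fun r x => by
        ext i; refine Fin.cases ?_ (fun i => ?_) i <;> simp [bdryPt] }

/-- The projection to the boundary hyperplane. -/
def tailL (n : ℕ) : Coord n →L[ℝ] EuclideanSpace ℝ (Fin n) :=
  LinearMap.toContinuousLinearMap
    { toFun := fun y => WithLp.toLp 2 fun i => y i.succ
      map_add' := fun _ _ => rfl
      map_smul' := fun _ _ => rfl }

theorem tailL_bdryL (w : EuclideanSpace ℝ (Fin n)) : tailL n (bdryL n w) = w := rfl

theorem bdryL_tailL {y : Coord n} (hy : y 0 = 0) : bdryL n (tailL n y) = y := by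
  ext i
  refine Fin.cases ?_ (fun i => ?_) i
  · exact hy.symm
  · rfl

theorem isConical_sphereBoundaryVolume (g : Metric n M) :
    IsConical (sphereBoundaryVolume g) (bdryL n) :=
  isConical_sphereMeasure g (bdryL n)
    (fun x₀ y => √((gramMatrix g x₀ y).submatrix Fin.succ Fin.succ).det *
      √(gramMatrix g x₀ y).det)
    (fun x₀ => by
      have h := continuousOn_gramMatrix g x₀
      refine ContinuousOn.mul (ContinuousOn.sqrt ?_) (ContinuousOn.sqrt ?_)
      · exact ((continuous_id.matrix_submatrix Fin.succ Fin.succ).matrix_det).comp_continuousOn h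
      · exact continuous_id.matrix_det.comp_continuousOn h)
    (fun x₀ y hy => mul_pos
      (Real.sqrt_pos.2 (((posDef_gramMatrix g hy).submatrix (Fin.succ_injective n)).det_pos))
      (Real.sqrt_pos.2 (posDef_gramMatrix g hy).det_pos))

theorem isChartInvariant_bdryL : IsChartInvariant M (bdryL n) := by
  refine ⟨⟨tailL n, tailL_bdryL⟩, fun x₀ x₁ w hw => ⟨tailL n (trans n x₀ x₁ (bdryL n w)), ?_⟩⟩
  refine bdryL_tailL ?_
  set x := (extChartAt (𝓡∂ (n + 1)) x₀).symm (bdryL n w)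
  have h0 : x ∈ chartDom n x₀ := symm_mem hw.1
  have h1 : extChartAt (𝓡∂ (n + 1)) x₀ x = bdryL n w := (extChartAt (𝓡∂ (n + 1)) x₀).right_inv hw.1
  have hb : x ∈ (𝓡∂ (n + 1)).boundary M := (mem_boundary_iff h0).2 (by rw [h1]; rfl)
  exact (mem_boundary_iff hw.2).1 hb

instance sFinite_sphereVolume [CompactSpace M] (g : Metric n M) : SFinite (sphereVolume g) :=
  (isConical_sphereVolume g).sFinite isChartInvariant_id

instance sFinite_sphereBoundaryVolume [CompactSpace M] (g : Metric n M) :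
    SFinite (sphereBoundaryVolume g) :=
  (isConical_sphereBoundaryVolume g).sFinite isChartInvariant_bdryL

theorem measurableSet_boundary [T2Space M] [CompactSpace M] (hnt : NonTrapping g)
    (hconv : StrictlyConvexBoundary g) :
    MeasurableSet {p : UnitBundle g | p.1.1 ∈ (𝓡∂ (n + 1)).boundary M} := by
  have : {p : UnitBundle g | p.1.1 ∈ (𝓡∂ (n + 1)).boundary M}ᶜ =
      {p | 0 < backwardTime g p} ∩ {p | 0 < backwardTime g (flip g p)} :=
    Set.ext fun p => mem_interior_iff_times hnt hconv
  rw [← MeasurableSet.compl_iff, this]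
  have h := measurable_backwardTime hnt
  exact (measurableSet_lt measurable_const h).inter
    (measurableSet_lt measurable_const (h.comp (measurable_flip g)))

theorem measurableSet_outgoing [T2Space M] [CompactSpace M] (hnt : NonTrapping g)
    (hconv : StrictlyConvexBoundary g) : MeasurableSet (outgoing g) := by
  have : outgoing g = {p | 0 < backwardTime g p} ∩ {p | backwardTime g (flip g p) = 0} :=
    Set.ext fun p => mem_outgoing_iff_times hnt hconv
  rw [this]
  have h := measurable_backwardTime hnt
  exact (measurableSet_lt measurable_const h).inter
    (measurableSet_eq_fun (h.comp (measurable_flip g)) measurable_const)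

/-- In every chart the cone over the boundary lies over the hyperplane of vanishing zeroth
coordinate. -/
theorem sphereVolume_boundary [T2Space M] [CompactSpace M] (hnt : NonTrapping g)
    (hconv : StrictlyConvexBoundary g) :
    sphereVolume g {p | p.1.1 ∈ (𝓡∂ (n + 1)).boundary M} = 0 := by
  refine (isConical_sphereVolume g _ (measurableSet_boundary hnt hconv)).2 fun x₀ => ?_
  set L : Coord n →ₗ[ℝ] ℝ := (EuclideanSpace.proj (0 : Fin (n + 1))).toLinearMap
  have h0 : (volume : Measure (Coord n)) (LinearMap.ker L : Set (Coord n)) = 0 := by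
    refine Measure.addHaar_submodule _ _ fun h => ?_
    have h1 : EuclideanSpace.single (0 : Fin (n + 1)) (1 : ℝ) ∈ LinearMap.ker L := by
      rw [h]; trivial
    have h2 : EuclideanSpace.single (0 : Fin (n + 1)) (1 : ℝ) 0 = 0 := h1
    simp at h2
  have h1 : (volume : Measure (Coord n × Coord n)) ((LinearMap.ker L : Set (Coord n)) ×ˢ univ) = 0 := by
    rw [Measure.volume_eq_prod, Measure.prod_prod, h0, zero_mul]
  refine measure_mono_null ?_ h1
  rintro z ⟨hz1, hz2, p, hp, hpz⟩
  obtain ⟨hx, hc⟩ := coord_eq_of_normalize (z := z) hz1 hpz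
  have h2 : pos x₀ p.1 = z.1 := congrArg Prod.fst hc
  have h3 : pos x₀ p.1 0 = 0 := (mem_boundary_iff hx).1 hp
  rw [h2] at h3
  exact ⟨h3, mem_univ _⟩

end Volumes



/-! ### Lipschitz dependence of the flow on time. -/

section FlowBoxEstimates

variable {n : ℕ} {M : Type*} [TopologicalSpace M]
  [ChartedSpace (EuclideanHalfSpace (n + 1)) M] [IsManifold (𝓡∂ (n + 1)) ∞ M]
  {g : Metric n M} {x₀ : M} (b : FlowBox g x₀)

theorem FlowBox.exists_field_bound (R : ℝ) : ∃ C : ℝ, 0 ≤ C ∧ ∀ z, ‖z‖ ≤ R →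
    ∀ s ∈ Icc (-b.ε) b.ε, ‖b.field (b.flow z s)‖ ≤ C := by
  obtain ⟨C₀, hC₀⟩ := (isCompact_Icc.image_of_continuousOn
    (b.continuousOn_flow_right 0)).isBounded.exists_norm_le
  have hC₀' : 0 ≤ C₀ :=
    (norm_nonneg _).trans (hC₀ _ (mem_image_of_mem _ b.zero_mem))
  refine ⟨‖b.field 0‖ + b.K * (C₀ + |R| * Real.exp (b.K * b.ε)), by positivity, fun z hz s hs => ?_⟩
  have h1 : ‖b.flow z s‖ ≤ C₀ + |R| * Real.exp (b.K * b.ε) := by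
    have h2 := b.dist_flow_le z 0 hs
    rw [dist_zero_right, dist_eq_norm] at h2
    have h3 := hC₀ _ (mem_image_of_mem _ hs)
    have h4 : ‖b.flow z s‖ ≤ ‖b.flow 0 s‖ + ‖b.flow z s - b.flow 0 s‖ := by
      have := norm_add_le (b.flow 0 s) (b.flow z s - b.flow 0 s)
      rwa [add_sub_cancel] at this
    have h5 : ‖z‖ * Real.exp (b.K * b.ε) ≤ |R| * Real.exp (b.K * b.ε) :=
      mul_le_mul_of_nonneg_right (hz.trans (le_abs_self R)) (Real.exp_pos _).le
    linarith
  have h2 := b.lip.dist_le_mul (b.flow z s) 0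
  rw [dist_zero_right, dist_eq_norm] at h2
  have h4 : ‖b.field (b.flow z s)‖ ≤ ‖b.field 0‖ + ‖b.field (b.flow z s) - b.field 0‖ := by
    have := norm_add_le (b.field 0) (b.field (b.flow z s) - b.field 0)
    rwa [add_sub_cancel] at this
  have h5 : (b.K : ℝ) * ‖b.flow z s‖ ≤ b.K * (C₀ + |R| * Real.exp (b.K * b.ε)) := by gcongr
  linarith

theorem FlowBox.exists_lipschitz_time (R : ℝ) : ∃ C : ℝ, 0 ≤ C ∧ ∀ z, ‖z‖ ≤ R →
    ∀ s ∈ Icc (-b.ε) b.ε, ∀ t ∈ Icc (-b.ε) b.ε,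
      dist (b.flow z s) (b.flow z t) ≤ C * |s - t| := by
  obtain ⟨C, hC, h⟩ := b.exists_field_bound R
  refine ⟨C, hC, fun z hz s hs t ht => ?_⟩
  rw [dist_eq_norm, ← Real.norm_eq_abs]
  exact (convex_Icc _ _).norm_image_sub_le_of_norm_hasDerivWithin_le
    (fun r hr => b.flow_deriv z r hr) (fun r hr => h z hz r hr) ht hs

end FlowBoxEstimates

/-! ### The flow and null sets of the sphere bundle. -/

section FlowNull

variable {n : ℕ} {M : Type*} [TopologicalSpace M] [T2Space M] [CompactSpace M]
  [ChartedSpace (EuclideanHalfSpace (n + 1)) M] [IsManifold (𝓡∂ (n + 1)) ∞ M] {g : Metric n M}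

theorem measurableSet_hits {B : Set (UnitBundle g)} (hB : MeasurableSet B) :
    MeasurableSet {q : ℝ × UnitBundle g | BackReach g q.1 q.2 ∧ backFlow g q.1 q.2 ∈ B} :=
  (backReach_closed_continuousOn g).1.measurableSet.inter (measurable_backFlow g hB)

theorem measurableSet_hits_at {B : Set (UnitBundle g)} (hB : MeasurableSet B) (s : ℝ) :
    MeasurableSet {p : UnitBundle g | BackReach g s p ∧ backFlow g s p ∈ B} :=
  measurable_prodMk_left (measurableSet_hits hB)

theorem sphereVolume_flip {B : Set (UnitBundle g)} (hB : MeasurableSet B)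
    (h0 : sphereVolume g B = 0) : sphereVolume g (flip g ⁻¹' B) = 0 := by
  have hc := isConical_sphereVolume g
  refine (hc _ (measurable_flip g hB)).2 fun x₀ => ?_
  refine measure_mono_null ?_ (volume_rescale_eq_zero ((hc B hB).1 h0 x₀) (r := -1) (by norm_num))
  rintro z ⟨h1, h2, p, hp, hpz⟩
  change (z.1, (-1 : ℝ) • z.2) ∈ cone g x₀ B
  change z.1 ∈ chartImg n x₀ at h1
  obtain ⟨hx, hcoord⟩ := coord_eq_of_normalize (z := z) h1 hpz
  have hs := speed_pos g h1 h2
  have hx' : (flip g p).1.1 ∈ chartDom n x₀ := hx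
  have h3 : coord x₀ (flip g p).1 = (z.1, -((speed g x₀ z)⁻¹ • z.2)) := by
    refine Prod.ext (show pos x₀ p.1 = z.1 from congrArg Prod.fst hcoord) ?_
    exact (coord_flip g p hx).trans (congrArg (fun v => -v) (congrArg Prod.snd hcoord))
  have h4 := smul_mem_cone (coord_mem_cone (show flip g p ∈ B from hp) hx') hs
  rw [h3] at h4
  convert h4 using 2
  rw [smul_neg, smul_smul, mul_inv_cancel₀ hs.ne', neg_one_smul, one_smul]

/-- In a flow box the set in question is contained in the preimage of a null cone under the time
`-s` map, whose inverse is Lipschitz. -/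
theorem exists_null_backFlow_short (g : Metric n M) : ∃ ε₀ : ℝ, 0 < ε₀ ∧ ∀ s, 0 ≤ s → s ≤ ε₀ →
    ∀ B : Set (UnitBundle g), MeasurableSet B → sphereVolume g B = 0 →
      sphereVolume g {p | BackReach g s p ∧ backFlow g s p ∈ B} = 0 := by
  obtain ⟨ε₀, hε₀, b, t, hbt, hcov⟩ := exists_uniform_flowBox g
  refine ⟨ε₀, hε₀, fun s hs0 hs B hB hB0 => ?_⟩
  have hc := isConical_sphereVolume g
  set A := {p : UnitBundle g | BackReach g s p ∧ backFlow g s p ∈ B}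
  have hA : MeasurableSet A := measurableSet_hits_at hB s
  have hA' : A ⊆ ⋃ q : t, A ∩ {p | p.1.1 ∈ chartDom n (q : UnitBundle g).1.1 ∧
      coord (q : UnitBundle g).1.1 p.1 ∈ (b q).V} := by
    intro p hp
    obtain ⟨q, hq, h⟩ := hcov p
    exact mem_iUnion.2 ⟨⟨q, hq⟩, hp, h⟩
  refine measure_mono_null hA' (measure_iUnion_null fun q => ?_)
  refine hc.of_chart_open isChartInvariant_id
    (hA.inter (isOpen_coord_preimage (b q).isOpen_V).measurableSet) (b q).isOpen_V
    (fun p hp => hp.2) ?_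
  have hsε : s ≤ (b q).ε := hs.trans (hbt q q.2)
  have hsI : -s ∈ Icc (-(b q).ε) (b q).ε := ⟨by linarith, by linarith [(b q).ε_pos]⟩
  have hnull := addHaar_eq_zero_of_le_dist (volume : Measure (Coord n × Coord n))
    (volume : Measure (Coord n × Coord n)) rfl (f := fun z => (b q).flow z (-s)) (s := univ)
    (C := Real.exp ((b q).K * (b q).ε)) (Real.exp_pos _).le
    (fun z _ z' _ => ((b q).le_dist_flow z z' hsI).trans_eq (mul_comm _ _))
    ((hc B hB).1 hB0 (q : UnitBundle g).1.1)
  refine measure_mono_null ?_ hnull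
  rintro z ⟨hzV, h1, h2, p, ⟨⟨hp, hpB⟩, -⟩, hpz⟩
  change z ∈ (b q).V at hzV
  have hzH : z.1 ∈ halfSpace n := chartImg_subset _ h1
  refine ⟨mem_univ _, ?_⟩
  have hH := ((b q).backReach_iff hzV hzH hpz hs0 hsε).1 hp s ⟨hs0, le_rfl⟩
  obtain ⟨h3, h4, -⟩ := (b q).mem_dom _ ((b q).flow_mem z hzV _ hsI) hH
  exact ⟨h3, h4, _, hpB, (b q).backFlow_eq hzV hzH hpz hsε hp⟩

/-- The geodesic flow preserves null sets. -/
theorem null_backFlow (s : ℝ) {B : Set (UnitBundle g)}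
    (hB : MeasurableSet B) (h0 : sphereVolume g B = 0) :
    sphereVolume g {p | BackReach g s p ∧ backFlow g s p ∈ B} = 0 := by
  obtain ⟨ε₀, hε₀, h⟩ := exists_null_backFlow_short g
  rcases lt_or_ge s 0 with hs | hs
  · convert measure_empty (μ := sphereVolume g)
    refine eq_empty_of_forall_notMem fun p hp => ?_
    exact absurd hp.1.1 (not_le.2 hs)
  have key : ∀ k : ℕ, ∀ s, 0 ≤ s → s ≤ k * ε₀ →
      sphereVolume g {p | BackReach g s p ∧ backFlow g s p ∈ B} = 0 := by
    intro k
    induction k with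
    | zero =>
      intro s hs0 hs
      exact h s hs0 (hs.trans (by simpa using hε₀.le)) B hB h0
    | succ k ih =>
      intro s hs0 hs
      push_cast at hs
      have hr0 : 0 ≤ min s ε₀ := le_min hs0 hε₀.le
      have hs' : 0 ≤ s - min s ε₀ := sub_nonneg.2 (min_le_left _ _)
      have hk : s - min s ε₀ ≤ k * ε₀ := by
        rcases le_total s ε₀ with h1 | h1
        · rw [min_eq_left h1, sub_self]; positivity
        · rw [min_eq_right h1]; linarith
      refine measure_mono_null ?_ (h (min s ε₀) hr0 (min_le_right _ _) _
        (measurableSet_hits_at hB (s - min s ε₀)) (ih _ hs' hk))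
      rintro p ⟨hp, hpB⟩
      have hp' : BackReach g (min s ε₀ + (s - min s ε₀)) p := by rwa [add_sub_cancel]
      have h2 := hp'.sub hr0 hs'
      refine ⟨hp.mono hr0 (min_le_left _ _), h2.1, ?_⟩
      rw [h2.2, add_sub_cancel]; exact hpB
  obtain ⟨k, hk⟩ := exists_nat_gt (s / ε₀)
  exact key k s hs ((div_lt_iff₀ hε₀).1 hk).le

theorem null_forwardFlow (s : ℝ) {B : Set (UnitBundle g)}
    (hB : MeasurableSet B) (h0 : sphereVolume g B = 0) :
    sphereVolume g {p | BackReach g s (flip g p) ∧ flip g (backFlow g s (flip g p)) ∈ B} = 0 :=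
  sphereVolume_flip (measurableSet_hits_at (measurable_flip g hB) s)
    (null_backFlow s (measurable_flip g hB) (sphereVolume_flip hB h0))

/-- Almost every orbit avoids a null set at almost every time. -/
theorem ae_ae_backFlow_notMem {B : Set (UnitBundle g)} (hB : MeasurableSet B)
    (h0 : sphereVolume g B = 0) :
    ∀ᵐ p ∂(sphereVolume g), ∀ᵐ s : ℝ, BackReach g s p → backFlow g s p ∉ B := by
  have hm : MeasurableSet {q : ℝ × UnitBundle g | BackReach g q.1 q.2 → backFlow g q.1 q.2 ∉ B} := by
    convert (measurableSet_hits hB).compl using 1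
    ext q; simp
  -- Fubini: it is enough to fix the time `s` and exclude a null set of vectors.
  refine (Measure.ae_ae_comm hm).1 (Filter.Eventually.of_forall fun s => ?_)
  refine measure_mono_null ?_ (null_backFlow s hB h0)
  intro p hp
  simpa using hp

end FlowNull



/-! ### Flowing back from the outgoing boundary for a short time. -/

section Transversal

variable {n : ℕ} {M : Type*} [TopologicalSpace M] [T2Space M] [CompactSpace M]
  [ChartedSpace (EuclideanHalfSpace (n + 1)) M] [IsManifold (𝓡∂ (n + 1)) ∞ M] {g : Metric n M}

/-- Near an outgoing vector, the backward flow of boundary vectors has a Lipschitz inverse. -/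
theorem exists_transversal_flowBox {p₀ : UnitBundle g} (hp₀ : p₀ ∈ outgoing g) :
    ∃ (b : FlowBox g p₀.1.1) (V : Set (Coord n × Coord n)) (ε C : ℝ), IsOpen V ∧ V ⊆ b.V ∧
      coord p₀.1.1 p₀.1 ∈ V ∧ 0 < ε ∧ ε ≤ b.ε ∧ 0 ≤ C ∧
      ∀ z ∈ V, ∀ z' ∈ V, z.1 0 = 0 → z'.1 0 = 0 → ∀ s ∈ Icc 0 ε, ∀ s' ∈ Icc 0 ε,
        dist z z' ≤ C * dist (b.flow z (-s)) (b.flow z' (-s')) ∧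
        |s - s'| ≤ C * dist (b.flow z (-s)) (b.flow z' (-s')) := by
  set x₀ := p₀.1.1
  have hx : p₀.1.1 ∈ chartDom n x₀ := mem_chart_source _ _
  obtain ⟨b, hb⟩ := exists_flowBox_at p₀ hx
  set z₀ := coord x₀ p₀.1
  have hfield : (b.field z₀).1 0 < 0 := by
    rw [(b.mem_dom z₀ (b.V_subset hb) (coord_mem_half hx)).2.2]
    change (speed g x₀ z₀)⁻¹ * vel x₀ p₀.1 0 < 0
    rw [speed_coord g p₀ hx, inv_one, one_mul]
    exact (mem_outgoing_iff.1 hp₀).2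
  set L : Coord n × Coord n →L[ℝ] ℝ :=
    (EuclideanSpace.proj (0 : Fin (n + 1))).comp (ContinuousLinearMap.fst ℝ (Coord n) (Coord n))
  have hLle : ∀ v, |L v| ≤ ‖v‖ := fun v =>
    (PiLp.norm_apply_le v.1 0 : |L v| ≤ ‖v.1‖).trans (norm_fst_le v)
  -- Half the speed with which the backward orbit of the outgoing vector leaves the boundary
  -- hyperplane; by continuity this rate is kept in a neighbourhood.
  set c : ℝ := -(L (b.field z₀)) / 2 with hc
  have hLf : L (b.field z₀) < 0 := hfield
  have hc0 : 0 < c := by rw [hc]; linarith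
  have hcont : ContinuousAt (fun p : (Coord n × Coord n) × ℝ => L (b.field (b.flow p.1 p.2)))
      (z₀, 0) := by
    have h1 : ContinuousAt (fun p : (Coord n × Coord n) × ℝ => b.flow p.1 p.2) (z₀, 0) :=
      b.continuousOn_flow.continuousAt (prod_mem_nhds Filter.univ_mem
        (Icc_mem_nhds (by linarith [b.ε_pos]) b.ε_pos))
    exact (L.continuous.comp b.lip.continuous).continuousAt.comp h1
  have hev : ∀ᶠ p in 𝓝 ((z₀, 0) : (Coord n × Coord n) × ℝ), L (b.field (b.flow p.1 p.2)) < -c :=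
    hcont.eventually_lt_const (by simp only [b.flow_zero]; rw [hc]; linarith)
  obtain ⟨δ, hδ, hball⟩ := Metric.eventually_nhds_iff_ball.1 hev
  obtain ⟨D, hD0, hD⟩ := b.exists_lipschitz_time (‖z₀‖ + δ)
  set ε := min (δ / 2) b.ε with hε
  have hε0 : 0 < ε := lt_min (half_pos hδ) b.ε_pos
  have hεb : ε ≤ b.ε := min_le_right _ _
  have hεδ : ε < δ := (min_le_left _ _).trans_lt (half_lt_self hδ)
  set V := Metric.ball z₀ δ ∩ b.V
  set X := Real.exp (b.K * b.ε)
  have hX : 0 < X := Real.exp_pos _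
  have hdesc : ∀ z ∈ V, ∀ s ∈ Icc 0 ε, L z + c * s ≤ L (b.flow z (-s)) := by
    intro z hz s hs
    have hsub : Icc (-ε) 0 ⊆ Icc (-b.ε) b.ε := Icc_subset_Icc (by linarith) b.ε_pos.le
    have hder : ∀ r ∈ Icc (-ε) 0, HasDerivWithinAt (fun r => L (b.flow z r) + c * r)
        (L (b.field (b.flow z r)) + c * 1) (Icc (-ε) 0) r := fun r hr =>
      (L.hasFDerivAt.comp_hasDerivWithinAt r ((b.flow_deriv z r (hsub hr)).mono hsub)).add
        ((hasDerivWithinAt_id r _).const_mul c)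
    have hanti := antitoneOn_of_hasDerivWithinAt_nonpos (convex_Icc (-ε) 0)
      (fun r hr => (hder r hr).continuousWithinAt)
      (fun r hr => (hder r (interior_subset hr)).mono interior_subset)
      (fun r hr => by
        have hr' := interior_subset hr
        have h1 : ((z, r) : (Coord n × Coord n) × ℝ) ∈ Metric.ball (z₀, (0 : ℝ)) δ := by
          rw [← ball_prod_same]
          refine ⟨hz.1, ?_⟩
          change r ∈ Metric.ball (0 : ℝ) δ
          rw [mem_ball_zero_iff, Real.norm_eq_abs, abs_lt]
          exact ⟨by linarith [hr'.1], by linarith [hr'.2]⟩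
        have h2 := hball _ h1
        simp only at h2
        linarith)
    have h := hanti (a := -s) (b := 0) ⟨by linarith [hs.2], by linarith [hs.1]⟩
      ⟨by linarith, le_rfl⟩ (by linarith [hs.1])
    simp only [b.flow_zero] at h
    linarith
  set C := max (X / c) (D * (X / c) + X)
  have hC0 : 0 ≤ C := le_max_of_le_left (by positivity)
  have key : ∀ z ∈ V, ∀ z' ∈ V, z.1 0 = 0 → z'.1 0 = 0 → ∀ s ∈ Icc 0 ε, ∀ s' ∈ Icc 0 ε, s' ≤ s →
      dist z z' ≤ C * dist (b.flow z (-s)) (b.flow z' (-s')) ∧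
      |s - s'| ≤ C * dist (b.flow z (-s)) (b.flow z' (-s')) := by
    intro z hz z' hz' h0 h0' s hs s' hs' hss
    -- Both end points are flowed forward by the smaller time `s'`, reaching `flow z (-a)` and the
    -- boundary point `z'`. Their distance is at most `d X`, while their heights differ by at least
    -- `c a`. This bounds the time difference `a`, and then the distance from `z` to `z'`.
    set d := dist (b.flow z (-s)) (b.flow z' (-s'))
    have hd : 0 ≤ d := dist_nonneg
    set a := s - s' with ha
    have ha0 : 0 ≤ a := sub_nonneg.2 hss
    have haε : a ∈ Icc 0 ε := ⟨ha0, by linarith [hs.2, hs'.1]⟩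
    have hI : Icc (-s') 0 ⊆ Icc (-b.ε) b.ε :=
      Icc_subset_Icc (by linarith [hs'.2]) b.ε_pos.le
    have h1 : ∀ t ∈ Icc (-s') 0, HasDerivWithinAt (fun r => b.flow z (r - a))
        (b.field (b.flow z (t - a))) (Icc (-s') 0) t := by
      intro t ht
      have h2 : t - a ∈ Icc (-b.ε) b.ε :=
        ⟨by linarith [ht.1, hs.2], by linarith [ht.2, b.ε_pos]⟩
      have h3 : HasDerivWithinAt (fun r : ℝ => r - a) 1 (Icc (-s') 0) t :=
        (hasDerivWithinAt_id t _).sub_const a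
      have hmaps : MapsTo (fun r : ℝ => r - a) (Icc (-s') 0) (Icc (-b.ε) b.ε) := fun r hr =>
        ⟨by linarith [hr.1, hs.2], by linarith [hr.2, b.ε_pos]⟩
      have h4 := (b.flow_deriv z (t - a) h2).scomp t h3 hmaps
      rwa [one_smul] at h4
    have hs'0 := hs'.1
    have h5 := dist_trajectories_le b.lip h1
      (fun t ht => (b.flow_deriv z' t (hI ht)).mono hI)
      (s := -s') (t := 0) ⟨le_rfl, by linarith⟩ ⟨by linarith, le_rfl⟩
    have h6 : -s' - a = -s := by rw [ha]; ring
    rw [zero_sub, b.flow_zero, h6, zero_sub, neg_neg, abs_of_nonneg hs'0] at h5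
    have h7 : dist (b.flow z (-a)) z' ≤ d * X := by
      refine h5.trans (mul_le_mul_of_nonneg_left (Real.exp_le_exp.2 ?_) hd)
      exact mul_le_mul_of_nonneg_left (hs'.2.trans hεb) b.K.coe_nonneg
    have h8 : c * a ≤ d * X := by
      have h9 := hdesc z hz a haε
      have h10 := hLle (b.flow z (-a) - z')
      rw [map_sub, ← dist_eq_norm] at h10
      have h11 : L z = 0 := h0
      have h12 : L z' = 0 := h0'
      rw [h12, sub_zero] at h10
      linarith [le_abs_self (L (b.flow z (-a)))]
    have h13 : a ≤ X / c * d := by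
      rw [div_mul_eq_mul_div, le_div_iff₀ hc0]; linarith
    have h14 : dist z (b.flow z (-a)) ≤ D * a := by
      have := hD z (by
        have h15 : dist z z₀ < δ := hz.1
        have h16 : ‖z‖ ≤ ‖z₀‖ + dist z z₀ := by
          rw [dist_eq_norm]
          have := norm_add_le z₀ (z - z₀); rwa [add_sub_cancel] at this
        linarith) 0 b.zero_mem (-a) ⟨by linarith [haε.2], by linarith [b.ε_pos]⟩
      rwa [b.flow_zero, zero_sub, neg_neg, abs_of_nonneg ha0] at this
    constructor
    · calc dist z z' ≤ dist z (b.flow z (-a)) + dist (b.flow z (-a)) z' := dist_triangle _ _ _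
        _ ≤ D * (X / c * d) + d * X := add_le_add (h14.trans (by gcongr)) h7
        _ = (D * (X / c) + X) * d := by ring
        _ ≤ C * d := mul_le_mul_of_nonneg_right (le_max_right _ _) hd
    · rw [abs_of_nonneg ha0]
      exact h13.trans (mul_le_mul_of_nonneg_right (le_max_left _ _) hd)
  refine ⟨b, V, ε, C, Metric.isOpen_ball.inter b.isOpen_V, inter_subset_right,
    ⟨Metric.mem_ball_self hδ, hb⟩, hε0, hεb, hC0, fun z hz z' hz' h0 h0' s hs s' hs' => ?_⟩
  rcases le_total s' s with h | h
  · exact key z hz z' hz' h0 h0' s hs s' hs' h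
  · rw [dist_comm z, abs_sub_comm, dist_comm (b.flow z (-s))]
    exact key z' hz' z hz h0' h0 s' hs' s hs h

theorem measurableSet_ae_avoid {B : Set (UnitBundle g)} (hB : MeasurableSet B) {I : Set ℝ}
    (hI : MeasurableSet I) :
    MeasurableSet {p : UnitBundle g | ∀ᵐ s : ℝ, s ∈ I → BackReach g s p → backFlow g s p ∉ B} := by
  have hm : MeasurableSet ({q : ℝ × UnitBundle g | BackReach g q.1 q.2 ∧ backFlow g q.1 q.2 ∈ B} ∩
    {q | q.1 ∈ I}) := (measurableSet_hits hB).inter (measurable_fst hI)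
  have h := measurable_measure_prodMk_right (μ := (volume : Measure ℝ)) hm
  convert h (measurableSet_singleton 0) using 1
  ext p
  simp only [mem_ofPred_eq, mem_preimage, mem_singleton_iff, ae_iff]
  congr! 2
  ext s
  simp
  tauto

/-- The map from boundary vectors and times to vectors has a Lipschitz inverse between spaces of
equal dimension, so the pairs that land in the null set form a null set; Fubini separates vector and
time. -/
theorem ae_ae_backFlow_notMem_short {p₀ : UnitBundle g} (hnt : NonTrapping g)
    (hconv : StrictlyConvexBoundary g) (hp₀ : p₀ ∈ outgoing g) :
    ∃ U ∈ 𝓝 p₀, ∃ ε : ℝ, 0 < ε ∧ ∀ B : Set (UnitBundle g), MeasurableSet B →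
      sphereVolume g B = 0 → sphereBoundaryVolume g {p | p ∈ outgoing g ∧ p ∈ U ∧
        ¬ ∀ᵐ s : ℝ, s ∈ Ioo 0 ε → BackReach g s p → backFlow g s p ∉ B} = 0 := by
  have hx : p₀.1.1 ∈ chartDom n p₀.1.1 := mem_chart_source _ _
  obtain ⟨b, V, ε, C, hVo, hVb, hV, hε, hεb, hC, hdist⟩ := exists_transversal_flowBox hp₀
  set U := {p : UnitBundle g | p.1.1 ∈ chartDom n p₀.1.1 ∧ coord p₀.1.1 p.1 ∈ V}
  have hUo : IsOpen U := isOpen_coord_preimage hVo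
  refine ⟨U, hUo.mem_nhds ⟨hx, hV⟩, ε, hε, fun B hB hB0 => ?_⟩
  have hm : MeasurableSet {p | p ∈ outgoing g ∧ p ∈ U ∧
        ¬ ∀ᵐ s : ℝ, s ∈ Ioo 0 ε → BackReach g s p → backFlow g s p ∉ B} :=
    (measurableSet_outgoing hnt hconv).inter (hUo.measurableSet.inter
      (measurableSet_ae_avoid hB measurableSet_Ioo).compl)
  refine (isConical_sphereBoundaryVolume g).of_chart_open isChartInvariant_bdryL hm hVo
    (fun p hp => hp.2.1) ?_
  set Y := EuclideanSpace ℝ (Fin n)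
  set S : Set ((Y × Coord n) × ℝ) := {q | (bdryL n q.1.1, q.1.2) ∈ V ∧ q.2 ∈ Icc 0 ε}
  set f : (Y × Coord n) × ℝ → Coord n × Coord n := fun q => b.flow (bdryL n q.1.1, q.1.2) (-q.2)
  have hfr : Module.finrank ℝ ((Y × Coord n) × ℝ) = Module.finrank ℝ (Coord n × Coord n) := by
    simp [Y]; ring
  have hAL : ∀ q ∈ S, ∀ q' ∈ S, dist q q' ≤ (max 1 ‖tailL n‖ * C) * dist (f q) (f q') := by
    intro q hq q' hq'
    obtain ⟨h1, h2⟩ := hdist _ hq.1 _ hq'.1 rfl rfl _ hq.2 _ hq'.2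
    set d := dist (f q) (f q')
    have hd : 0 ≤ d := dist_nonneg
    have hCd : C * d ≤ max 1 ‖tailL n‖ * C * d := by
      rw [mul_assoc]; exact le_mul_of_one_le_left (by positivity) (le_max_left _ _)
    rw [Prod.dist_eq] at h1
    change max (dist (bdryL n q.1.1) (bdryL n q'.1.1)) (dist q.1.2 q'.1.2) ≤ C * d at h1
    change |q.2 - q'.2| ≤ C * d at h2
    have h3 : dist (bdryL n q.1.1) (bdryL n q'.1.1) ≤ C * d := (le_max_left _ _).trans h1
    have h4 : dist q.1.2 q'.1.2 ≤ C * d := (le_max_right _ _).trans h1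
    have h5 : dist q.1.1 q'.1.1 ≤ max 1 ‖tailL n‖ * C * d := by
      have h6 := (tailL n).lipschitz.dist_le_mul (bdryL n q.1.1) (bdryL n q'.1.1)
      rw [tailL_bdryL, tailL_bdryL, coe_nnnorm] at h6
      calc _ ≤ _ := h6
        _ ≤ max 1 ‖tailL n‖ * (C * d) :=
          mul_le_mul (le_max_right _ _) h3 dist_nonneg (by positivity)
        _ = _ := by ring
    refine max_le (max_le h5 (h4.trans hCd)) ?_
    rw [Real.dist_eq]
    exact h2.trans hCd
  have hnull := addHaar_eq_zero_of_le_dist (volume : Measure ((Y × Coord n) × ℝ))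
    (volume : Measure (Coord n × Coord n)) hfr (by positivity) hAL
    ((isConical_sphereVolume g B hB).1 hB0 p₀.1.1)
  have hae := Measure.measure_ae_null_of_prod_null hnull
  refine measure_mono_null ?_ hae
  rintro z ⟨hzV, h1, h2, p, ⟨hpo, -, hbad⟩, hpz⟩
  change (bdryL n z.1, z.2) ∈ V at hzV
  intro hz
  refine hbad ?_
  change volume _ = 0 at hz
  refine (measure_eq_zero_iff_ae_notMem.1 hz).mono fun s hs hsI hreach hmem => hs ?_
  have hsε : s ≤ b.ε := hsI.2.le.trans hεb
  have hzH : (bdryL n z.1) ∈ halfSpace n := chartImg_subset _ h1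
  have hsb : -s ∈ Icc (-b.ε) b.ε := ⟨by linarith, by linarith [hsI.1, b.ε_pos]⟩
  have hH := (b.backReach_iff (hVb hzV) hzH hpz hsI.1.le hsε).1 hreach s ⟨hsI.1.le, le_rfl⟩
  obtain ⟨h3, h4, -⟩ := b.mem_dom _ (b.flow_mem _ (hVb hzV) _ hsb) hH
  exact ⟨⟨hzV, hsI.1.le, hsI.2.le⟩, h3, h4, _, hmem, b.backFlow_eq (hVb hzV) hzH hpz hsε hreach⟩

end Transversal



/-! ### Null sets of the sphere bundle against orbits from the outgoing boundary. -/

section BoundaryNull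

variable {n : ℕ} {M : Type*} [TopologicalSpace M] [T2Space M] [CompactSpace M]
  [ChartedSpace (EuclideanHalfSpace (n + 1)) M] [IsManifold (𝓡∂ (n + 1)) ∞ M] {g : Metric n M}

theorem ae_comp_sub {P : ℝ → Prop} (h : ∀ᵐ s : ℝ, P s) (r : ℝ) : ∀ᵐ s : ℝ, P (s - r) :=
  (measurePreserving_sub_right volume r).quasiMeasurePreserving.ae h

/-- Almost every orbit issuing from the outgoing boundary avoids a null set at almost every
time. -/
theorem ae_outgoing_ae_backFlow_notMem (hnt : NonTrapping g) (hconv : StrictlyConvexBoundary g)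
    {B : Set (UnitBundle g)} (hB : MeasurableSet B) (h0 : sphereVolume g B = 0) :
    ∀ᵐ p ∂((sphereBoundaryVolume g).restrict (outgoing g)),
      ∀ᵐ s : ℝ, BackReach g s p → backFlow g s p ∉ B := by
  rw [ae_restrict_iff' (measurableSet_outgoing hnt hconv), ae_iff]
  refine measure_null_of_locally_null _ fun p₀ hp₀ => ?_
  have hp₀' : p₀ ∈ outgoing g := by
    by_contra h; exact hp₀ fun h' => absurd h' h
  obtain ⟨U, hU, ε, hε, hb⟩ := ae_ae_backFlow_notMem_short hnt hconv hp₀'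
  refine ⟨_, inter_mem_nhdsWithin _ hU, ?_⟩
  -- Long times reduce to short ones: `Br r` is null by `null_backFlow`, and hitting `B` at time `s`
  -- means hitting `Br r` at time `s - r`, where the rational `r` is chosen with `0 < s - r < ε`.
  set Br : ℚ → Set (UnitBundle g) := fun r => {p | BackReach g r p ∧ backFlow g r p ∈ B}
  have hr : ∀ r : ℚ, sphereBoundaryVolume g {p | p ∈ outgoing g ∧ p ∈ U ∧
      ¬ ∀ᵐ s : ℝ, s ∈ Ioo 0 ε → BackReach g s p → backFlow g s p ∉ Br r} = 0 := fun r =>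
    hb _ (measurableSet_hits_at hB r) (null_backFlow r hB h0)
  refine measure_mono_null ?_ (measure_iUnion_null hr)
  rintro p ⟨hp, hpU⟩
  by_contra hcon
  refine hp fun hpo => ?_
  have hall : ∀ r : ℚ, ∀ᵐ s : ℝ, s - r ∈ Ioo 0 ε → BackReach g (s - r) p →
      backFlow g (s - r) p ∉ Br r := by
    intro r
    refine ae_comp_sub (P := fun s => s ∈ Ioo 0 ε → BackReach g s p → backFlow g s p ∉ Br r) ?_ r
    by_contra h
    exact hcon (mem_iUnion.2 ⟨r, hpo, hpU, h⟩)
  filter_upwards [ae_all_iff.2 hall, Measure.ae_ne volume (0 : ℝ)] with s hs hs0 hreach hmem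
  have hspos : 0 < s := lt_of_le_of_ne hreach.1 (Ne.symm hs0)
  obtain ⟨r, hr1, hr2⟩ := exists_rat_btwn (max_lt hspos (sub_lt_self s hε))
  have hr0 : (0 : ℝ) ≤ r := (le_max_left _ _).trans hr1.le
  have hsr : 0 ≤ s - r := (sub_pos.2 hr2).le
  have h1 : BackReach g ((s - r) + r) p := by rwa [sub_add_cancel]
  have h2 := h1.sub hsr hr0
  rw [sub_add_cancel] at h2
  exact hs r ⟨sub_pos.2 hr2, by linarith [le_max_right 0 (s - ε)]⟩
    (hreach.mono hsr (by linarith)) ⟨h2.1, by rw [h2.2]; exact hmem⟩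

/-- Flowing forward until the exit ends at an outgoing vector, from which the backward flow returns
to `p` after the same time. -/
theorem exit_spec (hnt : NonTrapping g) (hconv : StrictlyConvexBoundary g) {p : UnitBundle g}
    (hp : 0 < backwardTime g (flip g p)) :
    flip g (backFlow g (backwardTime g (flip g p)) (flip g p)) ∈ outgoing g ∧
    BackReach g (backwardTime g (flip g p))
      (flip g (backFlow g (backwardTime g (flip g p)) (flip g p))) ∧
    backFlow g (backwardTime g (flip g p))
      (flip g (backFlow g (backwardTime g (flip g p)) (flip g p))) = p := by
  set s := backwardTime g (flip g p)
  have h := backReach_backwardTime hnt (flip g p)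
  obtain ⟨h1, h2⟩ := h.flip hp.le le_rfl
  rw [sub_self, backFlow_zero, flip_flip] at h2
  refine ⟨(mem_outgoing_iff_times hnt hconv).2 ⟨hp.trans_le ((backReach_iff_le hnt).1 h1).2, ?_⟩,
    h1, h2⟩
  rw [flip_flip, backwardTime_backFlow hnt hp.le le_rfl, sub_self]

theorem speed_smul_coord (p : UnitBundle g) {x₀ : M} (hp : p.1.1 ∈ chartDom n x₀) {r : ℝ}
    (hr : 0 ≤ r) : speed g x₀ (pos x₀ p.1, r • vel x₀ p.1) = r := by
  rw [speed_smul g x₀ _ _ hr]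
  have h : speed g x₀ (pos x₀ p.1, vel x₀ p.1) = 1 := speed_coord g p hp
  rw [h, mul_one]

theorem normalize_param_smul_coord (p : UnitBundle g) {x₀ : M} (hp : p.1.1 ∈ chartDom n x₀) {r : ℝ}
    (hr : 0 < r) : normalize g (param x₀ (pos x₀ p.1, r • vel x₀ p.1)) = p.1 := by
  rw [normalize_param, speed_smul_coord p hp hr.le]
  simp only [smul_smul, inv_mul_cancel₀ hr.ne', one_smul]
  exact param_coord hp

theorem FlowBox.speed_flow {x₀ : M} (b : FlowBox g x₀) {z : Coord n × Coord n} (hz : z ∈ b.V)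
    {s : ℝ} (hs : 0 ≤ s) (hsε : s ≤ b.ε) (hH : ∀ r ∈ Icc 0 s, (b.flow z (-r)).1 ∈ halfSpace n) :
    speed g x₀ (b.flow z (-s)) = speed g x₀ z := by
  have hsub : Icc (-s) 0 ⊆ Icc (-b.ε) b.ε := Icc_subset_Icc (by linarith) b.ε_pos.le
  have hm := fun r (hr : r ∈ Icc (-s) 0) => b.mem_dom _ (b.flow_mem z hz r (hsub hr)) (by
    have := hH (-r) ⟨by linarith [hr.2], by linarith [hr.1]⟩
    rwa [neg_neg] at this)
  have h := speed_const (fun r hr => (hm r hr).1) (fun r hr => by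
    rw [← (hm r hr).2.2]
    exact (b.flow_deriv z r (hsub hr)).mono hsub) (s := -s) (t := 0)
    ⟨le_rfl, by linarith⟩ ⟨by linarith, le_rfl⟩
  rwa [b.flow_zero] at h

/-- Points of `B` close to their exit are images of pairs of a boundary vector and a time under the
flow of one flow box. These pairs form a null set by Fubini, and the flow map is Lipschitz. -/
theorem exists_null_of_ae_outgoing_short (hnt : NonTrapping g) (hconv : StrictlyConvexBoundary g) :
    ∃ ε₀ : ℝ, 0 < ε₀ ∧ ∀ B : Set (UnitBundle g), MeasurableSet B →
    (∀ᵐ p ∂((sphereBoundaryVolume g).restrict (outgoing g)),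
      ∀ᵐ s : ℝ, BackReach g s p → backFlow g s p ∉ B) →
    sphereVolume g {p | p ∈ B ∧ 0 < backwardTime g (flip g p) ∧
      backwardTime g (flip g p) ≤ ε₀} = 0 := by
  obtain ⟨ε₀, hε₀, b, t, hbt, hcov⟩ := exists_uniform_flowBox g
  refine ⟨ε₀, hε₀, fun B hB hae => ?_⟩
  have hτ : Measurable fun p => backwardTime g (flip g p) :=
    (measurable_backwardTime hnt).comp (measurable_flip g)
  set ex : UnitBundle g → UnitBundle g := fun p =>
    flip g (backFlow g (backwardTime g (flip g p)) (flip g p)) with hex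
  have hexm : Measurable ex :=
    (measurable_flip g).comp ((measurable_backFlow g).comp (hτ.prodMk (measurable_flip g)))
  set A := {p | p ∈ B ∧ 0 < backwardTime g (flip g p) ∧ backwardTime g (flip g p) ≤ ε₀}
  have hA : MeasurableSet A := hB.inter ((measurableSet_lt measurable_const hτ).inter
    (measurableSet_le hτ measurable_const))
  have hA' : A ⊆ ⋃ q : t, A ∩ ex ⁻¹' {p | p.1.1 ∈ chartDom n (q : UnitBundle g).1.1 ∧
      coord (q : UnitBundle g).1.1 p.1 ∈ (b q).V} := by
    intro p hp
    obtain ⟨q, hq, h⟩ := hcov (ex p)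
    exact mem_iUnion.2 ⟨⟨q, hq⟩, hp, h⟩
  refine measure_mono_null hA' (measure_iUnion_null fun q => ?_)
  have hqε : ε₀ ≤ (b q).ε := hbt q q.2
  generalize (b q) = bq at hqε
  generalize (q : UnitBundle g).1.1 = x₀ at bq
  -- the flow from the boundary
  have hflow : ∀ p ∈ A, (ex p).1.1 ∈ chartDom n x₀ → ∀ r : ℝ, 0 < r →
      (pos x₀ (ex p).1, r • vel x₀ (ex p).1) ∈ bq.V →
      bq.flow (pos x₀ (ex p).1, r • vel x₀ (ex p).1) (-(backwardTime g (flip g p))) =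
        (pos x₀ p.1, r • vel x₀ p.1) ∧ p.1.1 ∈ chartDom n x₀ := by
    intro p hpA hpx r hr hV
    obtain ⟨-, hreach, hback⟩ := exit_spec hnt hconv hpA.2.1
    change BackReach g _ (ex p) at hreach
    change backFlow g _ (ex p) = p at hback
    have hsε := hpA.2.2.trans hqε
    have hs0 := hpA.2.1.le
    set s := backwardTime g (flip g p)
    set z₁ : Coord n × Coord n := (pos x₀ (ex p).1, r • vel x₀ (ex p).1)
    have hz₁ : (ex p).1 = normalize g (param x₀ z₁) := (normalize_param_smul_coord _ hpx hr).symm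
    have hzH : z₁.1 ∈ halfSpace n := chartImg_subset _ (pos_mem hpx)
    have hH := (bq.backReach_iff hV hzH hz₁ hs0 hsε).1 hreach
    have hb := bq.backFlow_eq hV hzH hz₁ hsε hreach
    rw [hback] at hb
    have hm := bq.mem_dom _ (bq.flow_mem _ hV (-s) ⟨by linarith, by linarith [bq.ε_pos]⟩)
      (hH s ⟨hs0, le_rfl⟩)
    obtain ⟨hx, hc⟩ := coord_eq_of_normalize hm.1 hb
    rw [bq.speed_flow hV hs0 hsε hH, speed_smul_coord _ hpx hr.le] at hc
    refine ⟨Prod.ext (congrArg Prod.fst hc).symm ?_, hx⟩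
    have h3 : vel x₀ p.1 = r⁻¹ • (bq.flow z₁ (-s)).2 := congrArg Prod.snd hc
    rw [h3, smul_smul, mul_inv_cancel₀ hr.ne', one_smul]
  refine (isConical_sphereVolume g).of_chart (x₀ := x₀) isChartInvariant_id
    (hA.inter (hexm (isOpen_coord_preimage bq.isOpen_V).measurableSet)) (fun p hp => ?_) ?_
  · exact (hflow p hp.1 hp.2.1 1 one_pos (by rw [one_smul]; exact hp.2.2)).2
  set Y := EuclideanSpace ℝ (Fin n)
  rcases isEmpty_or_nonempty (UnitBundle g) with he | ⟨⟨p₀⟩⟩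
  · convert measure_empty (μ := (volume : Measure (Coord n × Coord n)))
    refine eq_empty_of_forall_notMem fun z hz => ?_
    obtain ⟨p, -⟩ := hz.2.2
    exact he.elim p
  obtain ⟨e, hem, he⟩ := exists_measurable_normalize_param p₀ x₀
  set J : Y × Coord n → Coord n × Coord n := fun z => (bdryL n z.1, z.2)
  have hJ : Measurable J := by
    have : Continuous J := by fun_prop
    exact this.measurable
  set D : Set (Coord n × Coord n) := chartImg n x₀ ×ˢ {0}ᶜ
  have hD : MeasurableSet D := (measurableSet_chartImg x₀).prod (measurableSet_singleton 0).compl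
  set G : Set (ℝ × UnitBundle g) := {q | BackReach g q.1 q.2 ∧ backFlow g q.1 q.2 ∈ B} ∩
    {q | q.2 ∈ outgoing g}
  have hG : MeasurableSet G :=
    (measurableSet_hits hB).inter (measurable_snd (measurableSet_outgoing hnt hconv))
  set E : Set ((Y × Coord n) × ℝ) := {q | J q.1 ∈ D ∧ (q.2, e (J q.1)) ∈ G}
  have hE : MeasurableSet E := ((hJ.comp measurable_fst) hD).inter
    ((measurable_snd.prodMk (hem.comp (hJ.comp measurable_fst))) hG)
  have hEnull : volume E = 0 := by
    rw [Measure.volume_eq_prod, Measure.measure_prod_null hE]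
    set Z : Set (UnitBundle g) := {p | p ∈ outgoing g ∧
      ¬ ∀ᵐ s : ℝ, s ∈ univ → BackReach g s p → backFlow g s p ∉ B}
    have hZm : MeasurableSet Z := (measurableSet_outgoing hnt hconv).inter
      (measurableSet_ae_avoid hB MeasurableSet.univ).compl
    have hZ : sphereBoundaryVolume g Z = 0 := by
      rw [ae_restrict_iff' (measurableSet_outgoing hnt hconv), ae_iff] at hae
      refine measure_mono_null ?_ hae
      rintro p ⟨hpo, hp⟩ h
      exact hp ((h hpo).mono fun s hs _ => hs)
    have h1 := (isConical_sphereBoundaryVolume g Z hZm).1 hZ x₀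
    refine (measure_eq_zero_iff_ae_notMem.1 h1).mono fun z hz => ?_
    change volume _ = 0
    by_cases hzD : J z ∈ D ∧ e (J z) ∈ outgoing g
    · by_contra hne
      refine hz ⟨hzD.1.1, hzD.1.2, e (J z), ⟨hzD.2, fun h => hne ?_⟩, he _ hzD.1⟩
      refine measure_eq_zero_iff_ae_notMem.2 (h.mono fun s hs hsE => ?_)
      exact hs (mem_univ _) hsE.2.1.1 hsE.2.1.2
    · convert measure_empty (μ := (volume : Measure ℝ))
      refine eq_empty_of_forall_notMem fun s hs => hzD ⟨hs.1, hs.2.2⟩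
  set F : (Y × Coord n) × ℝ → Coord n × Coord n := fun q => bq.flow (J q.1) (-q.2)
  have hfr : Module.finrank ℝ ((Y × Coord n) × ℝ) = Module.finrank ℝ (Coord n × Coord n) := by
    simp [Y]; ring
  -- The Lipschitz constant in time depends on the size of the initial value, hence the exhaustion
  -- by balls of radius `R`.
  have hFnull : ∀ R : ℕ, volume (F '' (E ∩ {q | ‖J q.1‖ ≤ R ∧ q.2 ∈ Icc 0 bq.ε})) = 0 := by
    intro R
    obtain ⟨C, hC, hlip⟩ := bq.exists_lipschitz_time R
    set X := Real.exp (bq.K * bq.ε)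
    have hX : 0 < X := Real.exp_pos _
    have hL : LipschitzOnWith (⟨max ‖bdryL n‖ 1 * X + C, by positivity⟩ : NNReal) F
        (E ∩ {q | ‖J q.1‖ ≤ R ∧ q.2 ∈ Icc 0 bq.ε}) := by
      refine LipschitzOnWith.of_dist_le_mul ?_
      rintro q ⟨-, hq1, hq2⟩ q' ⟨-, hq1', hq2'⟩
      have hI : ∀ s ∈ Icc 0 bq.ε, -s ∈ Icc (-bq.ε) bq.ε := fun s hs =>
        ⟨by linarith [hs.2], by linarith [hs.1, bq.ε_pos]⟩
      have h1 := bq.dist_flow_le (J q.1) (J q'.1) (hI _ hq2)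
      have h2 := hlip (J q'.1) hq1' _ (hI _ hq2) _ (hI _ hq2')
      have h3 : dist (J q.1) (J q'.1) ≤ max ‖bdryL n‖ 1 * dist q.1 q'.1 := by
        refine max_le ?_ ?_
        · have h4 := (bdryL n).lipschitz.dist_le_mul q.1.1 q'.1.1
          rw [coe_nnnorm] at h4
          exact h4.trans (mul_le_mul (le_max_left _ _) (le_max_left _ _) dist_nonneg
            (by positivity))
        · have h4 : dist q.1.2 q'.1.2 ≤ dist q.1 q'.1 := le_max_right _ _
          exact h4.trans (le_mul_of_one_le_left dist_nonneg (le_max_right _ _))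
      have h5 : dist q.1 q'.1 ≤ dist q q' := le_max_left _ _
      have h6 : |(-q.2) - (-q'.2)| ≤ dist q q' := by
        rw [neg_sub_neg, abs_sub_comm, ← Real.dist_eq]; exact le_max_right _ _
      calc dist (F q) (F q') ≤ dist (bq.flow (J q.1) (-q.2)) (bq.flow (J q'.1) (-q.2)) +
            dist (bq.flow (J q'.1) (-q.2)) (bq.flow (J q'.1) (-q'.2)) := dist_triangle _ _ _
        _ ≤ max ‖bdryL n‖ 1 * dist q q' * X + C * dist q q' := by
          refine add_le_add (h1.trans ?_) (h2.trans (by gcongr))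
          gcongr
          exact h3.trans (by gcongr)
        _ = (max ‖bdryL n‖ 1 * X + C) * dist q q' := by ring
    exact addHaar_image_eq_zero_of_lipschitzOn volume volume hfr hL
      (measure_mono_null inter_subset_left hEnull)
  -- Rational dilations again: the exit vector has to be rescaled into `bq.V`, and the dilation of
  -- the whole cone is undone afterwards.
  refine measure_mono_null ?_ (measure_iUnion_null fun r : {r : ℚ // 0 < r} =>
    volume_rescale_eq_zero (measure_iUnion_null hFnull) (r := ((r : ℚ) : ℝ))
      (by exact_mod_cast r.2.ne'))
  rintro z ⟨h1, h2, p, ⟨hpA, hpx, hpV⟩, hpz⟩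
  change p.1 = normalize g (param x₀ z) at hpz
  change z.1 ∈ chartImg n x₀ at h1
  have hs := speed_pos g h1 h2
  obtain ⟨hx, hcoord⟩ := coord_eq_of_normalize (z := z) h1 hpz
  set s := backwardTime g (flip g p)
  obtain ⟨hout, hreach, hback⟩ := exit_spec hnt hconv hpA.2.1
  change ex p ∈ outgoing g at hout
  change BackReach g s (ex p) at hreach
  change backFlow g s (ex p) = p at hback
  have hcont : Continuous fun r : ℝ => (pos x₀ (ex p).1, (r * speed g x₀ z) • vel x₀ (ex p).1) := by
    fun_prop
  have hO : IsOpen ((fun r : ℝ => (pos x₀ (ex p).1, (r * speed g x₀ z) • vel x₀ (ex p).1)) ⁻¹' bq.V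
      ∩ Ioi 0) := (bq.isOpen_V.preimage hcont).inter isOpen_Ioi
  obtain ⟨r, hr⟩ := Rat.denseRange_cast.exists_mem_open hO
    ⟨(speed g x₀ z)⁻¹, by
      change (_, _) ∈ bq.V
      rw [inv_mul_cancel₀ hs.ne', one_smul]; exact hpV, inv_pos.2 hs⟩
  have hr0 : (0 : ℝ) < r := hr.2
  have hrs : 0 < r * speed g x₀ z := mul_pos hr0 hs
  have hb0 : pos x₀ (ex p).1 0 = 0 := (mem_boundary_iff hpx).1 hout.1
  obtain ⟨hfl, -⟩ := hflow p hpA hpx _ hrs hr.1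
  set z₁ : Coord n × Coord n := (pos x₀ (ex p).1, (r * speed g x₀ z) • vel x₀ (ex p).1)
  obtain ⟨R, hR⟩ := exists_nat_ge ‖z₁‖
  have hJz : J (tailL n (pos x₀ (ex p).1), z₁.2) = z₁ := Prod.ext (bdryL_tailL hb0) rfl
  refine mem_iUnion.2 ⟨⟨r, by exact_mod_cast hr0⟩, mem_iUnion.2 ⟨R,
    ((tailL n (pos x₀ (ex p).1), z₁.2), s), ⟨⟨?_, ?_⟩, ?_, ?_⟩, ?_⟩⟩
  · rw [hJz]
    exact ⟨pos_mem hpx, smul_ne_zero hrs.ne' (vel_ne_zero g _ hpx)⟩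
  · have hz₁ : z₁ ∈ cone g x₀ (outgoing g) :=
      smul_mem_cone (z := coord x₀ (ex p).1) (coord_mem_cone hout hpx) hrs
    have hez : e z₁ = ex p := by
      exact Subtype.ext ((he z₁ ⟨hz₁.1, hz₁.2.1⟩).trans (normalize_param_smul_coord _ hpx hrs))
    simp only [hJz, hez]
    exact ⟨⟨hreach, by simp only [hback]; exact hpA.1⟩, hout⟩
  · simp only [hJz]; exact hR
  · exact ⟨hpA.2.1.le, hpA.2.2.trans hqε⟩
  · change bq.flow (J _) (-s) = (z.1, (r : ℝ) • z.2)
    rw [hJz, hfl]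
    refine Prod.ext (show pos x₀ p.1 = z.1 from congrArg Prod.fst hcoord) ?_
    have h3 : vel x₀ p.1 = (speed g x₀ z)⁻¹ • z.2 := congrArg Prod.snd hcoord
    simp only [h3, smul_smul]
    rw [mul_assoc, mul_inv_cancel₀ hs.ne', mul_one]

/-- A set avoided by almost all orbits issuing from the outgoing boundary is null. -/
theorem null_of_ae_outgoing (hnt : NonTrapping g) (hconv : StrictlyConvexBoundary g)
    {B : Set (UnitBundle g)} (hB : MeasurableSet B)
    (hae : ∀ᵐ p ∂((sphereBoundaryVolume g).restrict (outgoing g)),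
      ∀ᵐ s : ℝ, BackReach g s p → backFlow g s p ∉ B) : sphereVolume g B = 0 := by
  obtain ⟨ε₀, hε₀, h⟩ := exists_null_of_ae_outgoing_short hnt hconv
  have hτ : Measurable fun p => backwardTime g (flip g p) :=
    (measurable_backwardTime hnt).comp (measurable_flip g)
  set B' : ℕ → Set (UnitBundle g) := fun k =>
    {p | BackReach g (k * ε₀) p ∧ backFlow g (k * ε₀) p ∈ B}
  have hB' : ∀ k, MeasurableSet (B' k) := fun k => measurableSet_hits_at hB _
  set A : ℕ → Set (UnitBundle g) := fun k => {p | p ∈ B' k ∧ 0 < backwardTime g (flip g p) ∧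
      backwardTime g (flip g p) ≤ ε₀}
  have hAm : ∀ k, MeasurableSet (A k) := fun k => (hB' k).inter
    ((measurableSet_lt measurable_const hτ).inter (measurableSet_le hτ measurable_const))
  have hA : ∀ k, sphereVolume g (A k) = 0 := by
    intro k
    refine h _ (hB' k) (hae.mono fun p hp => ?_)
    have h1 := ae_comp_sub hp (-(k * ε₀))
    simp only [sub_neg_eq_add] at h1
    refine h1.mono fun s hs hreach hmem => ?_
    obtain ⟨h2, h3⟩ := hreach.add hmem.1
    exact hs h2 (h3 ▸ hmem.2)
  refine measure_mono_null ?_ (measure_union_null (sphereVolume_boundary hnt hconv)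
    (measure_iUnion_null fun k : ℕ => null_forwardFlow (k * ε₀) (hAm k) (hA k)))
  intro p hpB
  by_cases hb : p.1.1 ∈ (𝓡∂ (n + 1)).boundary M
  · exact Or.inl hb
  refine Or.inr (mem_iUnion.2 ?_)
  have hpos := ((mem_interior_iff_times hnt hconv).1 hb).2
  set s := backwardTime g (flip g p) with hs
  -- After flowing forward by `k ε₀` the remaining exit time lies in `(0, ε₀]`, so the point arrives
  -- in the null set `A k`. The left inequality must be strict, since `A k` excludes exit time zero.
  obtain ⟨k, hk⟩ : ∃ k : ℕ, k * ε₀ < s ∧ s ≤ (k + 1) * ε₀ := by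
    obtain ⟨k, hk⟩ : ∃ k : ℕ, ⌈s / ε₀⌉₊ = k + 1 :=
      Nat.exists_eq_succ_of_ne_zero (Nat.ceil_pos.2 (div_pos hpos hε₀)).ne'
    refine ⟨k, ?_, ?_⟩
    · have : (k : ℕ) < ⌈s / ε₀⌉₊ := by omega
      exact (lt_div_iff₀ hε₀).1 (Nat.lt_ceil.1 this)
    · have h1 := Nat.le_ceil (s / ε₀)
      rw [hk] at h1
      push_cast at h1
      exact (div_le_iff₀ hε₀).1 h1
  have hk0 : 0 ≤ k * ε₀ := by positivity
  have hreach : BackReach g (k * ε₀) (flip g p) := (backReach_iff_le hnt).2 ⟨hk0, hk.1.le⟩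
  obtain ⟨h1, h2⟩ := hreach.flip hk0 le_rfl
  rw [sub_self, backFlow_zero, flip_flip] at h2
  refine ⟨k, hreach, ⟨h1, ?_⟩, ?_, ?_⟩
  · rw [h2]; exact hpB
  · rw [flip_flip, backwardTime_backFlow hnt hk0 hk.1.le]
    linarith [hk.1]
  · rw [flip_flip, backwardTime_backFlow hnt hk0 hk.1.le]
    linarith [hk.2]

end BoundaryNull



/-! ### Measurable coefficients on the line. -/

section LineAnalysis

open Filter intervalIntegral

theorem intervalIntegrable_of_abs_le {φ : ℝ → ℝ} {P : ℝ} (hφ : Measurable φ)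
    (hP : ∀ s, |φ s| ≤ P) (a b : ℝ) : IntervalIntegrable φ volume a b :=
  (intervalIntegrable_const (c := P)).mono_fun hφ.aestronglyMeasurable
    (Eventually.of_forall fun s => by
      exact (hP s).trans (le_abs_self P))

theorem abs_integral_le_of_abs_le {φ : ℝ → ℝ} {P a b : ℝ} (hP : ∀ s, |φ s| ≤ P) :
    |∫ s in a..b, φ s| ≤ P * |b - a| :=
  intervalIntegral.norm_integral_le_of_norm_le_const (f := φ) fun s _ => hP s

/-- The primitive is continuous, so it vanishes at every point; its derivative is `ψ` almost
everywhere by Lebesgue differentiation. -/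
theorem ae_eq_zero_of_ae_integral_eq_zero {ψ : ℝ → ℝ} {P τ : ℝ} (hψ : Measurable ψ)
    (hP : ∀ s, |ψ s| ≤ P) (h : ∀ᵐ t : ℝ, t ∈ Ioo 0 τ → ∫ s in (0 : ℝ)..t, ψ s = 0) :
    (∀ t ∈ Ioo 0 τ, ∫ s in (0 : ℝ)..t, ψ s = 0) ∧ ∀ᵐ t : ℝ, t ∈ Ioo 0 τ → ψ t = 0 := by
  have hcont : Continuous fun t => ∫ s in (0 : ℝ)..t, ψ s :=
    continuous_primitive (fun a b => intervalIntegrable_of_abs_le hψ hP a b) 0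
  have h1 : EqOn (fun t => ∫ s in (0 : ℝ)..t, ψ s) (fun _ => 0) (Ioo 0 τ) :=
    Measure.eqOn_open_of_ae_eq ((ae_restrict_iff' measurableSet_Ioo).2 h) isOpen_Ioo
      hcont.continuousOn continuousOn_const
  refine ⟨h1, ?_⟩
  filter_upwards [(intervalIntegrable_of_abs_le hψ hP 0 τ).ae_hasDerivAt_integral] with t ht htI
  have hτ : (0 : ℝ) ≤ τ := htI.1.le.trans htI.2.le
  have h2 := ht (by rw [uIcc_of_le hτ]; exact Ioo_subset_Icc_self htI) 0
    (by rw [uIcc_of_le hτ]; exact left_mem_Icc.2 hτ)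
  have h3 : (fun t => ∫ s in (0 : ℝ)..t, ψ s) =ᶠ[𝓝 t] fun _ => 0 := by
    filter_upwards [isOpen_Ioo.mem_nhds htI] with s hs using h1 hs
  exact h2.unique ((hasDerivAt_const t (0 : ℝ)).congr_of_eventuallyEq h3)

/-- Variation of constants for linear equations with bounded measurable coefficients. -/
theorem variation_of_constants {α φ F : ℝ → ℝ} {S P R u t ε : ℝ} (hα : Measurable α)
    (hS : ∀ s, |α s| ≤ S) (hφ : Measurable φ) (hP : ∀ s, |φ s| ≤ P) (hF : Measurable F)
    (hR : ∀ s, |F s| ≤ R) (hut : u < t)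
    (h : ∀ s ∈ Ico u t, F s = ε - ∫ r in s..t, (α r * F r + φ r)) :
    F u = ε * Real.exp (-∫ s in u..t, α s) -
      ∫ r in u..t, Real.exp (-∫ s in u..r, α s) * φ r := by
  have hS0 : 0 ≤ S := (abs_nonneg _).trans (hS 0)
  have hiα := intervalIntegrable_of_abs_le hα hS
  set ψ : ℝ → ℝ := fun r => α r * F r + φ r with hψ
  have hψm : Measurable ψ := (hα.mul hF).add hφ
  have hψb : ∀ s, |ψ s| ≤ S * R + P := fun s => (abs_add_le _ _).trans
    (add_le_add (by rw [abs_mul]; exact mul_le_mul (hS s) (hR s) (abs_nonneg _) hS0) (hP s))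
  have hiψ := intervalIntegrable_of_abs_le hψm hψb
  set E : ℝ → ℝ := fun r => Real.exp (-∫ s in u..r, α s) with hE
  have hAc : Continuous fun r => ∫ s in u..r, α s := continuous_primitive hiα u
  have hEc : Continuous E := Real.continuous_exp.comp hAc.neg
  have hEφ : IntervalIntegrable (fun r => E r * φ r) volume u t :=
    (intervalIntegrable_of_abs_le hφ hP u t).continuousOn_mul hEc.continuousOn
  -- An absolutely continuous version of `F`. The equation is not assumed at `s = t`, where a
  -- solution may have a default value; there `G` takes the value `ε`.
  set G : ℝ → ℝ := fun s => F u + ∫ r in u..s, ψ r with hG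
  have hGF : ∀ s ∈ Ico u t, G s = F s := by
    intro s hs
    rw [hG, h s hs, h u ⟨le_rfl, hut⟩]
    simp only
    rw [← integral_add_adjacent_intervals (hiψ u s) (hiψ s t)]
    ring
  have hGt : G t = ε := by
    simp only [hG]; rw [h u ⟨le_rfl, hut⟩]; ring
  have hconst : ∀ c : ℝ, AbsolutelyContinuousOnInterval (fun _ : ℝ => c) u t := fun c =>
    (contDiff_const.contDiffOn).absolutelyContinuousOnInterval
  have hGac : AbsolutelyContinuousOnInterval G u t :=
    (hconst (F u)).add ((hiψ u t).absolutelyContinuousOnInterval_intervalIntegral left_mem_uIcc)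
  have hEac : AbsolutelyContinuousOnInterval E u t := by
    obtain ⟨C, hC⟩ := (isCompact_uIcc (a := u) (b := t)).exists_bound_of_continuousOn
      (f := fun r => -∫ s in u..r, α s) hAc.neg.continuousOn
    obtain ⟨K, hK⟩ := (Real.contDiff_exp (n := 1)).contDiffOn.exists_lipschitzOnWith (by decide)
      (convex_Icc (-C) C) isCompact_Icc
    have hL : LipschitzOnWith ⟨S, hS0⟩ (fun r => -∫ s in u..r, α s) (uIcc u t) := by
      refine LipschitzOnWith.of_dist_le_mul fun x _ y _ => ?_
      rw [dist_neg_neg, Real.dist_eq, integral_interval_sub_left (hiα u x) (hiα u y), Real.dist_eq]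
      exact abs_integral_le_of_abs_le hS
    exact (hK.comp hL fun r hr => abs_le.1 (hC r hr)).absolutelyContinuousOnInterval
  -- With the integrating factor `E` this quantity has derivative zero almost everywhere, and by
  -- absolute continuity it is constant. Comparing its values at `u` and `t` gives the formula.
  have hWac : AbsolutelyContinuousOnInterval (fun s => E s * G s - ∫ r in u..s, E r * φ r) u t :=
    (hEac.fun_mul hGac).sub
      (hEφ.absolutelyContinuousOnInterval_intervalIntegral left_mem_uIcc)
  obtain ⟨C, hC⟩ := hWac.const_of_ae_hasDerivAt_zero (by
    filter_upwards [(hiα u t).ae_hasDerivAt_integral, (hiψ u t).ae_hasDerivAt_integral,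
      hEφ.ae_hasDerivAt_integral, Measure.ae_ne volume t] with s h1 h2 h3 hst hs
    have h4 := h1 hs u left_mem_uIcc
    have h5 := (h2 hs u left_mem_uIcc).const_add (F u)
    have h6 := h3 hs u left_mem_uIcc
    have h7 := (h4.neg.exp.mul h5).sub h6
    refine h7.congr_deriv ?_
    rw [uIcc_of_le hut.le] at hs
    have h8 : G s = F s := hGF s ⟨hs.1, lt_of_le_of_ne hs.2 hst⟩
    change E s * -α s * G s + E s * ψ s - E s * φ s = 0
    rw [h8]
    simp only [hψ]
    ring)
  have h1 := hC u left_mem_uIcc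
  have h2 := hC t right_mem_uIcc
  simp only [hGt, integral_same, sub_zero] at h1 h2
  have h3 : E u = 1 := by simp [hE]
  have h4 : G u = F u := hGF u ⟨le_rfl, hut⟩
  rw [h3, h4, one_mul] at h1
  rw [h1, ← h2]
  simp only [hE]
  ring

/-- One use of l'Hôpital's rule, after which the definition of the second derivative at `0`
suffices; no second derivative elsewhere is needed. -/
theorem tendsto_div_sq_of_hasDerivAt_deriv {N : ℝ → ℝ} {b : ℝ} (hN : Differentiable ℝ N)
    (h0 : N 0 = 0) (h1 : deriv N 0 = 0) (h2 : HasDerivAt (deriv N) b 0) :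
    Tendsto (fun z => N z / z ^ 2) (𝓝[≠] 0) (𝓝 (b / 2)) := by
  refine HasDerivAt.lhopital_zero_nhdsNE (f' := deriv N) (g' := fun z => 2 * z)
    (Eventually.of_forall fun z => (hN z).hasDerivAt)
    (Eventually.of_forall fun z => by simpa using hasDerivAt_pow 2 z) ?_ ?_ ?_ ?_
  · filter_upwards [self_mem_nhdsWithin] with z hz using mul_ne_zero two_ne_zero hz
  · have := (hN.continuous.tendsto 0); rw [h0] at this; exact this.mono_left nhdsWithin_le_nhds
  · have : Tendsto (fun z : ℝ => z ^ 2) (𝓝 0) (𝓝 (0 ^ 2)) := (continuous_pow 2).tendsto 0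
    rw [zero_pow two_ne_zero] at this
    exact this.mono_left nhdsWithin_le_nhds
  · have h3 := (hasDerivAt_iff_tendsto_slope.1 h2).div_const 2
    refine h3.congr' ?_
    filter_upwards [self_mem_nhdsWithin] with z hz
    rw [slope_def_field, h1, sub_zero, sub_zero, div_div, mul_comm z 2]

end LineAnalysis



/-! ### Small-data expansion and recovery of the coefficients along one orbit. -/

section OrbitExpansion

open Filter intervalIntegral

theorem exp_neg_integral_le {α : ℝ → ℝ} {S u r t : ℝ} (hS : ∀ s, |α s| ≤ S) (hu : 0 ≤ u)
    (hur : u ≤ r) (hrt : r ≤ t) : Real.exp (-∫ s in u..r, α s) ≤ Real.exp (S * t) := by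
  have hS0 : 0 ≤ S := (abs_nonneg _).trans (hS 0)
  refine Real.exp_le_exp.2 ((neg_le_abs _).trans ((abs_integral_le_of_abs_le hS).trans ?_))
  rw [abs_of_nonneg (by linarith)]
  exact mul_le_mul_of_nonneg_left (by linarith) hS0

variable {N α β : ℝ → ℝ} {b C K S Q t : ℝ} {ε : ℕ → ℝ} {F : ℕ → ℝ → ℝ}

/-- First and second order expansion, for small data, of solutions of a semilinear equation. -/
theorem expansion_of_semilinear (hN : Measurable N) (hNC : ∀ z, |z| ≤ 1 → |N z| ≤ C * z ^ 2)
    (hNb : Tendsto (fun z => N z / z ^ 2) (𝓝[≠] 0) (𝓝 (b / 2)))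
    (hα : Measurable α) (hS : ∀ s, |α s| ≤ S) (hβ : Measurable β) (hQ : ∀ s, |β s| ≤ Q)
    (hε : ∀ k, 0 < ε k) (hε0 : Tendsto ε atTop (𝓝 0)) (hKε : ∀ k, K * ε k ≤ 1)
    (hF : ∀ k, Measurable (F k)) (hFK : ∀ k s, |F k s| ≤ K * ε k) (ht : 0 < t)
    (h : ∀ k, ∀ s ∈ Ico 0 t, F k s = ε k - ∫ r in s..t, (α r * F k r + β r * N (F k r))) :
    Tendsto (fun k => F k 0 / ε k) atTop (𝓝 (Real.exp (-∫ s in (0 : ℝ)..t, α s))) ∧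
    Tendsto (fun k => (ε k * Real.exp (-∫ s in (0 : ℝ)..t, α s) - F k 0) / ε k ^ 2) atTop
      (𝓝 (∫ r in (0 : ℝ)..t, Real.exp (-∫ s in (0 : ℝ)..r, α s) *
        (β r * (b / 2 * Real.exp (-∫ s in r..t, α s) ^ 2)))) := by
  have hQ0 : 0 ≤ Q := (abs_nonneg _).trans (hQ 0)
  have hC0 : 0 ≤ C := by simpa using (abs_nonneg _).trans (hNC 1 (by simp))
  have hNF : ∀ k s, |N (F k s)| ≤ C * K ^ 2 * ε k ^ 2 := by
    intro k s
    refine (hNC _ ((hFK k s).trans (hKε k))).trans ?_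
    rw [mul_assoc, ← mul_pow, ← sq_abs]
    exact mul_le_mul_of_nonneg_left (pow_le_pow_left₀ (abs_nonneg _) (hFK k s) 2) hC0
  have hφb : ∀ k s, |β s * N (F k s)| ≤ Q * (C * K ^ 2 * ε k ^ 2) := by
    intro k s
    rw [abs_mul]
    exact mul_le_mul (hQ s) (hNF k s) (abs_nonneg _) hQ0
  have hφm : ∀ k, Measurable fun s => β s * N (F k s) := fun k => hβ.mul (hN.comp (hF k))
  have hvoc : ∀ k, ∀ u ∈ Ico 0 t, F k u = ε k * Real.exp (-∫ s in u..t, α s) -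
      ∫ r in u..t, Real.exp (-∫ s in u..r, α s) * (β r * N (F k r)) := fun k u hu =>
    variation_of_constants hα hS (hφm k) (hφb k) (hF k) (hFK k) hu.2
      fun s hs => h k s ⟨hu.1.trans hs.1, hs.2⟩
  have hintb : ∀ k, ∀ u ∈ Ico 0 t, ∀ r ∈ Ioc u t,
      |Real.exp (-∫ s in u..r, α s) * (β r * N (F k r))| ≤
        Real.exp (S * t) * (Q * (C * K ^ 2 * ε k ^ 2)) := by
    intro k u hu r hr
    rw [abs_mul, abs_of_pos (Real.exp_pos _)]
    exact mul_le_mul (exp_neg_integral_le hS hu.1 hr.1.le hr.2) (hφb k r) (abs_nonneg _)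
      (Real.exp_pos _).le
  -- First order: the nonlinear term is `O(ε²)`, so only the linear attenuation survives division by
  -- `ε`.
  have hlim : ∀ u ∈ Ico 0 t,
      Tendsto (fun k => F k u / ε k) atTop (𝓝 (Real.exp (-∫ s in u..t, α s))) := by
    intro u hu
    rw [tendsto_iff_norm_sub_tendsto_zero]
    have hz : Tendsto (fun k => Real.exp (S * t) * (Q * (C * K ^ 2)) * (t - u) * ε k) atTop
        (𝓝 0) := by
      simpa using hε0.const_mul (Real.exp (S * t) * (Q * (C * K ^ 2)) * (t - u))
    refine squeeze_zero (fun _ => norm_nonneg _) (fun k => ?_) hz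
    have h1 := intervalIntegral.norm_integral_le_of_norm_le_const (a := u) (b := t)
      (f := fun r => Real.exp (-∫ s in u..r, α s) * (β r * N (F k r)))
      (C := Real.exp (S * t) * (Q * (C * K ^ 2 * ε k ^ 2)))
      (fun r hr => hintb k u hu r (by rwa [uIoc_of_le hu.2.le] at hr))
    rw [abs_of_nonneg (sub_nonneg.2 hu.2.le)] at h1
    have h2 : F k u / ε k - Real.exp (-∫ s in u..t, α s) =
        -(∫ r in u..t, Real.exp (-∫ s in u..r, α s) * (β r * N (F k r))) / ε k := by
      rw [hvoc k u hu]
      field_simp [(hε k).ne']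
      ring
    rw [h2, norm_div, norm_neg, Real.norm_eq_abs (ε k), abs_of_pos (hε k), div_le_iff₀ (hε k)]
    refine h1.trans_eq ?_
    ring
  refine ⟨hlim 0 ⟨le_rfl, ht⟩, ?_⟩
  have hrew : ∀ k, (ε k * Real.exp (-∫ s in (0 : ℝ)..t, α s) - F k 0) / ε k ^ 2 =
      ∫ r in (0 : ℝ)..t, Real.exp (-∫ s in (0 : ℝ)..r, α s) * (β r * N (F k r)) / ε k ^ 2 := by
    intro k
    rw [intervalIntegral.integral_div, hvoc k 0 ⟨le_rfl, ht⟩]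
    congr 1
    ring
  simp only [hrew]
  have hEm : Measurable fun r => Real.exp (-∫ s in (0 : ℝ)..r, α s) :=
    (Real.continuous_exp.comp
      (continuous_primitive (intervalIntegrable_of_abs_le hα hS) 0).neg).measurable
  refine intervalIntegral.tendsto_integral_filter_of_dominated_convergence
    (fun _ => Real.exp (S * t) * (Q * (C * K ^ 2)))
    (Eventually.of_forall fun k =>
      ((hEm.mul (hφm k)).div_const _).aestronglyMeasurable)
    (Eventually.of_forall fun k => Eventually.of_forall fun r hr => ?_)
    intervalIntegrable_const ?_
  · rw [uIoc_of_le ht.le] at hr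
    rw [Real.norm_eq_abs, abs_div, abs_of_pos (pow_pos (hε k) 2), div_le_iff₀ (pow_pos (hε k) 2)]
    exact (hintb k 0 ⟨le_rfl, ht⟩ r hr).trans_eq (by ring)
  -- Second order: `N(F) / ε² = (N(F) / F²) (F / ε)²`. This is legitimate because `F / ε` has a
  -- positive limit, so `F` is eventually nonzero.
  · filter_upwards [Measure.ae_ne volume t] with r hrt hr
    rw [uIoc_of_le ht.le] at hr
    have hr' : r ∈ Ico 0 t := ⟨hr.1.le, lt_of_le_of_ne hr.2 hrt⟩
    have h1 := hlim r hr'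
    have h2 : Tendsto (fun k => F k r) atTop (𝓝[≠] 0) := by
      refine tendsto_nhdsWithin_iff.2 ⟨?_, ?_⟩
      · have h3 := h1.mul hε0
        rw [mul_zero] at h3
        exact h3.congr fun k => div_mul_cancel₀ _ (hε k).ne'
      · filter_upwards [h1.eventually_const_lt (Real.exp_pos _)] with k hk h0
        rw [mem_singleton_iff] at h0
        rw [h0, zero_div] at hk
        exact lt_irrefl _ hk
    have h3 := ((hNb.comp h2).mul (h1.pow 2)).const_mul (β r)
      |>.const_mul (Real.exp (-∫ s in (0 : ℝ)..r, α s))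
    refine h3.congr' ?_
    filter_upwards [(tendsto_nhdsWithin_iff.1 h2).2] with k hk
    have hk' : F k r ≠ 0 := hk
    simp only [Function.comp_apply]
    field_simp [(hε k).ne']

variable {α₁ α₂ β₁ β₂ : ℝ → ℝ} {τ : ℝ} {F₁ F₂ : ℕ → ℝ → ℝ → ℝ}

/-- The coefficients of a semilinear equation on an interval are determined by the values at one
endpoint of the solutions with small constant data. -/
theorem coefficients_eq_of_semilinear (hN : Measurable N)
    (hNC : ∀ z, |z| ≤ 1 → |N z| ≤ C * z ^ 2)
    (hNb : Tendsto (fun z => N z / z ^ 2) (𝓝[≠] 0) (𝓝 (b / 2))) (hb : 0 < b)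
    (hα₁ : Measurable α₁) (hS₁ : ∀ s, |α₁ s| ≤ S) (hβ₁ : Measurable β₁) (hQ₁ : ∀ s, |β₁ s| ≤ Q)
    (hα₂ : Measurable α₂) (hS₂ : ∀ s, |α₂ s| ≤ S) (hβ₂ : Measurable β₂) (hQ₂ : ∀ s, |β₂ s| ≤ Q)
    (hε : ∀ k, 0 < ε k) (hε0 : Tendsto ε atTop (𝓝 0)) (hKε : ∀ k, K * ε k ≤ 1)
    (hF₁ : ∀ k t, Measurable (F₁ k t)) (hFK₁ : ∀ k t s, |F₁ k t s| ≤ K * ε k)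
    (hF₂ : ∀ k t, Measurable (F₂ k t)) (hFK₂ : ∀ k t s, |F₂ k t s| ≤ K * ε k)
    (h₁ : ∀ k, ∀ t ∈ Ioo 0 τ, ∀ s ∈ Ico 0 t,
      F₁ k t s = ε k - ∫ r in s..t, (α₁ r * F₁ k t r + β₁ r * N (F₁ k t r)))
    (h₂ : ∀ k, ∀ t ∈ Ioo 0 τ, ∀ s ∈ Ico 0 t,
      F₂ k t s = ε k - ∫ r in s..t, (α₂ r * F₂ k t r + β₂ r * N (F₂ k t r)))
    (h : ∀ᵐ t : ℝ, t ∈ Ioo 0 τ → ∀ k, F₁ k t 0 = F₂ k t 0) :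
    ∀ᵐ t : ℝ, t ∈ Ioo 0 τ → α₁ t = α₂ t ∧ β₁ t = β₂ t := by
  have e₁ := fun t (ht : t ∈ Ioo 0 τ) => expansion_of_semilinear hN hNC hNb hα₁ hS₁ hβ₁ hQ₁ hε hε0
    hKε (fun k => hF₁ k t) (fun k => hFK₁ k t) ht.1 (fun k => h₁ k t ht)
  have e₂ := fun t (ht : t ∈ Ioo 0 τ) => expansion_of_semilinear hN hNC hNb hα₂ hS₂ hβ₂ hQ₂ hε hε0
    hKε (fun k => hF₂ k t) (fun k => hFK₂ k t) ht.1 (fun k => h₂ k t ht)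
  have hi₁ := intervalIntegrable_of_abs_le hα₁ hS₁
  have hi₂ := intervalIntegrable_of_abs_le hα₂ hS₂
  have hA : ∀ᵐ t : ℝ, t ∈ Ioo 0 τ → ∫ s in (0 : ℝ)..t, (α₁ s - α₂ s) = 0 := by
    filter_upwards [h] with t ht htI
    have h3 : Real.exp (-∫ s in (0 : ℝ)..t, α₁ s) = Real.exp (-∫ s in (0 : ℝ)..t, α₂ s) :=
      tendsto_nhds_unique (e₁ t htI).1 ((e₂ t htI).1.congr fun k => by rw [ht htI k])
    rw [intervalIntegral.integral_sub (hi₁ _ _) (hi₂ _ _)]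
    have := Real.exp_injective h3
    linarith
  obtain ⟨hA1, hA2⟩ := ae_eq_zero_of_ae_integral_eq_zero (hα₁.sub hα₂) (P := S + S)
    (fun s => (abs_sub _ _).trans (add_le_add (hS₁ s) (hS₂ s))) hA
  have hA3 : ∀ t ∈ Ico 0 τ, ∫ s in (0 : ℝ)..t, α₁ s = ∫ s in (0 : ℝ)..t, α₂ s := by
    intro t ht
    rcases ht.1.eq_or_lt with rfl | h0
    · simp
    · have := hA1 t ⟨h0, ht.2⟩
      simp only [Pi.sub_apply] at this
      rw [intervalIntegral.integral_sub (hi₁ _ _) (hi₂ _ _)] at this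
      linarith
  set A : ℝ → ℝ := fun t => ∫ s in (0 : ℝ)..t, α₁ s with hAdef
  have hAc : Continuous A := continuous_primitive hi₁ 0
  have hsplit : ∀ (r t : ℝ), ∫ s in r..t, α₁ s = A t - A r := fun r t => by
    rw [hAdef]; exact (integral_interval_sub_left (hi₁ 0 t) (hi₁ 0 r)).symm
  have hsplit₂ : ∀ r ∈ Ico 0 τ, ∀ t ∈ Ico 0 τ, ∫ s in r..t, α₂ s = A t - A r :=
    fun r hr t ht => by
      rw [← integral_interval_sub_left (hi₂ 0 t) (hi₂ 0 r), ← hA3 t ht, ← hA3 r hr]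
  -- a bounded version of the exponential weight
  obtain ⟨R, hR⟩ := (isCompact_Icc (a := (0 : ℝ)) (b := τ)).exists_bound_of_continuousOn
    (f := fun t => Real.exp (A t)) (Real.continuous_exp.comp hAc).continuousOn
  -- The cut-off makes the weight globally bounded, as `ae_eq_zero_of_ae_integral_eq_zero` requires.
  set w : ℝ → ℝ := fun t => (Icc 0 τ).indicator (fun t => Real.exp (A t)) t with hw
  have hwm : Measurable w := (Real.continuous_exp.comp hAc).measurable.indicator measurableSet_Icc
  have hwb : ∀ t, |w t| ≤ |R| := by
    intro t
    by_cases ht : t ∈ Icc 0 τ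
    · rw [hw]; simp only [indicator_of_mem ht]; exact (hR t ht).trans (le_abs_self R)
    · rw [hw]; simp only [indicator_of_notMem ht, abs_zero]; positivity
  have hB : ∀ᵐ t : ℝ, t ∈ Ioo 0 τ → ∫ s in (0 : ℝ)..t, w s * (β₁ s - β₂ s) = 0 := by
    filter_upwards [h] with t ht htI
    have ht' : t ∈ Ico 0 τ := ⟨htI.1.le, htI.2⟩
    have l₁ := (e₁ t htI).2
    have l₂ := (e₂ t htI).2
    rw [← hA3 t ht'] at l₂
    have h3 := tendsto_nhds_unique l₁ (l₂.congr fun k => by rw [ht htI k])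
    have hI : ∀ r ∈ uIcc 0 t, r ∈ Ico 0 τ := fun r hr => by
      rw [uIcc_of_le htI.1.le] at hr; exact ⟨hr.1, hr.2.trans_lt htI.2⟩
    have hw' : ∀ r ∈ uIcc 0 t, w r = Real.exp (A r) := fun r hr =>
      
      indicator_of_mem (s := Icc 0 τ) (show r ∈ Icc 0 τ from ⟨(hI r hr).1, (hI r hr).2.le⟩) _
    -- The dependence on `t` splits off as a nonzero factor, so the second-order limits give an
    -- integral up to `t` of a function independent of `t`.
    have hexp : ∀ r, Real.exp (-(A r)) * Real.exp (-(A t - A r)) ^ 2 =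
        Real.exp (-2 * A t) * Real.exp (A r) := fun r => by
      rw [← Real.exp_nat_mul, ← Real.exp_add, ← Real.exp_add]
      congr 1; push_cast; ring
    have h4 : ∫ r in (0 : ℝ)..t, Real.exp (-∫ s in (0 : ℝ)..r, α₁ s) *
        (β₁ r * (b / 2 * Real.exp (-∫ s in r..t, α₁ s) ^ 2)) =
        (b / 2 * Real.exp (-2 * A t)) * ∫ r in (0 : ℝ)..t, w r * β₁ r := by
      rw [← intervalIntegral.integral_const_mul]
      refine integral_congr fun r hr => ?_
      simp only [hsplit, hw' r hr]
      have h0 : A 0 = 0 := by simp [hAdef]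
      rw [h0, sub_zero]
      linear_combination (b / 2 * β₁ r) * hexp r
    have h5 : ∫ r in (0 : ℝ)..t, Real.exp (-∫ s in (0 : ℝ)..r, α₂ s) *
        (β₂ r * (b / 2 * Real.exp (-∫ s in r..t, α₂ s) ^ 2)) =
        (b / 2 * Real.exp (-2 * A t)) * ∫ r in (0 : ℝ)..t, w r * β₂ r := by
      rw [← intervalIntegral.integral_const_mul]
      refine integral_congr fun r hr => ?_
      simp only [hsplit₂ r (hI r hr) t ht', ← hA3 r (hI r hr), hw' r hr]
      linear_combination (b / 2 * β₂ r) * hexp r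
    rw [h4, h5] at h3
    have h6 := mul_left_cancel₀ (mul_pos (half_pos hb) (Real.exp_pos _)).ne' h3
    have hint : ∀ β : ℝ → ℝ, Measurable β → (∀ s, |β s| ≤ Q) →
        IntervalIntegrable (fun r => w r * β r) volume 0 t := fun β hβ hQ =>
      intervalIntegrable_of_abs_le (hwm.mul hβ) (P := |R| * Q) (fun s => by
        rw [Pi.mul_apply, abs_mul]; exact mul_le_mul (hwb s) (hQ s) (abs_nonneg _) (abs_nonneg _)) _ _
    simp only [mul_sub]
    rw [intervalIntegral.integral_sub (hint β₁ hβ₁ hQ₁) (hint β₂ hβ₂ hQ₂), h6, sub_self]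
  obtain ⟨-, hB2⟩ := ae_eq_zero_of_ae_integral_eq_zero (hwm.mul (hβ₁.sub hβ₂)) (P := |R| * (Q + Q))
    (fun s => by
      rw [Pi.mul_apply, abs_mul]
      exact mul_le_mul (hwb s) ((abs_sub _ _).trans (add_le_add (hQ₁ s) (hQ₂ s))) (abs_nonneg _)
        (abs_nonneg _)) hB
  filter_upwards [hA2, hB2] with t ha hβ ht
  refine ⟨sub_eq_zero.1 (ha ht), ?_⟩
  have h3 := hβ ht
  have h4 : w t = Real.exp (A t) := 
    indicator_of_mem (s := Icc 0 τ) (show t ∈ Icc 0 τ from ⟨ht.1.le, ht.2.le⟩) _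
  rw [Pi.mul_apply, h4] at h3
  exact sub_eq_zero.1 ((mul_eq_zero.1 h3).resolve_left (Real.exp_pos _).ne')

end OrbitExpansion



/-! ### Solutions by Picard iteration. -/

section Picard

open Filter

variable {P : Type*} [MeasurableSpace P] {τ : P → ℝ} {Φ : ℝ → P → P} {H : P → ℝ → ℝ} {L T ε : ℝ}

open Classical in
/-- The Picard iteration step for the transport equation with constant initial data `ε`. -/
def picardStep (τ : P → ℝ) (Φ : ℝ → P → P) (H : P → ℝ → ℝ) (ε : ℝ) (f : ℝ × P → ℝ) : ℝ × P → ℝ :=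
  fun q => if 0 < q.1 ∧ q.1 < τ q.2 then
    ε - ∫ s, if 0 < s ∧ s ≤ q.1 then H (Φ s q.2) (f (q.1 - s, Φ s q.2)) else 0
  else 0

theorem picardStep_of_not {f : ℝ × P → ℝ} {q : ℝ × P} (h : ¬ (0 < q.1 ∧ q.1 < τ q.2)) :
    picardStep τ Φ H ε f q = 0 := if_neg h

theorem picardStep_of_mem {f : ℝ × P → ℝ} {t : ℝ} {p : P} (h : 0 < t) (h' : t < τ p) :
    picardStep τ Φ H ε f (t, p) = ε - ∫ s in (0 : ℝ)..t, H (Φ s p) (f (t - s, Φ s p)) := by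
  unfold picardStep
  rw [if_pos ⟨h, h'⟩, intervalIntegral.integral_of_le h.le, ← integral_indicator measurableSet_Ioc]
  congr 2
  ext s
  by_cases hs : 0 < s ∧ s ≤ t
  · rw [if_pos hs, indicator_of_mem (show s ∈ Ioc 0 t from hs)]
  · rw [if_neg hs, indicator_of_notMem (show s ∉ Ioc 0 t from hs)]

theorem measurable_comp_orbit (hΦ : Measurable fun q : ℝ × P => Φ q.1 q.2)
    (hH : Measurable fun q : P × ℝ => H q.1 q.2) {f : ℝ × P → ℝ} (hf : Measurable f) (t : ℝ) (p : P) :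
    Measurable fun s => H (Φ s p) (f (t - s, Φ s p)) := by
  have h1 : Measurable fun s => Φ s p := hΦ.comp (measurable_id.prodMk measurable_const)
  exact hH.comp (h1.prodMk (hf.comp ((measurable_const.sub measurable_id).prodMk h1)))

theorem measurable_picardStep (hτ : Measurable τ) (hΦ : Measurable fun q : ℝ × P => Φ q.1 q.2)
    (hH : Measurable fun q : P × ℝ => H q.1 q.2) {f : ℝ × P → ℝ} (hf : Measurable f) :
    Measurable (picardStep τ Φ H ε f) := by
  classical
  unfold picardStep
  have hset : MeasurableSet {q : ℝ × P | 0 < q.1 ∧ q.1 < τ q.2} :=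
    (measurableSet_lt measurable_const measurable_fst).inter
      (measurableSet_lt measurable_fst (hτ.comp measurable_snd))
  refine Measurable.ite hset (measurable_const.sub ?_) measurable_const
  have h1 : Measurable fun x : (ℝ × P) × ℝ => Φ x.2 x.1.2 :=
    hΦ.comp (measurable_snd.prodMk (measurable_snd.comp measurable_fst))
  have h2 : Measurable fun x : (ℝ × P) × ℝ =>
      if 0 < x.2 ∧ x.2 ≤ x.1.1 then H (Φ x.2 x.1.2) (f (x.1.1 - x.2, Φ x.2 x.1.2)) else 0 := by
    refine Measurable.ite ?_ ?_ measurable_const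
    · exact (measurableSet_lt measurable_const measurable_snd).inter
        (measurableSet_le measurable_snd (measurable_fst.comp measurable_fst))
    · exact hH.comp (h1.prodMk (hf.comp
        (((measurable_fst.comp measurable_fst).sub measurable_snd).prodMk h1)))
  exact (h2.stronglyMeasurable.integral_prod_right' (ν := (volume : Measure ℝ))).measurable

theorem integral_exp_weight (t : ℝ) :
    ∫ s in (0 : ℝ)..t, L * Real.exp (2 * L * (t - s)) = (Real.exp (2 * L * t) - 1) / 2 := by
  have h : ∀ s ∈ uIcc 0 t, HasDerivAt (fun s => -Real.exp (2 * L * (t - s)) / 2)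
      (L * Real.exp (2 * L * (t - s))) s := by
    intro s _
    have h1 : HasDerivAt (fun s => 2 * L * (t - s)) (2 * L * -1) s :=
      ((hasDerivAt_id s).const_sub t).const_mul (2 * L)
    refine (h1.exp.neg.div_const 2).congr_deriv ?_
    ring
  rw [intervalIntegral.integral_eq_sub_of_hasDerivAt h
    (by apply Continuous.intervalIntegrable; fun_prop)]
  simp
  ring

/-- Existence of bounded measurable solutions of a semilinear transport equation. -/
theorem exists_transport_solution (hτ : Measurable τ)
    (hΦ : Measurable fun q : ℝ × P => Φ q.1 q.2)
    (hH : Measurable fun q : P × ℝ => H q.1 q.2) (hL : 0 < L)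
    (hLip : ∀ p z z', |H p z - H p z'| ≤ L * |z - z'|) (hH0 : ∀ p, H p 0 = 0)
    (hT : ∀ p, τ p < T) (hT0 : 0 ≤ T) (hε : 0 ≤ ε) :
    ∃ f : ℝ × P → ℝ, Measurable f ∧ (∀ q, |f q| ≤ 2 * Real.exp (2 * L * T) * ε) ∧
      (∀ t p, ¬ (0 < t ∧ t < τ p) → f (t, p) = 0) ∧
      ∀ t p, 0 < t → t < τ p →
        f (t, p) = ε - ∫ s in (0 : ℝ)..t, H (Φ s p) (f (t - s, Φ s p)) := by
  set F : ℕ → ℝ × P → ℝ := fun k => (picardStep τ Φ H ε)^[k] fun _ => 0 with hFdef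
  have hF0 : F 0 = fun _ => 0 := rfl
  have hFs : ∀ k, F (k + 1) = picardStep τ Φ H ε (F k) := fun k =>
    Function.iterate_succ_apply' _ _ _
  have hFm : ∀ k, Measurable (F k) := by
    intro k
    induction k with
    | zero => exact measurable_const
    | succ k ih => rw [hFs]; exact measurable_picardStep hτ hΦ hH ih
  have hFn : ∀ k t p, ¬ (0 < t ∧ t < τ p) → F k (t, p) = 0 := by
    intro k t p h
    cases k with
    | zero => rfl
    | succ k => rw [hFs]; exact picardStep_of_not h
  have hHb : ∀ p z, |H p z| ≤ L * |z| := fun p z => by simpa [hH0] using hLip p z 0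
  have hFb : ∀ k, ∃ C, ∀ q, |F k q| ≤ C := by
    intro k
    induction k with
    | zero => exact ⟨0, fun q => by simp [hF0]⟩
    | succ k ih =>
      obtain ⟨C, hC⟩ := ih
      have hC0 : 0 ≤ L * |C| := by positivity
      refine ⟨ε + L * |C| * T, ?_⟩
      rintro ⟨t, p⟩
      by_cases h : 0 < t ∧ t < τ p
      · rw [hFs, picardStep_of_mem h.1 h.2]
        have h1 : |∫ s in (0 : ℝ)..t, H (Φ s p) (F k (t - s, Φ s p))| ≤ L * |C| * |t - 0| :=
          abs_integral_le_of_abs_le fun s => (hHb _ _).trans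
            (mul_le_mul_of_nonneg_left ((hC _).trans (le_abs_self C)) hL.le)
        rw [sub_zero, abs_of_pos h.1] at h1
        refine (abs_sub _ _).trans (add_le_add (abs_of_nonneg hε).le (h1.trans ?_))
        exact mul_le_mul_of_nonneg_left (h.2.le.trans (hT p).le) hC0
      · rw [hFn _ _ _ h, abs_zero]; positivity
  have hint : ∀ k t p, IntervalIntegrable (fun s => H (Φ s p) (F k (t - s, Φ s p))) volume 0 t := by
    intro k t p
    obtain ⟨C, hC⟩ := hFb k
    exact intervalIntegrable_of_abs_le (measurable_comp_orbit hΦ hH (hFm k) t p)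
      (P := L * |C|) (fun s => (hHb _ _).trans
        (mul_le_mul_of_nonneg_left ((hC _).trans (le_abs_self C)) hL.le)) _ _
  -- With the weight `exp(2 L t)` the step contracts by the factor `1 / 2`, by
  -- `integral_exp_weight`. The estimate is pointwise and uses no group property of `Φ`.
  have hstep : ∀ k t p, |F k (t, p) - F (k + 1) (t, p)| ≤
      ε * (1 / 2) ^ k * Real.exp (2 * L * |t|) := by
    intro k
    induction k with
    | zero =>
      intro t p
      by_cases h : 0 < t ∧ t < τ p
      · rw [hFs, picardStep_of_mem h.1 h.2, hF0]
        simp only [hH0, intervalIntegral.integral_zero, sub_zero, zero_sub, abs_neg, pow_zero,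
          mul_one, abs_of_nonneg hε]
        exact le_mul_of_one_le_right hε (Real.one_le_exp (by positivity))
      · rw [hFn _ _ _ h, hFn _ _ _ h, sub_zero, abs_zero]; positivity
    | succ k ih =>
      intro t p
      by_cases h : 0 < t ∧ t < τ p
      · rw [hFs (k + 1), picardStep_of_mem h.1 h.2]
        conv_lhs => rw [hFs k, picardStep_of_mem h.1 h.2]
        rw [sub_sub_sub_cancel_left, ← hFs k, ← intervalIntegral.integral_sub (hint _ t p)
          (hint _ t p)]
        have h1 : |∫ s in (0 : ℝ)..t, (H (Φ s p) (F (k + 1) (t - s, Φ s p)) -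
            H (Φ s p) (F k (t - s, Φ s p)))| ≤
            ∫ s in (0 : ℝ)..t, ε * (1 / 2) ^ k * (L * Real.exp (2 * L * (t - s))) := by
          have hc : Continuous fun s => ε * (1 / 2) ^ k * (L * Real.exp (2 * L * (t - s))) := by
            fun_prop
          rw [← Real.norm_eq_abs]
          refine intervalIntegral.norm_integral_le_of_norm_le h.1.le (ae_of_all _ fun s hs => ?_)
            (hc.intervalIntegrable (μ := volume) 0 t)
          rw [Real.norm_eq_abs]
          refine (hLip _ _ _).trans ?_
          have h2 := ih (t - s) (Φ s p)
          rw [abs_sub_comm, abs_of_nonneg (sub_nonneg.2 hs.2)] at h2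
          calc _ ≤ L * (ε * (1 / 2) ^ k * Real.exp (2 * L * (t - s))) :=
                mul_le_mul_of_nonneg_left h2 hL.le
            _ = _ := by ring
        refine h1.trans ?_
        rw [intervalIntegral.integral_const_mul, integral_exp_weight, abs_of_pos h.1,
          pow_succ]
        have h3 : 0 ≤ ε * (1 / 2) ^ k := by positivity
        nlinarith
      · rw [hFn _ _ _ h, hFn _ _ _ h, sub_zero, abs_zero]; positivity
  set D := ε * Real.exp (2 * L * T) with hD
  have hD0 : 0 ≤ D := by positivity
  have hdist : ∀ q k, dist (F k q) (F (k + 1) q) ≤ D * (1 / 2) ^ k := by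
    rintro ⟨t, p⟩ k
    rw [Real.dist_eq]
    by_cases h : 0 < t ∧ t < τ p
    · refine (hstep k t p).trans ?_
      rw [abs_of_pos h.1, hD, mul_right_comm]
      have : Real.exp (2 * L * t) ≤ Real.exp (2 * L * T) :=
        Real.exp_le_exp.2 (mul_le_mul_of_nonneg_left (h.2.trans (hT p)).le (by positivity))
      gcongr
    · rw [hFn _ _ _ h, hFn _ _ _ h, sub_zero, abs_zero]; positivity
  have hr : (1 / 2 : ℝ) < 1 := by norm_num
  have hlim : ∀ q, ∃ a, Tendsto (fun k => F k q) atTop (𝓝 a) := fun q =>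
    cauchySeq_tendsto_of_complete (cauchySeq_of_le_geometric _ D hr (hdist q))
  choose f hf using hlim
  have hfb : ∀ q, |f q| ≤ 2 * Real.exp (2 * L * T) * ε := by
    intro q
    have h1 := dist_le_of_le_geometric_of_tendsto₀ _ D hr (hdist q) (hf q)
    have h2 : F 0 q = 0 := rfl
    rw [h2, dist_comm, Real.dist_eq, sub_zero] at h1
    refine h1.trans_eq ?_
    rw [hD]; ring
  have hFf : ∀ k q, |F k q| ≤ 4 * D := by
    intro k q
    have h1 := dist_le_of_le_geometric_of_tendsto _ D hr (hdist q) (hf q) k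
    have h2 : |f q| ≤ 2 * D := (hfb q).trans_eq (by rw [hD]; ring)
    have h3 : D * (1 / 2) ^ k / (1 - 1 / 2) ≤ 2 * D := by
      have : (1 / 2 : ℝ) ^ k ≤ 1 := pow_le_one₀ (by norm_num) (by norm_num)
      have := mul_le_mul_of_nonneg_left this hD0
      rw [div_le_iff₀ (by norm_num)]
      linarith
    rw [Real.dist_eq] at h1
    have h4 := abs_sub_abs_le_abs_sub (F k q) (f q)
    linarith
  refine ⟨f, measurable_of_tendsto_metrizable hFm (tendsto_pi_nhds.2 hf), hfb, ?_, ?_⟩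
  · intro t p h
    exact tendsto_nhds_unique (hf (t, p)) (tendsto_const_nhds.congr fun k => (hFn k t p h).symm)
  · intro t p h h'
    have h1 := (hf (t, p)).comp (tendsto_add_atTop_nat 1)
    have h2 : ∀ k, ((fun k => F k (t, p)) ∘ fun a => a + 1) k =
        ε - ∫ s in (0 : ℝ)..t, H (Φ s p) (F k (t - s, Φ s p)) := fun k => by
      simp only [Function.comp_apply, hFs, picardStep_of_mem h h']
    refine tendsto_nhds_unique (h1.congr h2) (tendsto_const_nhds.sub ?_)
    refine intervalIntegral.tendsto_integral_filter_of_dominated_convergence (fun _ => L * (4 * D))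
      (Eventually.of_forall fun k =>
        (measurable_comp_orbit hΦ hH (hFm k) t p).aestronglyMeasurable)
      (Eventually.of_forall fun k => Eventually.of_forall fun s _ =>
        (hHb _ _).trans (mul_le_mul_of_nonneg_left (hFf k _) hL.le))
      intervalIntegrable_const (Eventually.of_forall fun s _ => ?_)
    rw [tendsto_iff_norm_sub_tendsto_zero]
    have h3 := (tendsto_iff_norm_sub_tendsto_zero.1 (hf (t - s, Φ s p))).const_mul L
    rw [mul_zero] at h3
    exact squeeze_zero (fun _ => norm_nonneg _) (fun k => hLip _ _ _) h3

end Picard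



/-! ### Existence of measurements for small constant data. -/

section Existence

open Filter

/-- A class of essentially bounded functions has a bounded measurable representative. -/
theorem exists_bounded_representative {X : Type*} [MeasurableSpace X] {μ : Measure X} {f : X → ℝ}
    (hf : MemLp f ∞ μ) :
    ∃ (f' : X → ℝ) (C : ℝ), Measurable f' ∧ 0 ≤ C ∧ (∀ x, |f' x| ≤ C) ∧ ∀ᵐ x ∂μ, f x = f' x := by
  set C := (eLpNorm f ∞ μ).toReal
  have hm := hf.1.stronglyMeasurable_mk.measurable
  refine ⟨fun x => max (-C) (min C (hf.1.mk f x)), C, measurable_const.max (measurable_const.min hm),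
    ENNReal.toReal_nonneg, fun x => ?_, ?_⟩
  · have hC : 0 ≤ C := ENNReal.toReal_nonneg
    exact abs_le.2 ⟨le_max_left _ _, max_le (by linarith) (min_le_left _ _)⟩
  · filter_upwards [hf.1.ae_eq_mk, ae_le_eLpNormEssSup (f := f) (μ := μ)] with x h1 h2
    rw [← h1]
    have h3 : |f x| ≤ C := by
      rw [← Real.norm_eq_abs, ← toReal_enorm]
      exact ENNReal.toReal_mono hf.2.ne (by rw [eLpNorm_exponent_top]; exact h2)
    rw [min_eq_right (abs_le.1 h3).2, max_eq_right (abs_le.1 h3).1]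

/-- Truncating the argument to `[-1, 1]` makes the nonlinearity globally Lipschitz, and small
solutions do not notice the truncation. -/
theorem lipschitz_clip {N : ℝ → ℝ} {C : ℝ} (hN : Differentiable ℝ N)
    (hC : ∀ z, |z| ≤ 1 → |deriv N z| ≤ C) (z z' : ℝ) :
    |N (max (-1) (min 1 z)) - N (max (-1) (min 1 z'))| ≤ C * |z - z'| := by
  have hmem : ∀ z : ℝ, max (-1) (min 1 z) ∈ Icc (-1 : ℝ) 1 := fun z =>
    ⟨le_max_left _ _, max_le (by norm_num) (min_le_left _ _)⟩
  have h1 := (convex_Icc (-1 : ℝ) 1).norm_image_sub_le_of_norm_deriv_le (f := N) (C := C)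
    (fun x _ => hN x) (fun x hx => hC x (abs_le.2 hx)) (hmem z') (hmem z)
  have hC0 : 0 ≤ C := (abs_nonneg _).trans (hC 0 (by simp))
  refine h1.trans (mul_le_mul_of_nonneg_left ?_ hC0)
  rw [Real.norm_eq_abs]
  refine (abs_max_sub_max_le_max _ _ _ _).trans ?_
  rw [sub_self, abs_zero, max_eq_right (abs_nonneg _)]
  refine (abs_min_sub_min_le_max _ _ _ _).trans ?_
  rw [sub_self, abs_zero, max_eq_right (abs_nonneg _)]

variable {n : ℕ} {M : Type*} [TopologicalSpace M] [T2Space M] [CompactSpace M]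
  [ChartedSpace (EuclideanHalfSpace (n + 1)) M] [IsManifold (𝓡∂ (n + 1)) ∞ M] {g : Metric n M}

theorem characteristicValue_of_backFlow (hnt : NonTrapping g) {σ : UnitBundle g → ℝ}
    {N : UnitBundle g → ℝ → ℝ} {f₀ : UnitBundle g → ℝ} {fm f : ℝ → UnitBundle g → ℝ} {t a : ℝ}
    {p : UnitBundle g}
    (hint : IntervalIntegrable (fun s => σ (backFlow g s p) * f (t - s) (backFlow g s p) +
      N (backFlow g s p) (f (t - s) (backFlow g s p))) volume 0 (min t (backwardTime g p)))
    (ha : a = (if t < backwardTime g p then f₀ (backFlow g t p)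
        else fm (t - backwardTime g p) (backFlow g (backwardTime g p) p)) -
      ∫ s in (0 : ℝ)..min t (backwardTime g p), (σ (backFlow g s p) * f (t - s) (backFlow g s p) +
        N (backFlow g s p) (f (t - s) (backFlow g s p)))) :
    CharacteristicValue g σ N f₀ fm f t p a := by
  refine ⟨fun t => backFlow g (-t) p, by simp [backFlow_zero],
    (backReach_backwardTime hnt p).isGeodesicOn, ?_, ?_⟩
  · simpa only [neg_neg] using hint
  · simpa only [neg_neg] using ha

/-- Restarting the equation at the intermediate point `φ₋ₛ(p)`: the flow property turns the solution
into a solution of a scalar integral equation along the orbit of `p`. -/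
theorem transport_solution_orbit (hnt : NonTrapping g) {f : ℝ × UnitBundle g → ℝ}
    {G : UnitBundle g → ℝ → ℝ} {ε : ℝ}
    (hf : ∀ t p, 0 < t → t < backwardTime g p →
      f (t, p) = ε - ∫ s in (0 : ℝ)..t, G (backFlow g s p) (f (t - s, backFlow g s p)))
    {s t : ℝ} {p : UnitBundle g} (hs : 0 ≤ s) (hst : s < t) (ht : t < backwardTime g p) :
    f (t - s, backFlow g s p) =
      ε - ∫ r in s..t, G (backFlow g r p) (f (t - r, backFlow g r p)) := by
  rw [hf _ _ (sub_pos.2 hst) (by rw [backwardTime_backFlow hnt hs (hst.trans ht).le]; linarith)]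
  congr 1
  have h := intervalIntegral.integral_comp_add_right (a := 0) (b := t - s)
    (fun r => G (backFlow g r p) (f (t - r, backFlow g r p))) s
  rw [zero_add, sub_add_cancel] at h
  rw [← h]
  refine intervalIntegral.integral_congr fun r hr => ?_
  rw [uIcc_of_le (sub_nonneg.2 hst.le)] at hr
  rw [backFlow_backFlow hnt hs hr.1 (by linarith [hr.2]), add_comm s r,
    show t - s - r = t - (r + s) by ring]

/-- A pointwise solution for bounded measurable coefficients gives the characteristic value for
coefficients that agree with these at almost every point of the orbit. -/
theorem characteristicValue_of_pointwise (hnt : NonTrapping g) {σ q σ' q' : UnitBundle g → ℝ}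
    (hσ' : Measurable σ') (hq' : Measurable q') {N : ℝ → ℝ} (hN : Measurable N) (hN0 : N 0 = 0)
    {S Q A : ℝ} (hS : ∀ p, |σ' p| ≤ S) (hQ : ∀ p, |q' p| ≤ Q) (hA : ∀ z, |z| ≤ 1 → |N z| ≤ A)
    {f : ℝ × UnitBundle g → ℝ} (hfm : Measurable f) (hf1 : ∀ x, |f x| ≤ 1)
    (hf0 : ∀ t p, ¬ (0 < t ∧ t < backwardTime g p) → f (t, p) = 0) {ε t : ℝ} {p : UnitBundle g}
    (hf : 0 < t → t < backwardTime g p → f (t, p) = ε - ∫ s in (0 : ℝ)..t,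
        (σ' (backFlow g s p) * f (t - s, backFlow g s p) +
          q' (backFlow g s p) * N (f (t - s, backFlow g s p))))
    (ht : 0 < t)
    (hae : ∀ᵐ s : ℝ, BackReach g s p →
      σ (backFlow g s p) = σ' (backFlow g s p) ∧ q (backFlow g s p) = q' (backFlow g s p)) :
    CharacteristicValue g σ (fun p z => q p * N z) (fun _ => ε) (fun _ _ => 0)
      (fun t p => f (t, p)) t p (f (t, p)) := by
  have hτ := backwardTime_nonneg hnt p
  have hmin : 0 ≤ min t (backwardTime g p) := le_min ht.le hτ
  have hΦ : Measurable fun s => backFlow g s p :=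
    (measurable_backFlow g).comp (measurable_id.prodMk measurable_const)
  have hfs : Measurable fun s => f (t - s, backFlow g s p) :=
    hfm.comp ((measurable_const.sub measurable_id).prodMk hΦ)
  have hmeas : Measurable fun s => σ' (backFlow g s p) * f (t - s, backFlow g s p) +
      q' (backFlow g s p) * N (f (t - s, backFlow g s p)) :=
    ((hσ'.comp hΦ).mul hfs).add ((hq'.comp hΦ).mul (hN.comp hfs))
  have hbd : ∀ s, |σ' (backFlow g s p) * f (t - s, backFlow g s p) +
      q' (backFlow g s p) * N (f (t - s, backFlow g s p))| ≤ S * 1 + Q * A := by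
    intro s
    have hS0 : 0 ≤ S := (abs_nonneg _).trans (hS p)
    have hQ0 : 0 ≤ Q := (abs_nonneg _).trans (hQ p)
    refine (abs_add_le _ _).trans (add_le_add ?_ ?_) <;> rw [abs_mul]
    · exact mul_le_mul (hS _) (hf1 _) (abs_nonneg _) hS0
    · exact mul_le_mul (hQ _) (hA _ (hf1 _)) (abs_nonneg _) hQ0
  have hcongr : ∀ᵐ s : ℝ, s ∈ uIoc 0 (min t (backwardTime g p)) →
      σ' (backFlow g s p) * f (t - s, backFlow g s p) +
        q' (backFlow g s p) * N (f (t - s, backFlow g s p)) =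
      σ (backFlow g s p) * f (t - s, backFlow g s p) +
        q (backFlow g s p) * N (f (t - s, backFlow g s p)) := by
    filter_upwards [hae] with s hs hmem
    rw [uIoc_of_le hmin] at hmem
    obtain ⟨h1, h2⟩ := hs ((backReach_iff_le hnt).2
      ⟨hmem.1.le, hmem.2.trans (min_le_right _ _)⟩)
    rw [h1, h2]
  refine characteristicValue_of_backFlow hnt ?_ ?_
  · refine (intervalIntegrable_of_abs_le hmeas hbd 0 _).congr_ae ?_
    rw [EventuallyEq, ae_restrict_iff' measurableSet_uIoc]
    exact hcongr
  · rw [← intervalIntegral.integral_congr_ae hcongr]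
    by_cases h : t < backwardTime g p
    · rw [if_pos h, min_eq_left h.le, hf ht h]
    -- If `t ≥ τ₋(p)`, the characteristic starts on the incoming boundary with value zero. All its
    -- points satisfy `t - s ≥ τ₋(φ₋ₛ(p))`, so `f` vanishes along it.
    · rw [if_neg h, hf0 t p (fun h' => h h'.2), zero_sub, eq_comm, neg_eq_zero]
      rw [min_eq_right (not_lt.1 h)]
      refine (intervalIntegral.integral_congr fun s hs => ?_).trans
        intervalIntegral.integral_zero
      rw [uIcc_of_le hτ] at hs
      rw [hf0, hN0, mul_zero, mul_zero, add_zero]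
      rw [backwardTime_backFlow hnt hs.1 hs.2]
      intro h'
      linarith [h'.2]

/-- Small constant initial data have a measurable solution, which is defined everywhere and attains
the outgoing trace. -/
theorem exists_measurement (hnt : NonTrapping g) (hconv : StrictlyConvexBoundary g)
    {σ q σ' q' : UnitBundle g → ℝ} (hσ' : Measurable σ') (hq' : Measurable q')
    (hσ : ∀ᵐ p ∂(sphereVolume g), σ p = σ' p) (hq : ∀ᵐ p ∂(sphereVolume g), q p = q' p)
    {N : ℝ → ℝ} (hN : Differentiable ℝ N) (hN0 : N 0 = 0)
    {S Q A L T₀ ε : ℝ} (hS : ∀ p, |σ' p| ≤ S) (hQ : ∀ p, |q' p| ≤ Q)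
    (hA : ∀ z, |z| ≤ 1 → |deriv N z| ≤ A) (hL : 0 < L) (hSQ : S + Q * A ≤ L) (hT₀ : 0 ≤ T₀)
    (hT : ∀ p, backwardTime g p < T₀) (hε : 0 ≤ ε) (hε1 : 2 * Real.exp (2 * L * T₀) * ε ≤ 1) :
    ∃ f : ℝ × UnitBundle g → ℝ, Measurable f ∧
      (∀ x, |f x| ≤ 2 * Real.exp (2 * L * T₀) * ε) ∧
      (∀ t p, 0 < t → t < backwardTime g p → f (t, p) = ε - ∫ s in (0 : ℝ)..t,
        (σ' (backFlow g s p) * f (t - s, backFlow g s p) +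
          q' (backFlow g s p) * N (f (t - s, backFlow g s p)))) ∧
      ∀ T, IsMeasurement g T σ (fun p z => q p * N z) (fun _ => ε) (fun _ _ => 0)
        fun t p => f (t, p) := by
  have hclip : ∀ z : ℝ, |z| ≤ 1 → max (-1) (min 1 z) = z := fun z hz => by
    rw [min_eq_right (abs_le.1 hz).2, max_eq_right (abs_le.1 hz).1]
  have hNm : Measurable N := hN.continuous.measurable
  have hA0 : 0 ≤ A := (abs_nonneg _).trans (hA 0 (by simp))
  have hNA : ∀ z, |z| ≤ 1 → |N z| ≤ A := by
    intro z hz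
    have h := lipschitz_clip hN hA z 0
    rw [hclip z hz, hclip 0 (by simp), hN0, sub_zero, sub_zero] at h
    exact h.trans (mul_le_of_le_one_right hA0 hz)
  obtain ⟨f, hfm, hfb, hf0, hf⟩ := exists_transport_solution (measurable_backwardTime hnt)
    (measurable_backFlow g) (H := fun p z => σ' p * z + q' p * N (max (-1) (min 1 z))) (L := L)
    (T := T₀) (ε := ε)
    (((hσ'.comp measurable_fst).mul measurable_snd).add ((hq'.comp measurable_fst).mul
      (hNm.comp (measurable_const.max (measurable_const.min measurable_snd))))) hL
    (fun p z z' => by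
      have hd := abs_nonneg (z - z')
      calc |σ' p * z + q' p * N (max (-1) (min 1 z)) -
            (σ' p * z' + q' p * N (max (-1) (min 1 z')))|
          = |σ' p * (z - z') +
              q' p * (N (max (-1) (min 1 z)) - N (max (-1) (min 1 z')))| := by congr 1; ring
        _ ≤ S * |z - z'| + Q * (A * |z - z'|) := by
          refine (abs_add_le _ _).trans (add_le_add ?_ ?_) <;> rw [abs_mul]
          · exact mul_le_mul_of_nonneg_right (hS p) hd
          · exact mul_le_mul (hQ p) (lipschitz_clip hN hA z z') (abs_nonneg _)
              ((abs_nonneg _).trans (hQ p))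
        _ = (S + Q * A) * |z - z'| := by ring
        _ ≤ L * |z - z'| := mul_le_mul_of_nonneg_right hSQ hd)
    (fun p => by simp [hN0]) hT hT₀ hε
  have hf1 : ∀ x, |f x| ≤ 1 := fun x => (hfb x).trans hε1
  have hf' : ∀ t p, 0 < t → t < backwardTime g p → f (t, p) = ε - ∫ s in (0 : ℝ)..t,
        (σ' (backFlow g s p) * f (t - s, backFlow g s p) +
          q' (backFlow g s p) * N (f (t - s, backFlow g s p))) := by
    intro t p h h'
    rw [hf t p h h']
    simp only [hclip _ (hf1 _)]
  refine ⟨f, hfm, hfb, hf', fun T => ?_⟩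
  -- The coefficients differ from their representatives only inside the measurable null set `B`,
  -- which almost every orbit avoids at almost every time.
  obtain ⟨B, hBsub, hBm, hB0⟩ : ∃ B, {p | ¬ (σ p = σ' p ∧ q p = q' p)} ⊆ B ∧ MeasurableSet B ∧
      sphereVolume g B = 0 := by
    have h : sphereVolume g {p | ¬ (σ p = σ' p ∧ q p = q' p)} = 0 := ae_iff.1 (hσ.and hq)
    exact ⟨toMeasurable _ _, subset_toMeasurable _ _, measurableSet_toMeasurable _ _,
      (measure_toMeasurable _).trans h⟩
  have hgood : ∀ t p, 0 < t → (∀ᵐ s : ℝ, BackReach g s p → backFlow g s p ∉ B) →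
      CharacteristicValue g σ (fun p z => q p * N z) (fun _ => ε) (fun _ _ => 0)
      (fun t p => f (t, p)) t p (f (t, p)) := fun t p ht hp =>
    characteristicValue_of_pointwise hnt hσ' hq' hNm hN0 hS hQ hNA hfm hf1 hf0 (hf' t p) ht
      (hp.mono fun s hs hr => by
        by_contra h
        exact hs hr (hBsub h))
  have hmem : ∀ μ : Measure (ℝ × UnitBundle g), MemLp (fun z : ℝ × UnitBundle g => f (z.1, z.2)) ∞ μ :=
    fun μ => memLp_top_of_bound hfm.aestronglyMeasurable 1 (ae_of_all _ hf1)
  refine ⟨fun t p => f (t, p), ⟨hmem _, ?_⟩, hmem _, ?_⟩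
  · filter_upwards [Measure.quasiMeasurePreserving_fst.ae (ae_restrict_mem measurableSet_Ioo),
      Measure.quasiMeasurePreserving_snd.ae (ae_ae_backFlow_notMem hBm hB0)] with z h1 h2
    exact hgood _ _ h1.1 h2
  · filter_upwards [Measure.quasiMeasurePreserving_fst.ae (ae_restrict_mem measurableSet_Ioo),
      Measure.quasiMeasurePreserving_snd.ae (ae_outgoing_ae_backFlow_notMem hnt hconv hBm hB0)]
      with z h1 h2
    exact hgood _ _ h1.1 h2

end Existence



/-! ### From equal measurements to equal coefficients. -/

section Recovery

open Filter

variable {n : ℕ} {M : Type*} [TopologicalSpace M] [T2Space M] [CompactSpace M]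
  [ChartedSpace (EuclideanHalfSpace (n + 1)) M] [IsManifold (𝓡∂ (n + 1)) ∞ M] {g : Metric n M}

/-- If the solutions for two pairs of coefficients and a sequence of small constant initial data
agree on the outgoing boundary, then the coefficients agree. -/
theorem coefficients_eq_of_outgoing (hnt : NonTrapping g) (hconv : StrictlyConvexBoundary g)
    {T S Q C b K : ℝ} (hT : ∀ p, backwardTime g p < T) {σ₁ σ₂ q₁ q₂ : UnitBundle g → ℝ}
    (hσ₁ : Measurable σ₁) (hσ₂ : Measurable σ₂) (hq₁ : Measurable q₁) (hq₂ : Measurable q₂)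
    (hS₁ : ∀ p, |σ₁ p| ≤ S) (hS₂ : ∀ p, |σ₂ p| ≤ S) (hQ₁ : ∀ p, |q₁ p| ≤ Q)
    (hQ₂ : ∀ p, |q₂ p| ≤ Q) {N : ℝ → ℝ} (hN : Measurable N)
    (hNC : ∀ z, |z| ≤ 1 → |N z| ≤ C * z ^ 2)
    (hNb : Tendsto (fun z => N z / z ^ 2) (𝓝[≠] 0) (𝓝 (b / 2))) (hb : 0 < b)
    {ε : ℕ → ℝ} (hε : ∀ k, 0 < ε k) (hε0 : Tendsto ε atTop (𝓝 0)) (hKε : ∀ k, K * ε k ≤ 1)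
    {f₁ f₂ : ℕ → ℝ × UnitBundle g → ℝ} (hf₁ : ∀ k, Measurable (f₁ k))
    (hf₂ : ∀ k, Measurable (f₂ k)) (hK₁ : ∀ k x, |f₁ k x| ≤ K * ε k)
    (hK₂ : ∀ k x, |f₂ k x| ≤ K * ε k)
    (h₁ : ∀ k t p, 0 < t → t < backwardTime g p → f₁ k (t, p) = ε k - ∫ s in (0 : ℝ)..t,
      (σ₁ (backFlow g s p) * f₁ k (t - s, backFlow g s p) +
        q₁ (backFlow g s p) * N (f₁ k (t - s, backFlow g s p))))
    (h₂ : ∀ k t p, 0 < t → t < backwardTime g p → f₂ k (t, p) = ε k - ∫ s in (0 : ℝ)..t,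
      (σ₂ (backFlow g s p) * f₂ k (t - s, backFlow g s p) +
        q₂ (backFlow g s p) * N (f₂ k (t - s, backFlow g s p))))
    (h : ∀ k, ∀ᵐ z ∂(outgoingSpaceTime g T), f₁ k z = f₂ k z) :
    ∀ᵐ p ∂(sphereVolume g), σ₁ p = σ₂ p ∧ q₁ p = q₂ p := by
  have hB : MeasurableSet {p | ¬ (σ₁ p = σ₂ p ∧ q₁ p = q₂ p)} :=
    ((measurableSet_eq_fun hσ₁ hσ₂).inter (measurableSet_eq_fun hq₁ hq₂)).compl
  rw [ae_iff]
  refine null_of_ae_outgoing hnt hconv hB ?_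
  have hE : MeasurableSet {z : ℝ × UnitBundle g | ∀ k, f₁ k z = f₂ k z} := by
    rw [ofPred_forall]
    exact MeasurableSet.iInter fun k => measurableSet_eq_fun (hf₁ k) (hf₂ k)
  -- Equality for almost all `(t, p)` is turned into equality, for almost every outgoing `p`, at
  -- almost every `t` and for all `k` at once.
  have h3 := Measure.ae_ae_of_ae_prod (ae_all_iff.2 h)
  rw [Measure.ae_ae_comm hE] at h3
  filter_upwards [h3] with p hp
  rw [ae_restrict_iff' measurableSet_Ioo] at hp
  have hΦ : Measurable fun s => backFlow g s p :=
    (measurable_backFlow g).comp (measurable_id.prodMk measurable_const)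
  have hline : ∀ t : ℝ, Measurable fun s => (t - s, backFlow g s p) := fun t =>
    (measurable_const.sub measurable_id).prodMk hΦ
  have key := coefficients_eq_of_semilinear (τ := backwardTime g p) hN hNC hNb hb
    (hσ₁.comp hΦ) (fun s => hS₁ _) (hq₁.comp hΦ) (fun s => hQ₁ _)
    (hσ₂.comp hΦ) (fun s => hS₂ _) (hq₂.comp hΦ) (fun s => hQ₂ _) hε hε0 hKε
    (F₁ := fun k t s => f₁ k (t - s, backFlow g s p))
    (F₂ := fun k t s => f₂ k (t - s, backFlow g s p))
    (fun k t => (hf₁ k).comp (hline t)) (fun k t s => hK₁ k _)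
    (fun k t => (hf₂ k).comp (hline t)) (fun k t s => hK₂ k _)
    (fun k t ht s hs => transport_solution_orbit hnt (G := fun p z => σ₁ p * z + q₁ p * N z)
      (h₁ k) hs.1 hs.2 ht.2)
    (fun k t ht s hs => transport_solution_orbit hnt (G := fun p z => σ₂ p * z + q₂ p * N z)
      (h₂ k) hs.1 hs.2 ht.2)
    (hp.mono fun t ht hmem k => by
      simp only [sub_zero, backFlow_zero]
      exact ht ⟨hmem.1, hmem.2.trans (hT p)⟩ k)
  filter_upwards [key, Measure.ae_ne volume (0 : ℝ), Measure.ae_ne volume (backwardTime g p)]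
    with s hs hs0 hsτ hreach hmem
  obtain ⟨h5, h6⟩ := (backReach_iff_le hnt).1 hreach
  exact hmem (hs ⟨h5.lt_of_ne hs0.symm, h6.lt_of_ne hsτ⟩)

/-- Only data `ε k → 0` matter. Their explicitly constructed solutions are admissible measurements
for the original coefficients, so the hypothesis compares these particular solutions on the outgoing
boundary. -/
theorem coefficients_eq_of_measurements (hnt : NonTrapping g) (hconv : StrictlyConvexBoundary g)
    {T₀ T : ℝ} (hT₀ : 0 ≤ T₀) (hτ : ∀ p, backwardTime g p < T₀) (hT : T₀ ≤ T)
    {σ₁ σ₂ q₁ q₂ : UnitBundle g → ℝ} (hσ₁ : MemLp σ₁ ∞ (sphereVolume g))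
    (hσ₂ : MemLp σ₂ ∞ (sphereVolume g)) (hq₁ : MemLp q₁ ∞ (sphereVolume g))
    (hq₂ : MemLp q₂ ∞ (sphereVolume g)) {N : ℝ → ℝ} {C A b δ : ℝ} (hN : Differentiable ℝ N)
    (hNC : ∀ z, |z| ≤ 1 → |N z| ≤ C * z ^ 2) (hA : ∀ z, |z| ≤ 1 → |deriv N z| ≤ A)
    (hN1 : deriv N 0 = 0) (hN2 : HasDerivAt (deriv N) b 0) (hb : 0 < b) (hδ : 0 < δ)
    (h : ∀ ε, 0 ≤ ε → ε ≤ δ → ∀ m₁ m₂ : ℝ → UnitBundle g → ℝ,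
      IsMeasurement g T σ₁ (fun p z => q₁ p * N z) (fun _ => ε) (fun _ _ => 0) m₁ →
      IsMeasurement g T σ₂ (fun p z => q₂ p * N z) (fun _ => ε) (fun _ _ => 0) m₂ →
      ∀ᵐ z ∂(outgoingSpaceTime g T), m₁ z.1 z.2 = m₂ z.1 z.2) :
    (∀ᵐ p ∂(sphereVolume g), σ₁ p = σ₂ p) ∧ ∀ᵐ p ∂(sphereVolume g), q₁ p = q₂ p := by
  obtain ⟨s₁, S₁, hs₁, hS₁0, hS₁, hs₁e⟩ := exists_bounded_representative hσ₁
  obtain ⟨s₂, S₂, hs₂, hS₂0, hS₂, hs₂e⟩ := exists_bounded_representative hσ₂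
  obtain ⟨r₁, R₁, hr₁, hR₁0, hR₁, hr₁e⟩ := exists_bounded_representative hq₁
  obtain ⟨r₂, R₂, hr₂, hR₂0, hR₂, hr₂e⟩ := exists_bounded_representative hq₂
  have hA0 : 0 ≤ A := (abs_nonneg _).trans (hA 0 (by simp))
  have hN0 : N 0 = 0 := by simpa using hNC 0 (by simp)
  set S := S₁ + S₂
  set R := R₁ + R₂
  have hS₁' : ∀ p, |s₁ p| ≤ S := fun p => (hS₁ p).trans (le_add_of_nonneg_right hS₂0)
  have hS₂' : ∀ p, |s₂ p| ≤ S := fun p => (hS₂ p).trans (le_add_of_nonneg_left hS₁0)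
  have hR₁' : ∀ p, |r₁ p| ≤ R := fun p => (hR₁ p).trans (le_add_of_nonneg_right hR₂0)
  have hR₂' : ∀ p, |r₂ p| ≤ R := fun p => (hR₂ p).trans (le_add_of_nonneg_left hR₁0)
  -- A Lipschitz constant for both truncated right-hand sides; the added one keeps it positive.
  set L := S + R * A + 1
  have hL : 0 < L := by positivity
  have hSQ : S + R * A ≤ L := by linarith
  set K := 2 * Real.exp (2 * L * T₀)
  have hK : 0 < K := by positivity
  -- Data below `δ` are covered by the hypothesis; data below `1 / K` have solutions bounded by one,
  -- so the truncation is inactive.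
  set d := min δ (1 / K)
  have hd : 0 < d := lt_min hδ (by positivity)
  set ε : ℕ → ℝ := fun k => d * (1 / ((k : ℝ) + 1))
  have hε : ∀ k, 0 < ε k := fun k => by positivity
  have hεd : ∀ k, ε k ≤ d := fun k => by
    refine mul_le_of_le_one_right hd.le ?_
    rw [div_le_one (by positivity)]
    linarith [(Nat.cast_nonneg k : (0 : ℝ) ≤ k)]
  have hε0 : Tendsto ε atTop (𝓝 0) := by
    have := (tendsto_one_div_add_atTop_nhds_zero_nat (𝕜 := ℝ)).const_mul d
    rwa [mul_zero] at this
  have hKε : ∀ k, K * ε k ≤ 1 := fun k => by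
    have := (hεd k).trans (min_le_right _ _)
    rwa [le_div_iff₀' hK] at this
  choose f₁ hf₁ hb₁ he₁ hm₁ using fun k => exists_measurement hnt hconv hs₁ hr₁ hs₁e hr₁e hN hN0
    hS₁' hR₁' hA hL hSQ hT₀ hτ (hε k).le (hKε k)
  choose f₂ hf₂ hb₂ he₂ hm₂ using fun k => exists_measurement hnt hconv hs₂ hr₂ hs₂e hr₂e hN hN0
    hS₂' hR₂' hA hL hSQ hT₀ hτ (hε k).le (hKε k)
  have hmain := coefficients_eq_of_outgoing hnt hconv (fun p => (hτ p).trans_le hT) hs₁ hs₂ hr₁ hr₂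
    hS₁' hS₂' hR₁' hR₂' hN.continuous.measurable hNC
    (tendsto_div_sq_of_hasDerivAt_deriv hN hN0 hN1 hN2) hb hε hε0 hKε hf₁ hf₂ hb₁ hb₂ he₁ he₂
    fun k => h (ε k) (hε k).le ((hεd k).trans (min_le_left _ _)) _ _ (hm₁ k T) (hm₂ k T)
  constructor
  · filter_upwards [hmain, hs₁e, hs₂e] with p h1 h2 h3
    rw [h2, h3, h1.1]
  · filter_upwards [hmain, hr₁e, hr₂e] with p h1 h2 h3
    rw [h2, h3, h1.2]

end Recovery

end TransportIP

end

/-! ### The main theorem. -/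

theorem theorem1p4 {n : ℕ} (hn : 1 ≤ n) {M : Type*} [TopologicalSpace M] [T2Space M]
    [CompactSpace M] [ChartedSpace (EuclideanHalfSpace (n + 1)) M]
    [IsManifold (𝓡∂ (n + 1)) ∞ M] (g : TransportIP.Metric n M)
    (hnontrapping : TransportIP.NonTrapping g)
    (hconvex : TransportIP.StrictlyConvexBoundary g) :
    ∃ T₀ : ℝ, 0 < T₀ ∧ ∀ T : ℝ, T₀ ≤ T →
      ∀ σ₁ σ₂ q₁ q₂ : TransportIP.UnitBundle g → ℝ,
        TransportIP.IsAbsorption g σ₁ → TransportIP.IsAbsorption g σ₂ →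
        MemLp q₁ ∞ (TransportIP.sphereVolume g) → MemLp q₂ ∞ (TransportIP.sphereVolume g) →
      ∀ (N₀ : ℝ → ℝ) (l : ℕ) (C₁ C₂ b : ℝ), 2 ≤ l → 0 < C₁ → 0 < C₂ →
        Differentiable ℝ N₀ →
        (∀ z, |N₀ z| ≤ C₁ * |z| ^ l) →
        (∀ z, |deriv N₀ z| ≤ C₂ * |z| ^ (l - 1)) →
        HasDerivAt (deriv N₀) b 0 → 0 < b →
      ∀ δ : ℝ, 0 < δ →
        (∀ h : TransportIP.UnitBundle g → ℝ,
          MemLp h ∞ (TransportIP.sphereVolume g) →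
          eLpNorm h ∞ (TransportIP.sphereVolume g) ≤ ENNReal.ofReal δ →
          ∀ m₁ m₂ : ℝ → TransportIP.UnitBundle g → ℝ,
            TransportIP.IsMeasurement g T σ₁ (fun p z => q₁ p * N₀ z) h (fun _ _ => 0) m₁ →
            TransportIP.IsMeasurement g T σ₂ (fun p z => q₂ p * N₀ z) h (fun _ _ => 0) m₂ →
            ∀ᵐ z ∂(TransportIP.outgoingSpaceTime g T), m₁ z.1 z.2 = m₂ z.1 z.2) →
        (∀ᵐ p ∂(TransportIP.sphereVolume g), σ₁ p = σ₂ p) ∧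
        (∀ᵐ p ∂(TransportIP.sphereVolume g), q₁ p = q₂ p) ∧
        (∀ᵐ p ∂(TransportIP.sphereVolume g), ∀ z : ℝ, q₁ p * N₀ z = q₂ p * N₀ z) := by
  obtain ⟨T₀, hT₀, hreach⟩ := TransportIP.exists_backReach_bound hnontrapping
  refine ⟨T₀, hT₀, ?_⟩
  intro T hT σ₁ σ₂ q₁ q₂ hσ₁ hσ₂ hq₁ hq₂ N₀ l C₁ C₂ b hl hC₁ hC₂ hN hN₁ hN₂ hb hb0 δ hδ h
  have hNC : ∀ z, |z| ≤ 1 → |N₀ z| ≤ C₁ * z ^ 2 := fun z hz => by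
    rw [← sq_abs z]
    exact (hN₁ z).trans (mul_le_mul_of_nonneg_left
      (pow_le_pow_of_le_one (abs_nonneg z) hz hl) hC₁.le)
  have hA : ∀ z, |z| ≤ 1 → |deriv N₀ z| ≤ C₂ := fun z hz =>
    (hN₂ z).trans (mul_le_of_le_one_right hC₂.le (pow_le_one₀ (abs_nonneg z) hz))
  have hN' : deriv N₀ 0 = 0 := by
    have h0 := hN₂ 0
    rw [abs_zero, zero_pow (by omega), mul_zero] at h0
    exact abs_nonpos_iff.1 h0
  obtain ⟨h1, h2⟩ := TransportIP.coefficients_eq_of_measurements hnontrapping hconvex hT₀.le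
    (fun p => hreach p _ (TransportIP.backReach_backwardTime hnontrapping p)) hT
    hσ₁.1 hσ₂.1 hq₁ hq₂ hN hNC hA hN' hb hb0 hδ
    -- The hypothesis is specialized to constant initial data.
    (fun ε hε hεδ m₁ m₂ hm₁ hm₂ => by
      have hbd : ∀ᵐ _p ∂(TransportIP.sphereVolume g), ‖ε‖ ≤ δ :=
        Filter.Eventually.of_forall fun _ => by rwa [Real.norm_of_nonneg hε]
      refine h (fun _ => ε) (memLp_top_of_bound aestronglyMeasurable_const δ hbd) ?_ m₁ m₂ hm₁ hm₂
      rw [eLpNorm_exponent_top]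
      exact eLpNormEssSup_le_of_ae_bound hbd)
  exact ⟨h1, h2, h2.mono fun p hp z => by rw [hp]⟩
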